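/- **Model.** A system has $m$ identical servers, a queue with buffer size $B\in\{0,1,2,\dots\}\cup\{\infty\}$, and starts empty at time $0$. Packets $i=1,\dots,n$ ($n\le\infty$) are generated at times $0\le s_1\le s_2\le\cdots$ and arrive at times $a_i\ge s_i$, in any order, with finitely many arrivals in every bounded time interval. The input $\mathcal I=(n,(s_i,a_i)_i,B)$ is arbitrary and given. The durations of the successive services started at the servers are i.i.d. exponential random variables with rate $\mu>0$; a preempted service is abandoned, and a later service of the same packet has a new duration. A *causal policy* decides (measurably) at time $0$, at every arrival and delivery, and at further times of its own choice, on the basis of the observed history of the system (not of the remaining service times) and possibly of a random seed independent of the service times, which packets of the system are put on the servers, which are kept in the queue, and which are dropped. A packet is on at most one server at a time, and at most $B$ packets wait in the queue. Preemption and idling are allowed. Let $\Pi$ be the set of causal policies. The *preemptive Last-Generated-First-Served* policy (prmp-LGFS) acts as follows. An arriving packet goes to an idle server if there is one; if all servers are busy and the packet was generated later than the packet under service with the smallest generation time, it preempts that packet, which goes back to the queue; otherwise the arriving packet goes to the queue. (A packet that is to be stored in a full queue is dropped.) After a delivery, a packet of the queue with the largest generation time, if any, is assigned to the idle server. Ties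 are broken arbitrarily. If packet $i$ is delivered at time $c_i$ under the policy $\pi$, and $u_0$ is the generation time of the freshest packet at the destination before time $0$ (the same for all policies), put $U_\pi(t)=\max(\{u_0\}\cup\{s_i:c_i\le t\})$ and let the age process be $\Delta_\pi=\{\Delta_\pi(t)=t-U_\pi(t),\ t\in[0,\infty)\}$. **Theorem.** For every $m$, $\mu$, $u_0$ and every input $\mathcal I$, the prmp-LGFS policy belongs to $\Pi$, and: 1. For every $\pi\in\Pi$, $[\Delta_{\text{prmp-LGFS}}\mid\mathcal I]\le_{\rm st}[\Delta_\pi\mid\mathcal I]$; that is, for all $k$, all $0\le t_1<\dots<t_k$ and every measurable upper set $S\subseteq\mathbb R^k$, $$\mathbb P\big((\Delta_{\text{prmp-LGFS}}(t_1),\dots,\Delta_{\text{prmp-LGFS}}(t_k))\in S\big)\le\mathbb P\big((\Delta_\pi(t_1),\dots,\Delta_\pi(t_k))\in S\big).$$ 2. For every measurable functional $g$ of right-continuous paths with left limits that is non-decreasing (that is, $g(\Delta_1)\le g(\Delta_2)$ whenever $\Delta_1(t)\le\Delta_2(t)$ for all $t\ge0$), such as the time-average age $\frac1T\int_0^T\Delta(t)\,dt$,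 $$\mathbb E[g(\Delta_{\text{prmp-LGFS}})\mid\mathcal I]=\min_{\pi\in\Pi}\mathbb E[g(\Delta_\pi)\mid\mathcal I],$$ provided the expectations exist (as elements of $[-\infty,\infty]$; the minimum is over the policies for which the expectation exists). -/

import Mathlib

open MeasureTheory ProbabilityTheory
open scoped NNReal ENNReal Topology

noncomputable section

namespace InfoUpdate

/-! ### Input data -/

/-- The given data: the number `n ≤ ∞` of packets, their generation times `s i` and arrival times
`a i`, and the buffer size `B ≤ ∞`. Packets are numbered `0, 1, 2, …` in the order of generation;
only the values at `i < n` matter. Arrivals may be in any order. -/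
structure Input where
  n : ℕ∞
  s : ℕ → ℝ
  a : ℕ → ℝ
  B : ℕ∞
  s_nonneg : ∀ i : ℕ, (i : ℕ∞) < n → 0 ≤ s i
  s_mono : ∀ i j : ℕ, i ≤ j → (j : ℕ∞) < n → s i ≤ s j
  s_le_a : ∀ i : ℕ, (i : ℕ∞) < n → s i ≤ a i
  /-- Only finitely many packets arrive in a bounded time. -/
  finite_arrivals : ∀ t : ℝ, {i : ℕ | (i : ℕ∞) < n ∧ a i ≤ t}.Finite

/-- `i` is the next packet to arrive when `A` is the set of packets that have arrived already
(simultaneous arrivals are handed over one by one). -/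
def Input.IsNext (I : Input) (A : Finset ℕ) (i : ℕ) : Prop :=
  (i : ℕ∞) < I.n ∧ i ∉ A ∧
    ∀ j : ℕ, (j : ℕ∞) < I.n → j ∉ A → I.a i < I.a j ∨ (I.a i = I.a j ∧ i ≤ j)

open Classical in
/-- The next packet to arrive, if there is one. -/
def Input.next (I : Input) (A : Finset ℕ) : Option ℕ :=
  if h : ∃ i, I.IsNext A i then some h.choose else none

/-! ### States and decisions -/

/-- The discrete part of the observable state of a system with `m` servers. -/
structure Status (m : ℕ) where
  /-- the packets that have arrived so far -/
  arrived : Finset ℕ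
  /-- the packets that have been delivered so far -/
  delivered : Finset ℕ
  /-- the packet under service at each server (`none`: the server is idle) -/
  serving : Fin m → Option ℕ
  /-- the packets waiting in the queue -/
  queue : Finset ℕ
  /-- a packet that has arrived at this very moment and has not been placed yet -/
  incoming : Option ℕ
  /-- the number of services that each server has started so far -/
  started : Fin m → ℕ

instance (m : ℕ) : MeasurableSpace (Status m) := ⊤

/-- The observable state of the system at an epoch (an arrival, a delivery, or a moment at which
the policy wanted to act). -/
structure Config (m : ℕ) extends Status m where
  /-- the current time -/
  time : ℝ
  /-- the time at which each server started its latest service -/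
  start : Fin m → ℝ

instance (m : ℕ) : MeasurableSpace (Config m) :=
  MeasurableSpace.comap (fun c : Config m => (c.toStatus, c.time, c.start)) inferInstance

/-- Which packets are put on the servers and which are kept in the queue; all others are
dropped. -/
structure Placement (m : ℕ) where
  serving : Fin m → Option ℕ
  queue : Finset ℕ

instance (m : ℕ) : MeasurableSpace (Placement m) := ⊤

/-- A decision: a placement of the packets, in force until the next epoch, and the delay after
which the policy wants to decide anew if no packet arrives or is delivered before
(`⊤`: it only waits for the next arrival or delivery). -/
structure Decision (m : ℕ) extends Placement m where
  delay : ℝ≥0∞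

instance (m : ℕ) : MeasurableSpace (Decision m) :=
  MeasurableSpace.comap (fun d : Decision m => (d.toPlacement, d.delay)) inferInstance

/-- The packet is in the system: under service, in the queue, or just arriving. -/
def Status.InSystem {m : ℕ} (c : Status m) (p : ℕ) : Prop :=
  (∃ j, c.serving j = some p) ∨ p ∈ c.queue ∨ c.incoming = some p

/-- A placement is feasible if it uses packets in the system only, puts no packet on two servers
and none both on a server and in the queue, and respects the buffer size `B`. Preemption,
idling and dropping are allowed. -/
structure Feasible {m : ℕ} (B : ℕ∞) (c : Status m) (d : Placement m) : Prop where
  serving_mem : ∀ j p, d.serving j = some p → c.InSystem p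
  queue_mem : ∀ p ∈ d.queue, c.InSystem p
  serving_inj : ∀ j j' p, d.serving j = some p → d.serving j' = some p → j = j'
  serving_queue : ∀ j p, d.serving j = some p → p ∉ d.queue
  queue_card : (d.queue.card : ℕ∞) ≤ B

/-! ### Dynamics -/

open Classical in
/-- The state right after a decision. A server that keeps its packet continues its service; a
server that gets another packet starts a new service now. -/
def Config.place {m : ℕ} (c : Config m) (d : Placement m) : Config m where
  arrived := c.arrived
  delivered := c.delivered
  serving := d.serving
  queue := d.queue
  incoming := none
  started j := if d.serving j ≠ none ∧ d.serving j ≠ c.serving j then c.started j + 1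
    else c.started j
  time := c.time
  start j := if d.serving j ≠ none ∧ d.serving j ≠ c.serving j then c.time else c.start j

/-- The initial state: time `0`, an empty system. -/
def Config.initial (m : ℕ) : Config m where
  arrived := ∅
  delivered := ∅
  serving _ := none
  queue := ∅
  incoming := none
  started _ := 0
  time := 0
  start _ := 0

/-- The time at which server `j` completes the service in progress, where `x j k` is the service
time of the `k`-th service (`k = 1, 2, …`) that server `j` starts; `⊤` for an idle server. -/
def Config.completion {m : ℕ} (x : Fin m → ℕ → ℝ) (c : Config m) (j : Fin m) : EReal :=
  match c.serving j with
  | some _ => ((c.start j + x j (c.started j) : ℝ) : EReal)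
  | none => ⊤

/-- The time of the next arrival (`⊤` if there is none). -/
def Config.nextArrival {m : ℕ} (I : Input) (c : Config m) : EReal :=
  match I.next c.arrived with
  | some i => (I.a i : EReal)
  | none => ⊤

/-- The time of the next epoch: the first completion, the next arrival or the moment chosen by the
policy, whichever comes first. -/
def Config.nextTime {m : ℕ} (I : Input) (x : Fin m → ℕ → ℝ) (c : Config m) (delay : ℝ≥0∞) :
    EReal :=
  min (⨅ j, c.completion x j) (min (c.nextArrival I) ((c.time : EReal) + (delay : EReal)))

/-- Server `j` delivers its packet at time `t`. -/
def Config.deliver {m : ℕ} (c : Config m) (t : ℝ) (j : Fin m) : Config m :=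
  { c with
    delivered := c.delivered ∪ (c.serving j).toFinset
    serving := Function.update c.serving j none
    time := t }

/-- Packet `i` arrives at time `t`. -/
def Config.arrive {m : ℕ} (c : Config m) (t : ℝ) (i : ℕ) : Config m :=
  { c with
    arrived := insert i c.arrived
    incoming := some i
    time := t }

open Classical in
/-- The state at the next epoch, from the state `c` right after a decision. Coinciding events are
handled one by one: deliveries in the order of the servers, then arrivals. If nothing is going to
happen any more, the state stays as it is. -/
def Config.advance {m : ℕ} (I : Input) (x : Fin m → ℕ → ℝ) (c : Config m) (delay : ℝ≥0∞) :
    Config m :=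
  let T := c.nextTime I x delay
  if T = ⊤ then c
  else if h : ∃ j, c.completion x j = T ∧ ∀ i < j, c.completion x i ≠ T then
    c.deliver T.toReal h.choose
  else if c.nextArrival I = T then
    match I.next c.arrived with
    | some i => c.arrive T.toReal i
    | none => c
  else { c with time := T.toReal }

/-! ### Policies -/

/-- A causal decision rule: the decision at epoch `k` is a function of the observable states at the
epochs `0, …, k` and of a private random seed with values in `E`. -/
abbrev Policy (m : ℕ) (E : Type*) : Type _ := E → (k : ℕ) → (Fin (k + 1) → Config m) → Decision m

/-- The observable states at the epochs `0, …, k` (each right before the decision taken there)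
under the policy `π` with seed `e` and service times `x`. -/
def run {m : ℕ} {E : Type*} (I : Input) (π : Policy m E) (e : E) (x : Fin m → ℕ → ℝ) :
    (k : ℕ) → Fin (k + 1) → Config m
  | 0 => fun _ => Config.initial m
  | k + 1 =>
    let h := run I π e x k
    let d := π e k h
    Fin.snoc (α := fun _ => Config m) h
      (((h (Fin.last k)).place d.toPlacement).advance I x d.delay)

/-- The observable state at epoch `k`. -/
def stateAt {m : ℕ} {E : Type*} (I : Input) (π : Policy m E) (e : E) (x : Fin m → ℕ → ℝ)
    (k : ℕ) : Config m :=
  run I π e x k (Fin.last k)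

/-- The set of causal policies for the input `I`: measurable causal decision rules all of whose
decisions are feasible. -/
def causalPolicies (m : ℕ) (E : Type*) [MeasurableSpace E] (I : Input) : Set (Policy m E) :=
  {π | (∀ k, Measurable fun q : E × (Fin (k + 1) → Config m) => π q.1 k q.2) ∧
    ∀ (e : E) (x : Fin m → ℕ → ℝ), (∀ j k, 0 < x j k) → ∀ k,
      Feasible I.B (stateAt I π e x k).toStatus (π e k (run I π e x k)).toPlacement}

open Classical in
/-- Put `p` into the queue `q` if there is room, drop it otherwise. -/
def store (B : ℕ∞) (q : Finset ℕ) (p : ℕ) : Finset ℕ :=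
  if (q.card : ℕ∞) < B then insert p q else q

open Classical in
/-- The placement of the preemptive Last-Generated-First-Served policy.
* A new packet `p` goes to an idle server if there is one. If all servers are busy and `p` is
  fresher than the stalest packet under service, it preempts that packet, which is stored back
  into the queue; otherwise `p` is stored in the queue.
* After a delivery, the freshest packet of the queue, if any, goes to the idle server. -/
def lgfsPlacement {m : ℕ} (I : Input) (c : Status m) : Placement m :=
  match c.incoming with
  | some p =>
    if h : ∃ j, c.serving j = none then
      ⟨Function.update c.serving h.choose (some p), c.queue⟩
    else if h : ∃ r : Fin m × ℕ, c.serving r.1 = some r.2 ∧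
        (∀ j q, c.serving j = some q → I.s r.2 ≤ I.s q) ∧ I.s r.2 < I.s p then
      ⟨Function.update c.serving h.choose.1 (some p), store I.B c.queue h.choose.2⟩
    else ⟨c.serving, store I.B c.queue p⟩
  | none =>
    if h : ∃ r : Fin m × ℕ, c.serving r.1 = none ∧ r.2 ∈ c.queue ∧
        ∀ q ∈ c.queue, I.s q ≤ I.s r.2 then
      ⟨Function.update c.serving h.choose.1 (some h.choose.2), c.queue.erase h.choose.2⟩
    else ⟨c.serving, c.queue⟩

/-- The preemptive Last-Generated-First-Served policy; it acts at arrivals and deliveries only. -/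
def prmpLGFS (m : ℕ) (E : Type*) (I : Input) : Policy m E :=
  fun _ k h => ⟨lgfsPlacement I (h (Fin.last k)).toStatus, ⊤⟩

/-! ### The age -/

/-- The packets whose service is completed at time `t` or before. -/
def deliveredBy {m : ℕ} {E : Type*} (I : Input) (π : Policy m E) (e : E) (x : Fin m → ℕ → ℝ)
    (t : ℝ) : Set ℕ :=
  {i | ∃ k, (stateAt I π e x k).time ≤ t ∧ i ∈ (stateAt I π e x k).delivered}

/-- The generation time `U(t)` of the freshest packet at the destination at time `t`; `u₀` is the
generation time of the freshest packet there before time `0`. -/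
def freshest {m : ℕ} {E : Type*} (I : Input) (u₀ : ℝ) (π : Policy m E) (e : E)
    (x : Fin m → ℕ → ℝ) (t : ℝ) : ℝ :=
  sSup (insert u₀ (I.s '' deliveredBy I π e x t))

/-- The age path `Δ(t) = t - U(t)`, `t ∈ [0, ∞)`. -/
def age {m : ℕ} {E : Type*} (I : Input) (u₀ : ℝ) (π : Policy m E) (e : E)
    (x : Fin m → ℕ → ℝ) : ℝ≥0 → ℝ :=
  fun t => (t : ℝ) - freshest I u₀ π e x t

/-! ### Stochastic order and expectations -/

/-- The multivariate stochastic order `X ≤_st Y` of random vectors. -/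
def StLE {Ω : Type*} [MeasurableSpace Ω] (P : Measure Ω) {n : ℕ} (X Y : Ω → Fin n → ℝ) : Prop :=
  ∀ S : Set (Fin n → ℝ), MeasurableSet S → IsUpperSet S → P (X ⁻¹' S) ≤ P (Y ⁻¹' S)

/-- The stochastic order of processes indexed by `[0, ∞)`. -/
def ProcessStLE {Ω : Type*} [MeasurableSpace Ω] (P : Measure Ω) (X Y : Ω → ℝ≥0 → ℝ) : Prop :=
  ∀ (n : ℕ) (t : Fin n → ℝ≥0), StrictMono t →
    StLE P (fun ω i => X ω (t i)) (fun ω i => Y ω (t i))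

/-- Right-continuous paths with left limits. -/
def IsCadlag (f : ℝ≥0 → ℝ) : Prop :=
  ∀ t, ContinuousWithinAt f (Set.Ici t) t ∧ ∃ l, Filter.Tendsto f (𝓝[<] t) (𝓝 l)

/-- Age penalty functionals: non-decreasing functionals of the age path, measurable with respect
to the evaluations at the times `t`. Only the values on right-continuous paths with left limits
matter. -/
structure IsAgePenalty (g : (ℝ≥0 → ℝ) → ℝ) : Prop where
  mono : ∀ f₁ f₂, IsCadlag f₁ → IsCadlag f₂ → (∀ t, f₁ t ≤ f₂ t) → g f₁ ≤ g f₂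
  measurable : Measurable fun f : {f : ℝ≥0 → ℝ // IsCadlag f} => g f.1

/-- The expectation of `Y` exists: its positive and negative parts do not both have an infinite
expectation. -/
def HasExpectation {Ω : Type*} [MeasurableSpace Ω] (P : Measure Ω) (Y : Ω → ℝ) : Prop :=
  ∫⁻ ω, ENNReal.ofReal (Y ω) ∂P ≠ ⊤ ∨ ∫⁻ ω, ENNReal.ofReal (-Y ω) ∂P ≠ ⊤

/-- The expectation of `Y`, with values in `[-∞, ∞]`. -/
def expectation {Ω : Type*} [MeasurableSpace Ω] (P : Measure Ω) (Y : Ω → ℝ) : EReal :=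
  ((∫⁻ ω, ENNReal.ofReal (Y ω) ∂P : ℝ≥0∞) : EReal) -
    ((∫⁻ ω, ENNReal.ofReal (-Y ω) ∂P : ℝ≥0∞) : EReal)

/-- The age process of the policy `π` when the service times are `X` and the seed is `ξ`. -/
def ageProcess {Ω : Type*} {m : ℕ} {E : Type*} (I : Input) (u₀ : ℝ) (X : Fin m → ℕ → Ω → ℝ)
    (ξ : Ω → E) (π : Policy m E) : Ω → ℝ≥0 → ℝ :=
  fun ω => age I u₀ π (ξ ω) (fun j k => X j k ω)

end InfoUpdate

end

noncomputable section

namespace InfoUpdate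

/-! The age depends only on which generation times have reached the destination, so it suffices to
couple prmp-LGFS with an arbitrary causal policy in such a way that, almost surely, the freshest
delivered packet is never staler under prmp-LGFS. Giving both policies the same service times at the
same servers does not achieve this, since the servers hold different packets and start services at
different times.

The coupling attaches clocks to ranks instead. The servers are ranked by decreasing generation times
of their packets, idle ones last, and `m` independent renewal processes with exponential gaps run
forever. Clock `l` completes the service at the server of rank `l`, and rings in vain if that server
is idle. By memorylessness the residual gaps are, given the seed and the observed history, always
independent with the original law, whether a service continues, is restarted, or passes to another
clock. Hence a causal policy produces the same law of the states with ranked clocks as in the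
original system: `map_advanceBy_gapsAfter` is the one-step statement, `map_chainStep` and
`map_run_serverGaps` propagate it, `map_stateAt_eq` concludes.

All policies now share the same ring times. If some policy delivers a packet generated at `v` when
clock `l` rings, then ranks `0, …, l` hold `l + 1` packets generated at `v` or later, all of which
have arrived (`exists_offered_of_mem_delivered`). Under prmp-LGFS, as long as nothing generated at
`v` or later is delivered, as many servers as possible hold such packets (`Config.TopServed`); so
the server of rank `l` holds one and delivers it at the same ring (`exists_delivered_of_offered`).
This invariant counts dropped packets too, which is why the buffer size plays no role.

The pathwise comparison `seqAge_prmpLGFS_le` orders the positive and negative parts of every age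
penalty. Indicators of upper sets are such penalties, so the stochastic order is a special case. -/

/-! ### Memoryless laws -/

/-- The properties of the exponential laws that are used: `ρ` is a continuous, memoryless law on
the positive reals with unbounded support. -/
structure IsMemoryless (ρ : Measure ℝ) : Prop where
  ae_pos : ∀ᵐ y ∂ρ, 0 < y
  measure_singleton : ∀ y, ρ {y} = 0
  measure_Iic_lt : ∀ t, ρ (Set.Iic t) < 1
  map_sub : ∀ y, 0 ≤ y → (ρ.restrict (Set.Ioi y)).map (fun z => z - y) = ρ (Set.Ioi y) • ρ

theorem expMeasure_Iic {r : ℝ} (hr : 0 < r) (x : ℝ) :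
    expMeasure r (Set.Iic x) =
      ENNReal.ofReal (if 0 ≤ x then 1 - Real.exp (-(r * x)) else 0) := by
  have := isProbabilityMeasure_expMeasure hr
  rw [← cdf_expMeasure_eq hr, cdf_eq_real, ofReal_measureReal]

theorem expMeasure_Ioi {r : ℝ} (hr : 0 < r) (x : ℝ) :
    expMeasure r (Set.Ioi x) = ENNReal.ofReal (if 0 ≤ x then Real.exp (-(r * x)) else 1) := by
  have := isProbabilityMeasure_expMeasure hr
  rw [← Set.compl_Iic, prob_compl_eq_one_sub measurableSet_Iic, expMeasure_Iic hr,
    ← ENNReal.ofReal_one, ← ENNReal.ofReal_sub]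
  · congr 1
    split_ifs <;> ring
  · split_ifs with h
    · have : Real.exp (-(r * x)) ≤ 1 := Real.exp_le_one_iff.2 (by nlinarith)
      linarith
    · exact le_rfl

/-- Memorylessness is tested on the half-lines `Set.Iic t`: both sides equal `exp (-(r * y)) * (1 -
exp (-(r * t)))` for `t ≥ 0` and vanish for `t < 0`. -/
theorem isMemoryless_expMeasure {r : ℝ} (hr : 0 < r) : IsMemoryless (expMeasure r) := by
  have := isProbabilityMeasure_expMeasure hr
  refine ⟨?_, fun y => ?_, fun t => ?_, fun y hy => ?_⟩
  · have : expMeasure r (Set.Iic 0) = 0 := by simp [expMeasure_Iic hr]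
    rw [ae_iff]
    convert this using 2
    ext; simp
  · have : expMeasure r ≪ volume := withDensity_absolutelyContinuous _ _
    exact this (by simp)
  · rw [expMeasure_Iic hr, ← ENNReal.ofReal_one]
    refine (ENNReal.ofReal_lt_ofReal_iff one_pos).2 ?_
    split_ifs
    · have := Real.exp_pos (-(r * t))
      linarith
    · exact one_pos
  · refine Measure.ext_of_Iic _ _ fun t => ?_
    have h1 : (fun z => z - y) ⁻¹' Set.Iic t ∩ Set.Ioi y = Set.Ioc y (t + y) := by
      ext z; simp only [Set.mem_inter_iff, Set.mem_preimage, Set.mem_Iic, Set.mem_Ioi, Set.mem_Ioc]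
      constructor <;> rintro ⟨h, h'⟩ <;> constructor <;> linarith
    rw [Measure.map_apply (by fun_prop) measurableSet_Iic,
      Measure.restrict_apply (measurableSet_Iic.preimage (by fun_prop)), h1, Measure.smul_apply,
      smul_eq_mul, expMeasure_Iic hr, expMeasure_Ioi hr, if_pos hy]
    rcases lt_or_ge t 0 with ht | ht
    · rw [Set.Ioc_eq_empty (by linarith), if_neg (not_le.2 ht)]; simp
    · rw [← Set.Iic_sdiff_Iic, measure_sdiff (Set.Iic_subset_Iic.2 (by linarith))
        nullMeasurableSet_Iic (by finiteness), expMeasure_Iic hr, expMeasure_Iic hr, if_pos hy,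
        if_pos (by linarith), if_pos ht, ← ENNReal.ofReal_mul (Real.exp_pos _).le,
        ← ENNReal.ofReal_sub]
      · congr 1
        have : Real.exp (-(r * (t + y))) = Real.exp (-(r * y)) * Real.exp (-(r * t)) := by
          rw [← Real.exp_add]; ring_nf
        rw [this]; ring
      · have : Real.exp (-(r * y)) ≤ 1 := Real.exp_le_one_iff.2 (by nlinarith)
        linarith

/-! ### Sequences of gaps -/

/-- The sequence with first entry `y`, followed by `w`. -/
def rowCons (y : ℝ) (w : ℕ → ℝ) : ℕ → ℝ
  | 0 => y
  | i + 1 => w i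

/-- The sequence without its first entry. -/
def rowTail (w : ℕ → ℝ) : ℕ → ℝ := fun i => w (i + 1)

/-- The sequence with its first entry decreased by `τ`. -/
def subHead (τ : ℝ) (w : ℕ → ℝ) : ℕ → ℝ := rowCons (w 0 - τ) (rowTail w)

@[simp] theorem rowCons_zero (y w) : rowCons y w 0 = y := rfl
@[simp] theorem rowCons_succ (y w i) : rowCons y w (i + 1) = w i := rfl
@[simp] theorem rowTail_apply (w i) : rowTail w i = w (i + 1) := rfl
@[simp] theorem rowTail_rowCons (y w) : rowTail (rowCons y w) = w := rfl
@[simp] theorem subHead_rowCons (τ y w) : subHead τ (rowCons y w) = rowCons (y - τ) w := rfl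
@[simp] theorem subHead_zero_apply (τ w) : subHead τ w 0 = w 0 - τ := rfl
@[simp] theorem subHead_succ_apply (τ w i) : subHead τ w (i + 1) = w (i + 1) := rfl

theorem measurable_rowCons : Measurable fun p : ℝ × (ℕ → ℝ) => rowCons p.1 p.2 := by
  refine measurable_pi_lambda _ fun i => ?_
  cases i
  · exact measurable_fst
  · exact (measurable_pi_apply _).comp measurable_snd

theorem measurable_rowTail : Measurable rowTail :=
  measurable_pi_lambda _ fun i => measurable_pi_apply (i + 1)

theorem measurable_subHead : Measurable fun p : ℝ × (ℕ → ℝ) => subHead p.1 p.2 :=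
  measurable_rowCons.comp
    ((((measurable_pi_apply 0).comp measurable_snd).sub measurable_fst).prodMk
      (measurable_rowTail.comp measurable_snd))

/-- The law of a sequence of independent gaps with law `ρ`. -/
def rowLaw (ρ : Measure ℝ) : Measure (ℕ → ℝ) := Measure.infinitePi fun _ => ρ

variable (ρ : Measure ℝ) [IsProbabilityMeasure ρ]

instance : IsProbabilityMeasure (rowLaw ρ) := by unfold rowLaw; infer_instance

/-- A box splits into its constraint on entry `0` and shifted constraints on the later entries, and
boxes determine an infinite product measure. This is what permits conditioning on the first gap. -/
theorem map_rowCons : (ρ.prod (rowLaw ρ)).map (fun p => rowCons p.1 p.2) = rowLaw ρ := by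
  classical
  refine Measure.eq_infinitePi _ fun s t ht => ?_
  have hpre : (fun p : ℝ × (ℕ → ℝ) => rowCons p.1 p.2) ⁻¹' Set.pi s t =
      (if 0 ∈ s then t 0 else Set.univ) ×ˢ
        Set.pi ↑(s.preimage Nat.succ Nat.succ_injective.injOn) (fun i => t (i + 1)) := by
    ext ⟨y, w⟩
    simp only [Set.mem_preimage, Set.mem_pi, Finset.mem_coe, Set.mem_prod, Finset.mem_preimage]
    constructor
    · intro h
      refine ⟨?_, fun i hi => h (i + 1) hi⟩
      split_ifs with h0
      · exact h 0 h0
      · trivial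
    · rintro ⟨h1, h2⟩ i hi
      cases i with
      | zero => rw [if_pos hi] at h1; exact h1
      | succ i => exact h2 i hi
  rw [Measure.map_apply measurable_rowCons (.pi s.countable_toSet fun _ _ => ht _), hpre,
    Measure.prod_prod, rowLaw, Measure.infinitePi_pi _ (fun i _ => ht _)]
  have hs : ∏ i ∈ s.preimage Nat.succ Nat.succ_injective.injOn, ρ (t (i + 1)) =
      ∏ i ∈ s.erase 0, ρ (t i) := by
    refine Finset.prod_bij (fun i _ => i + 1) ?_ ?_ ?_ ?_
    · intro i hi; simpa using hi
    · intro i _ j _ h; simpa using h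
    · intro i hi
      obtain ⟨h0, hi⟩ := Finset.mem_erase.1 hi
      obtain ⟨j, rfl⟩ := Nat.exists_eq_succ_of_ne_zero h0
      exact ⟨j, by simpa using hi, rfl⟩
    · intros; rfl
  rw [hs]
  split_ifs with h0
  · exact Finset.mul_prod_erase s (fun i => ρ (t i)) h0
  · rw [Finset.erase_eq_of_notMem h0]; simp

theorem rowLaw_apply {S : Set (ℕ → ℝ)} (hS : MeasurableSet S) :
    rowLaw ρ S = ∫⁻ y, rowLaw ρ {w | rowCons y w ∈ S} ∂ρ := by
  conv_lhs => rw [← map_rowCons, Measure.map_apply measurable_rowCons hS,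
    Measure.prod_apply (measurable_rowCons hS)]
  rfl

theorem measurePreserving_rowTail : MeasurePreserving rowTail (rowLaw ρ) (rowLaw ρ) := by
  refine ⟨measurable_rowTail, ?_⟩
  conv_lhs => rw [← map_rowCons, Measure.map_map measurable_rowTail measurable_rowCons]
  have : rowTail ∘ (fun p : ℝ × (ℕ → ℝ) => rowCons p.1 p.2) = Prod.snd := rfl
  rw [this, ← Measure.snd, Measure.snd_prod]

variable {ρ}

/-- There are no atoms, so closed and open tails agree. The closed version serves the rows that are
allowed to tie with the first one. -/
theorem IsMemoryless.map_sub_Ici {ρ : Measure ℝ} (hρ : IsMemoryless ρ) {y : ℝ} (hy : 0 ≤ y) :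
    (ρ.restrict (Set.Ici y)).map (fun z => z - y) = ρ (Set.Ici y) • ρ := by
  have : NullSingletonClass ρ := ⟨hρ.measure_singleton⟩
  rw [← restrict_Ioi_eq_restrict_Ici, ← measure_congr Ioi_ae_eq_Ici, hρ.map_sub y hy]

/-- Given that the first gap exceeds `y`, the remaining gaps have the original law. -/
theorem rowLaw_subHead {y : ℝ} {F : Set ℝ} (hF : MeasurableSet F)
    (h : (ρ.restrict F).map (fun z => z - y) = ρ F • ρ) {S : Set (ℕ → ℝ)}
    (hS : MeasurableSet S) :
    rowLaw ρ {w | w 0 ∈ F ∧ subHead y w ∈ S} = ρ F * rowLaw ρ S := by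
  have hsub : Measurable (subHead y) := measurable_subHead.comp measurable_prodMk_left
  have hmeas : MeasurableSet {w : ℕ → ℝ | w 0 ∈ F ∧ subHead y w ∈ S} :=
    ((measurable_pi_apply 0) hF).inter (hsub hS)
  have hm : Measurable fun z => rowLaw ρ {w | rowCons z w ∈ S} :=
    measurable_measure_prodMk_left (measurable_rowCons hS)
  -- Both sides are integrals over the first gap; `h` turns the scaled law on the right into the law
  -- of `z - y` for `z` in `F`.
  rw [rowLaw_apply ρ hmeas, rowLaw_apply ρ hS, ← smul_eq_mul, ← lintegral_smul_measure, ← h,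
    lintegral_map hm (by fun_prop), ← lintegral_indicator hF]
  refine lintegral_congr fun z => ?_
  by_cases hz : z ∈ F <;> simp [hz]

/-! ### The residual sequence of a renewal process -/

/-- The `n`-th renewal time `w 0 + ⋯ + w (n - 1)`. -/
def psum (w : ℕ → ℝ) (n : ℕ) : ℝ := ∑ i ∈ Finset.range n, w i

@[simp] theorem psum_zero (w) : psum w 0 = 0 := by simp [psum]

theorem psum_succ (w n) : psum w (n + 1) = psum w n + w n := Finset.sum_range_succ _ _

theorem psum_succ' (w n) : psum w (n + 1) = w 0 + psum (rowTail w) n := by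
  simp [psum, Finset.sum_range_succ', add_comm]

theorem psum_subHead (τ w n) : psum (subHead τ w) (n + 1) = psum w (n + 1) - τ := by
  rw [psum_succ', psum_succ']; simp [subHead]; ring

theorem measurable_psum (n : ℕ) : Measurable fun w => psum w n := by
  unfold psum; fun_prop

/-- Exactly `n` of the renewal times are not after `τ`. -/
def PassAt (τ : ℝ) (w : ℕ → ℝ) (n : ℕ) : Prop :=
  τ < psum w (n + 1) ∧ ∀ k < n, psum w (k + 1) ≤ τ

theorem PassAt.unique {τ w n n'} (h : PassAt τ w n) (h' : PassAt τ w n') : n = n' := by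
  rcases lt_trichotomy n n' with hn | hn | hn
  · exact absurd (h'.2 n hn) (not_le.2 h.1)
  · exact hn
  · exact absurd (h.2 n' hn) (not_le.2 h'.1)

theorem exists_passAt {τ w} (h : ∃ n, τ < psum w (n + 1)) : ∃ n, PassAt τ w n := by
  classical
  exact ⟨Nat.find h, Nat.find_spec h, fun k hk => not_lt.1 (Nat.find_min h hk)⟩

theorem passAt_zero {τ w} : PassAt τ w 0 ↔ τ < w 0 := by simp [PassAt, psum]

/-- Restarts the count at the first renewal. With `residualAt_succ` it drives the induction in
`rowLaw_passAt`. -/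
theorem passAt_succ {τ w n} :
    PassAt τ w (n + 1) ↔ w 0 ≤ τ ∧ PassAt (τ - w 0) (rowTail w) n := by
  unfold PassAt
  constructor
  · rintro ⟨h1, h2⟩
    refine ⟨by simpa [psum] using h2 0 (by omega), ?_, fun k hk => ?_⟩
    · rw [psum_succ'] at h1; linarith
    · have := h2 (k + 1) (by omega); rw [psum_succ'] at this; linarith
  · rintro ⟨h0, h1, h2⟩
    refine ⟨by rw [psum_succ']; linarith, fun k hk => ?_⟩
    cases k with
    | zero => simpa [psum] using h0
    | succ k => rw [psum_succ']; linarith [h2 k (by omega)]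

theorem measurableSet_passAt (n : ℕ) :
    MeasurableSet {p : ℝ × (ℕ → ℝ) | PassAt p.1 p.2 n} := by
  have h : ∀ k, Measurable fun p : ℝ × (ℕ → ℝ) => psum p.2 k :=
    fun k => (measurable_psum k).comp measurable_snd
  have hle : MeasurableSet {p : ℝ × (ℕ → ℝ) | ∀ k < n, psum p.2 (k + 1) ≤ p.1} := by
    simp only [Set.ofPred_forall]
    exact .iInter fun k => .iInter fun _ => measurableSet_le (h _) measurable_fst
  exact (measurableSet_lt measurable_fst (h _)).inter hle

/-- The gaps after time `τ`, if there are `n` renewals up to time `τ`. -/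
def residualAt (τ : ℝ) (w : ℕ → ℝ) (n : ℕ) : ℕ → ℝ :=
  rowCons (psum w (n + 1) - τ) fun i => w (n + 1 + i)

theorem residualAt_zero (τ w) : residualAt τ w 0 = subHead τ w := by
  funext i
  cases i <;> simp [residualAt, psum, add_comm]

theorem residualAt_succ (τ w n) :
    residualAt τ w (n + 1) = residualAt (τ - w 0) (rowTail w) n := by
  funext i
  cases i with
  | zero => simp only [residualAt, rowCons_zero]; rw [psum_succ']; ring
  | succ i => simp only [residualAt, rowCons_succ, rowTail_apply]; congr 1; omega

theorem measurable_residualAt (n : ℕ) :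
    Measurable fun p : ℝ × (ℕ → ℝ) => residualAt p.1 p.2 n := by
  refine measurable_rowCons.comp ((((measurable_psum _).comp measurable_snd).sub
    measurable_fst).prodMk (measurable_pi_lambda _ fun i =>
      (measurable_pi_apply _).comp measurable_snd))

open Classical in
/-- The gaps of the renewal process with gaps `w` after time `τ`. -/
def residual (τ : ℝ) (w : ℕ → ℝ) : ℕ → ℝ :=
  -- The default `w` concerns only sequences whose renewal times never exceed `τ`, a null event for
  -- a memoryless law.
  if h : ∃ n, PassAt τ w n then residualAt τ w h.choose else w

theorem PassAt.residual_eq {τ w n} (h : PassAt τ w n) : residual τ w = residualAt τ w n := by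
  have h' : ∃ n, PassAt τ w n := ⟨n, h⟩
  rw [residual, dif_pos h', h'.choose_spec.unique h]

theorem measurable_residual : Measurable fun p : ℝ × (ℕ → ℝ) => residual p.1 p.2 := by
  classical
  intro S hS
  have : (fun p : ℝ × (ℕ → ℝ) => residual p.1 p.2) ⁻¹' S =
      (⋃ n, {p | PassAt p.1 p.2 n} ∩ (fun p => residualAt p.1 p.2 n) ⁻¹' S) ∪
        ((⋃ n, {p | PassAt p.1 p.2 n})ᶜ ∩ Prod.snd ⁻¹' S) := by
    ext p
    simp only [Set.mem_preimage, Set.mem_union, Set.mem_iUnion, Set.mem_inter_iff,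
      Set.mem_ofPred_eq, Set.mem_compl_iff]
    by_cases h : ∃ n, PassAt p.1 p.2 n
    · obtain ⟨n, hn⟩ := h
      rw [hn.residual_eq]
      constructor
      · exact fun h' => Or.inl ⟨n, hn, h'⟩
      · rintro (⟨n', hn', h'⟩ | ⟨h', -⟩)
        · rwa [hn.unique hn']
        · exact absurd ⟨n, hn⟩ h'
    · rw [residual, dif_neg h]
      constructor
      · exact fun h' => Or.inr ⟨h, h'⟩
      · rintro (⟨n', hn', h'⟩ | ⟨-, h'⟩)
        · exact absurd ⟨n', hn'⟩ h
        · exact h'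
  rw [this]
  exact (MeasurableSet.iUnion fun n => (measurableSet_passAt n).inter
    (measurable_residualAt n hS)).union
      ((MeasurableSet.iUnion fun n => measurableSet_passAt n).compl.inter (measurable_snd hS))

theorem ae_rowLaw_pos (hρ : IsMemoryless ρ) : ∀ᵐ w ∂rowLaw ρ, ∀ i, 0 < w i := by
  rw [ae_all_iff]
  exact fun i => (measurePreserving_eval_infinitePi (fun _ : ℕ => ρ) i).quasiMeasurePreserving.ae
    hρ.ae_pos

/-- The first `n` gaps are all at most `N` with probability `ρ (Iic N) ^ n`, which tends to `0`. So
some gap exceeds `N`, and as gaps are positive, so does the renewal time at its end. -/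
theorem ae_rowLaw_exists_lt_psum (hρ : IsMemoryless ρ) :
    ∀ᵐ w ∂rowLaw ρ, ∀ t, ∃ n, t < psum w (n + 1) := by
  have key : ∀ N : ℕ, ∀ᵐ w ∂rowLaw ρ, ∃ i, (N : ℝ) < w i := by
    intro N
    rw [ae_iff]
    have hle : ∀ n : ℕ, rowLaw ρ {w | ¬∃ i, (N : ℝ) < w i} ≤ ρ (Set.Iic (N : ℝ)) ^ n := by
      intro n
      have : {w : ℕ → ℝ | ¬∃ i, (N : ℝ) < w i} ⊆
          Set.pi (Finset.range n : Set ℕ) fun _ => Set.Iic (N : ℝ) := by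
        intro w hw i _
        simp only [not_exists, not_lt, Set.mem_ofPred_eq] at hw
        exact hw i
      refine (measure_mono this).trans ?_
      rw [rowLaw, Measure.infinitePi_pi _ (fun _ _ => measurableSet_Iic)]
      simp
    exact le_antisymm (ge_of_tendsto'
      (ENNReal.tendsto_pow_atTop_nhds_zero_of_lt_one (hρ.measure_Iic_lt N)) hle) zero_le
  filter_upwards [ae_all_iff.2 key, ae_rowLaw_pos hρ] with w hw hpos t
  obtain ⟨N, hN⟩ := exists_nat_gt t
  obtain ⟨i, hi⟩ := hw N
  refine ⟨i, ?_⟩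
  rw [psum_succ]
  have : 0 ≤ psum w i := Finset.sum_nonneg fun j _ => (hpos j).le
  linarith

/-- Induction on `n`, conditioning on the first gap `y`. If `y ≤ τ`, the later gaps form the same
process observed at `τ - y`, with one renewal fewer; the case `n = 0` is memorylessness. Thus the
residual gaps are independent of the number of past renewals. -/
theorem rowLaw_passAt (hρ : IsMemoryless ρ) {S : Set (ℕ → ℝ)} (hS : MeasurableSet S) (n : ℕ) :
    ∀ τ : ℝ, 0 ≤ τ → rowLaw ρ {w | PassAt τ w n ∧ residualAt τ w n ∈ S} =
      rowLaw ρ {w | PassAt τ w n} * rowLaw ρ S := by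
  induction n with
  | zero =>
    intro τ hτ
    simp only [passAt_zero, residualAt_zero]
    have h := fun S hS => rowLaw_subHead (ρ := ρ) measurableSet_Ioi (hρ.map_sub τ hτ) (S := S) hS
    have h1 := h Set.univ .univ
    simp only [Set.mem_Ioi, Set.mem_univ, and_true, measure_univ, mul_one] at h1
    have h2 := h S hS
    simp only [Set.mem_Ioi] at h2
    rw [h2, h1]
  | succ n ih =>
    intro τ hτ
    have hP : ∀ n, MeasurableSet {w : ℕ → ℝ | PassAt τ w n} := fun n =>
      measurable_prodMk_left (measurableSet_passAt n)
    have hR : ∀ n, MeasurableSet {w : ℕ → ℝ | residualAt τ w n ∈ S} := fun n =>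
      measurable_prodMk_left (measurable_residualAt n hS)
    have hm : Measurable fun y => rowLaw ρ {w | rowCons y w ∈ {w | PassAt τ w (n + 1)}} :=
      measurable_measure_prodMk_left (measurable_rowCons (hP _))
    have hPR : MeasurableSet {w : ℕ → ℝ | PassAt τ w (n + 1) ∧ residualAt τ w (n + 1) ∈ S} :=
      (hP _).inter (hR _)
    rw [rowLaw_apply ρ hPR, rowLaw_apply ρ (hP _), ← lintegral_mul_const _ hm]
    refine lintegral_congr fun y => ?_
    simp only [Set.mem_ofPred_eq, passAt_succ, residualAt_succ, rowTail_rowCons, rowCons_zero]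
    by_cases hy : y ≤ τ
    · simp only [hy, true_and]
      exact ih (τ - y) (by linarith)
    · simp [hy]

/-- The residual gaps of a renewal process with memoryless gaps have the original law. -/
theorem measurePreserving_residual (hρ : IsMemoryless ρ) {τ : ℝ} (hτ : 0 ≤ τ) :
    MeasurePreserving (residual τ) (rowLaw ρ) (rowLaw ρ) := by
  have hmeas : Measurable (residual τ) := measurable_residual.comp measurable_prodMk_left
  refine ⟨hmeas, ?_⟩
  ext S hS
  rw [Measure.map_apply hmeas hS]
  have hP : ∀ n, MeasurableSet {w : ℕ → ℝ | PassAt τ w n} := fun n =>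
    measurable_prodMk_left (measurableSet_passAt n)
  -- The number of renewals up to `τ` partitions the space up to a null set, and the pieces computed
  -- in `rowLaw_passAt` are summed.
  have hdisj : Pairwise (Function.onFun Disjoint fun n => {w : ℕ → ℝ | PassAt τ w n}) := by
    intro i j hij
    exact Set.disjoint_left.2 fun w hi hj => hij (hi.unique hj)
  have htot : rowLaw ρ (⋃ n, {w | PassAt τ w n}) = 1 := by
    rw [← measure_univ (μ := rowLaw ρ)]
    refine measure_congr (Filter.eventuallyEq_univ.2 ?_)
    filter_upwards [ae_rowLaw_exists_lt_psum hρ] with w hw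
    simpa using exists_passAt (hw τ)
  have hdecomp : rowLaw ρ (residual τ ⁻¹' S) =
      rowLaw ρ (⋃ n, {w | PassAt τ w n ∧ residualAt τ w n ∈ S}) := by
    refine measure_congr ?_
    filter_upwards [ae_rowLaw_exists_lt_psum hρ] with w hw
    obtain ⟨n, hn⟩ := exists_passAt (hw τ)
    refine propext ⟨fun h => Set.mem_iUnion.2 ⟨n, hn, ?_⟩, fun h => ?_⟩
    · rw [← hn.residual_eq]; exact h
    · obtain ⟨n', hn', h'⟩ := Set.mem_iUnion.1 h
      change residual τ w ∈ S
      rw [hn'.residual_eq]; exact h'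
  rw [hdecomp, measure_iUnion]
  · simp_rw [rowLaw_passAt hρ hS _ τ hτ]
    rw [ENNReal.tsum_mul_right, ← measure_iUnion hdisj hP, htot, one_mul]
  · intro i j hij
    exact Set.disjoint_left.2 fun w hi hj => hij (hi.1.unique hj.1)
  · exact fun n => (hP n).inter (measurable_prodMk_left (measurable_residualAt n hS))

/-! ### Arrays of gaps -/

/-- The law of an array of independent gaps with law `ρ`. -/
def arrLaw (m : ℕ) (ρ : Measure ℝ) : Measure (Fin m → ℕ → ℝ) := Measure.pi fun _ => rowLaw ρ

instance (m : ℕ) (ρ : Measure ℝ) [IsProbabilityMeasure ρ] :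
    IsProbabilityMeasure (arrLaw m ρ) := by
  unfold arrLaw; infer_instance

section

variable {m : ℕ} {ρ : Measure ℝ} [IsProbabilityMeasure ρ]

/-- The law restricted to a product event and mapped row by row is again a product measure, with
factors `c i • rowLaw ρ`. So rows that are separately fresh after conditioning and transformation
are jointly fresh. -/
theorem arrLaw_rowwise {F : Fin m → Set (ℕ → ℝ)}
    {f : Fin m → (ℕ → ℝ) → ℕ → ℝ} (hf : ∀ i, Measurable (f i)) {c : Fin m → ℝ≥0∞}
    (h : ∀ i S, MeasurableSet S → rowLaw ρ (F i ∩ f i ⁻¹' S) = c i * rowLaw ρ S)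
    {S : Set (Fin m → ℕ → ℝ)} (hS : MeasurableSet S) :
    arrLaw m ρ {W | (∀ i, W i ∈ F i) ∧ (fun i => f i (W i)) ∈ S} = (∏ i, c i) * arrLaw m ρ S := by
  have hc : ∀ i, c i = rowLaw ρ (F i) := fun i => by simpa using (h i Set.univ .univ).symm
  have hfin : ∀ i, IsFiniteMeasure (c i • rowLaw ρ) := fun i =>
    Measure.smul_finite _ (by rw [hc]; finiteness)
  have hfun : Measurable fun (W : Fin m → ℕ → ℝ) i => f i (W i) := by fun_prop
  have e1 : Measure.pi (fun i => c i • rowLaw ρ) = (∏ i, c i) • arrLaw m ρ :=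
    Measure.pi_eq fun s hs => by simp [arrLaw, Measure.pi_pi, Finset.prod_mul_distrib]
  have e2 : Measure.pi (fun i => c i • rowLaw ρ) =
      ((arrLaw m ρ).restrict (Set.univ.pi F)).map fun W i => f i (W i) := by
    refine Measure.pi_eq fun s hs => ?_
    rw [Measure.map_apply hfun (.univ_pi hs), Measure.restrict_apply (hfun (.univ_pi hs))]
    have : (fun (W : Fin m → ℕ → ℝ) i => f i (W i)) ⁻¹' Set.univ.pi s ∩ Set.univ.pi F =
        Set.univ.pi fun i => F i ∩ f i ⁻¹' s i := by
      ext W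
      simp only [Set.mem_inter_iff, Set.mem_preimage, Set.mem_univ_pi]
      exact ⟨fun h i => ⟨h.2 i, h.1 i⟩, fun h => ⟨fun i => (h i).2, fun i => (h i).1⟩⟩
    rw [this, arrLaw, Measure.pi_pi]
    exact Finset.prod_congr rfl fun i _ => by rw [h i _ (hs i)]; simp
  have e3 := congrArg (fun M : Measure (Fin m → ℕ → ℝ) => M S) (e2.symm.trans e1)
  simp only [Measure.map_apply hfun hS, Measure.restrict_apply (hfun hS), Measure.smul_apply,
    smul_eq_mul] at e3
  rw [← e3]
  congr 1
  ext W
  simp only [Set.mem_inter_iff, Set.mem_preimage, Set.mem_univ_pi, Set.mem_ofPred_eq]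
  exact and_comm

theorem measurable_update_row (l : Fin m) :
    Measurable fun p : (ℕ → ℝ) × (Fin m → ℕ → ℝ) => Function.update p.2 l p.1 := by
  refine measurable_pi_lambda _ fun i => ?_
  by_cases h : i = l
  · subst h; simpa using measurable_fst
  · simp only [Function.update_of_ne h]
    exact (measurable_pi_apply i).comp measurable_snd

/-- Resampling row `l` independently leaves the law unchanged; this is conditioning on row `l` in a
form that keeps the index type `Fin m`. -/
theorem map_update_row (l : Fin m) :
    ((rowLaw ρ).prod (arrLaw m ρ)).map (fun p => Function.update p.2 l p.1) = arrLaw m ρ := by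
  refine (Measure.pi_eq fun s hs => ?_).symm
  rw [Measure.map_apply (measurable_update_row l) (.univ_pi hs)]
  have : (fun p : (ℕ → ℝ) × (Fin m → ℕ → ℝ) => Function.update p.2 l p.1) ⁻¹' Set.univ.pi s =
      s l ×ˢ Set.univ.pi (Function.update s l Set.univ) := by
    ext ⟨w, W⟩
    simp only [Set.mem_preimage, Set.mem_univ_pi, Set.mem_prod]
    constructor
    · refine fun h => ⟨by simpa using h l, fun i => ?_⟩
      by_cases hi : i = l
      · subst hi; simp
      · simpa [Function.update_of_ne hi] using h i
    · rintro ⟨h1, h2⟩ i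
      by_cases hi : i = l
      · subst hi; simpa using h1
      · simpa [Function.update_of_ne hi] using h2 i
  rw [this, Measure.prod_prod, arrLaw, Measure.pi_pi, ← Finset.mul_prod_erase _ _
    (Finset.mem_univ l), ← Finset.mul_prod_erase _ (fun i => rowLaw ρ (s i)) (Finset.mem_univ l)]
  simp only [Function.update_self, measure_univ, one_mul]
  congr 1
  exact Finset.prod_congr rfl fun i hi => by
    rw [Function.update_of_ne (Finset.ne_of_mem_erase hi)]

theorem arrLaw_apply_update (l : Fin m) {S : Set (Fin m → ℕ → ℝ)} (hS : MeasurableSet S) :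
    arrLaw m ρ S = ∫⁻ w, arrLaw m ρ {W | Function.update W l w ∈ S} ∂rowLaw ρ := by
  conv_lhs => rw [← map_update_row l, Measure.map_apply (measurable_update_row l) hS,
    Measure.prod_apply (measurable_update_row l hS)]
  rfl

theorem lintegral_rowLaw {f : (ℕ → ℝ) → ℝ≥0∞} (hf : Measurable f) :
    ∫⁻ w, f w ∂rowLaw ρ = ∫⁻ y, ∫⁻ w, f (rowCons y w) ∂rowLaw ρ ∂ρ := by
  conv_lhs => rw [← map_rowCons, lintegral_map hf measurable_rowCons]
  exact lintegral_prod _ (hf.comp measurable_rowCons).aemeasurable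

theorem arrLaw_apply_update_rowCons (l : Fin m) {S : Set (Fin m → ℕ → ℝ)}
    (hS : MeasurableSet S) :
    arrLaw m ρ S =
      ∫⁻ y, ∫⁻ w, arrLaw m ρ {W | Function.update W l (rowCons y w) ∈ S} ∂rowLaw ρ ∂ρ := by
  rw [arrLaw_apply_update l hS, lintegral_rowLaw]
  exact measurable_measure_prodMk_left (measurable_update_row l hS)

/-- Reindexing the rows preserves the law of an array. -/
theorem measurePreserving_comp_perm (σ : Equiv.Perm (Fin m)) :
    MeasurePreserving (fun W : Fin m → ℕ → ℝ => W ∘ σ) (arrLaw m ρ) (arrLaw m ρ) := by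
  have hm : Measurable fun W : Fin m → ℕ → ℝ => W ∘ σ :=
    measurable_pi_lambda _ fun i => measurable_pi_apply (σ i)
  refine ⟨hm, (Measure.pi_eq fun s hs => ?_).symm⟩
  rw [Measure.map_apply hm (.univ_pi hs)]
  have : (fun W : Fin m → ℕ → ℝ => W ∘ σ) ⁻¹' Set.univ.pi s =
      Set.univ.pi fun i => s (σ.symm i) := by
    ext W
    simp only [Set.mem_preimage, Set.mem_univ_pi, Function.comp]
    exact ⟨fun h i => by simpa using h (σ.symm i), fun h i => by simpa using h (σ i)⟩
  rw [this, arrLaw, Measure.pi_pi]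
  exact Equiv.prod_comp σ.symm fun i => rowLaw ρ (s i)

/-- Applying a measure preserving map to each row preserves the law of an array. -/
theorem measurePreserving_rowwise {f : Fin m → (ℕ → ℝ) → ℕ → ℝ}
    (hf : ∀ i, MeasurePreserving (f i) (rowLaw ρ) (rowLaw ρ)) :
    MeasurePreserving (fun (W : Fin m → ℕ → ℝ) i => f i (W i)) (arrLaw m ρ) (arrLaw m ρ) :=
  measurePreserving_pi _ _ hf

theorem ae_arrLaw_of_ae_rowLaw {p : (ℕ → ℝ) → Prop} (h : ∀ᵐ w ∂rowLaw ρ, p w) :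
    ∀ᵐ W ∂arrLaw m ρ, ∀ l, p (W l) := by
  rw [ae_all_iff]
  exact fun l => (measurePreserving_eval (fun _ : Fin m => rowLaw ρ) l).quasiMeasurePreserving.ae h

/-- A renewal time of one row differs from any independent time. -/
theorem ae_psum_ne (hρ : IsMemoryless ρ) (l : Fin m) (n : ℕ) {q : (Fin m → ℕ → ℝ) → ℝ}
    (hq : Measurable q) (hql : ∀ W w, q (Function.update W l w) = q W) :
    ∀ᵐ W ∂arrLaw m ρ, psum (W l) (n + 1) ≠ q W := by
  have hmeas : MeasurableSet {W : Fin m → ℕ → ℝ | ¬psum (W l) (n + 1) ≠ q W} := by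
    simp only [ne_eq, not_not]
    exact measurableSet_eq_fun ((measurable_psum _).comp (measurable_pi_apply l)) hq
  have hupd : Measurable fun p : ℝ × (ℕ → ℝ) × (Fin m → ℕ → ℝ) =>
      Function.update p.2.2 l (rowCons p.1 p.2.1) :=
    (measurable_update_row l).comp ((measurable_rowCons.comp
      (measurable_fst.prodMk (measurable_fst.comp measurable_snd))).prodMk
        (measurable_snd.comp measurable_snd))
  have hlaw : (ρ.prod ((rowLaw ρ).prod (arrLaw m ρ))).map (fun p =>
      Function.update p.2.2 l (rowCons p.1 p.2.1)) = arrLaw m ρ := by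
    ext S hS
    rw [Measure.map_apply hupd hS, arrLaw_apply_update_rowCons l hS,
      Measure.prod_apply (hupd hS)]
    refine lintegral_congr fun y => ?_
    rw [Measure.prod_apply (measurable_prodMk_left (hupd hS))]
    rfl
  -- Fubini with the first gap of row `l` innermost: once everything else is fixed, the equation
  -- determines that gap, and single points are null.
  rw [ae_iff, ← hlaw, Measure.map_apply hupd hmeas, Measure.prod_apply_symm (hupd hmeas)]
  refine (lintegral_congr fun p => ?_).trans lintegral_zero
  refine measure_mono_null ?_ (hρ.measure_singleton (q p.2 - psum p.1 n))
  intro y hy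
  simp only [ne_eq, not_not, Set.mem_preimage, Set.mem_ofPred_eq, Function.update_self, hql] at hy
  rw [psum_succ'] at hy
  simp only [rowCons_zero, rowTail_rowCons] at hy
  exact Set.mem_singleton_iff.2 (by linarith)

/-! ### The residual gaps after an event -/

open Classical in
/-- The gaps of the rows a time `τ` later, if no busy row has had a renewal: the first gap of the
busy rows is decreased, the others are subject to `Φ`. -/
def elapse (b : Fin m → Prop) (Φ : ℝ → (ℕ → ℝ) → ℕ → ℝ) (τ : ℝ) (W : Fin m → ℕ → ℝ) :
    Fin m → ℕ → ℝ :=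
  fun j => if b j then subHead τ (W j) else Φ τ (W j)

variable {b : Fin m → Prop} {Φ : ℝ → (ℕ → ℝ) → ℕ → ℝ}

/-- For a deterministic `τ` the event constrains each row separately. Busy rows are fresh by
memorylessness, idle rows by the assumption on `Φ`. -/
theorem arrLaw_elapse (hρ : IsMemoryless ρ) {τ : ℝ} (hτ : 0 ≤ τ)
    (hΦ : MeasurePreserving (Φ τ) (rowLaw ρ) (rowLaw ρ))
    {S : Set (Fin m → ℕ → ℝ)} (hS : MeasurableSet S) :
    arrLaw m ρ {W | (∀ j, b j → τ < W j 0) ∧ elapse b Φ τ W ∈ S} =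
      arrLaw m ρ {W | ∀ j, b j → τ < W j 0} * arrLaw m ρ S := by
  classical
  have key : ∀ S, MeasurableSet S →
      arrLaw m ρ {W | (∀ j, b j → τ < W j 0) ∧ elapse b Φ τ W ∈ S} =
      (∏ j, if b j then ρ (Set.Ioi τ) else 1) * arrLaw m ρ S := by
    intro S hS
    rw [← arrLaw_rowwise (F := fun j => {w | b j → τ < w 0})
      (f := fun j w => if b j then subHead τ w else Φ τ w) (fun j => ?_)
      (fun j T hT => ?_) hS]
    · rfl
    · by_cases hb : b j
      · simp only [hb, if_true]
        exact measurable_subHead.comp measurable_prodMk_left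
      · simpa [hb] using hΦ.measurable
    · by_cases hb : b j
      · simp only [hb, if_true, true_imp_iff]
        exact rowLaw_subHead measurableSet_Ioi (hρ.map_sub τ hτ) hT
      · simpa [hb] using hΦ.measure_preimage hT.nullMeasurableSet
  have h1 := key Set.univ .univ
  simp only [Set.mem_univ, and_true, measure_univ, mul_one] at h1
  rw [key S hS, h1]

/-- Row `l` has the first renewal among the busy rows (ties are broken by the order). -/
def IsFirst (b : Fin m → Prop) (l : Fin m) (W : Fin m → ℕ → ℝ) : Prop :=
  ∀ j, j ≠ l → b j → (j < l → W l 0 < W j 0) ∧ (l < j → W l 0 ≤ W j 0)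

theorem measurableSet_isFirst (b : Fin m → Prop) (l : Fin m) :
    MeasurableSet {W | IsFirst b l W} := by
  have h0 : ∀ j : Fin m, Measurable fun W : Fin m → ℕ → ℝ => W j 0 :=
    fun j => (measurable_pi_apply 0).comp (measurable_pi_apply j)
  have h1 : ∀ j, MeasurableSet {W : Fin m → ℕ → ℝ | W l 0 < W j 0} :=
    fun j => measurableSet_lt (h0 l) (h0 j)
  have h2 : ∀ j, MeasurableSet {W : Fin m → ℕ → ℝ | W l 0 ≤ W j 0} :=
    fun j => measurableSet_le (h0 l) (h0 j)
  unfold IsFirst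
  simp only [Set.ofPred_forall]
  refine .iInter fun j => .iInter fun _ => .iInter fun _ => ?_
  by_cases hj : j < l <;> by_cases hlj : l < j
  · exact absurd hlj hj.not_gt
  · simpa [hj, hlj] using h1 j
  · simpa [hj, hlj] using h2 j
  · simp [hj, hlj]

/-- The gaps right after a renewal of row `l`. -/
def afterRenewal (b : Fin m → Prop) (Φ : ℝ → (ℕ → ℝ) → ℕ → ℝ) (l : Fin m)
    (W : Fin m → ℕ → ℝ) : Fin m → ℕ → ℝ :=
  Function.update (elapse b Φ (W l 0) W) l (rowTail (W l))

theorem measurable_elapse (hΦm : Measurable fun p : ℝ × (ℕ → ℝ) => Φ p.1 p.2) :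
    Measurable fun p : ℝ × (Fin m → ℕ → ℝ) => elapse b Φ p.1 p.2 := by
  refine measurable_pi_lambda _ fun j => ?_
  have h : Measurable fun p : ℝ × (Fin m → ℕ → ℝ) => (p.1, p.2 j) :=
    measurable_fst.prodMk ((measurable_pi_apply j).comp measurable_snd)
  by_cases hb : b j
  · simp only [elapse, hb, if_true]
    exact measurable_subHead.comp h
  · simp only [elapse, hb, if_false]
    exact hΦm.comp h

theorem measurable_afterRenewal (hΦm : Measurable fun p : ℝ × (ℕ → ℝ) => Φ p.1 p.2) (l : Fin m) :
    Measurable (afterRenewal b Φ l) := by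
  have h0 : Measurable fun W : Fin m → ℕ → ℝ => (W l 0, W) :=
    ((measurable_pi_apply 0).comp (measurable_pi_apply l)).prodMk measurable_id
  exact (measurable_update_row l).comp
    ((measurable_rowTail.comp (measurable_pi_apply l)).prodMk ((measurable_elapse hΦm).comp h0))

/-- Given the first gap `y` of row `l`, the elapsed time is a constant and the event again splits
into rows, so the argument for a fixed time applies for each `y`. The set `C` records whatever else
is asked of the ring time. -/
theorem arrLaw_afterRenewal (hρ : IsMemoryless ρ)
    (hΦm : Measurable fun p : ℝ × (ℕ → ℝ) => Φ p.1 p.2)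
    (hΦ : ∀ τ, 0 ≤ τ → MeasurePreserving (Φ τ) (rowLaw ρ) (rowLaw ρ)) (l : Fin m)
    {C : Set ℝ} (hC : MeasurableSet C) {S : Set (Fin m → ℕ → ℝ)} (hS : MeasurableSet S) :
    arrLaw m ρ {W | (W l 0 ∈ C ∧ IsFirst b l W) ∧ afterRenewal b Φ l W ∈ S} =
      arrLaw m ρ {W | W l 0 ∈ C ∧ IsFirst b l W} * arrLaw m ρ S := by
  classical
  -- The condition that `IsFirst` puts on the first gap of row `j` when row `l` rings at `y`: strict
  -- before `l`, weak after it, none for idle rows and for `l` itself.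
  let F : ℝ → Fin m → Set ℝ := fun y j =>
    if j ≠ l ∧ b j then (if j < l then Set.Ioi y else Set.Ici y) else Set.univ
  have hFm : ∀ y j, MeasurableSet (F y j) := by
    intro y j
    simp only [F]
    split_ifs
    exacts [measurableSet_Ioi, measurableSet_Ici, .univ]
  let c : ℝ → ℝ≥0∞ := fun y => C.indicator (fun y => ∏ j, ρ (F y j)) y
  have hmE : MeasurableSet {W : Fin m → ℕ → ℝ | W l 0 ∈ C ∧ IsFirst b l W} :=
    (((measurable_pi_apply 0).comp (measurable_pi_apply l)) hC).inter (measurableSet_isFirst b l)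
  have key : ∀ S, MeasurableSet S →
      arrLaw m ρ {W | (W l 0 ∈ C ∧ IsFirst b l W) ∧ afterRenewal b Φ l W ∈ S} =
        ∫⁻ y, c y * arrLaw m ρ S ∂ρ := by
    intro S hS
    have hm : MeasurableSet {W : Fin m → ℕ → ℝ |
        (W l 0 ∈ C ∧ IsFirst b l W) ∧ afterRenewal b Φ l W ∈ S} :=
      hmE.inter (measurable_afterRenewal hΦm l hS)
    rw [arrLaw_apply_update_rowCons l hm]
    refine lintegral_congr_ae ?_
    filter_upwards [hρ.ae_pos] with y hy
    -- The right-hand side is disintegrated along row `l` as well: the tail `w`, which becomes the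
    -- new row `l`, then matches on both sides.
    rw [arrLaw_apply_update l hS, ← lintegral_const_mul]
    swap
    · exact measurable_measure_prodMk_left (measurable_update_row l hS)
    refine lintegral_congr fun w => ?_
    by_cases hyC : y ∈ C
    · have hSw : MeasurableSet {W : Fin m → ℕ → ℝ | Function.update W l w ∈ S} :=
        measurable_prodMk_left (measurable_update_row l hS)
      have := arrLaw_rowwise (ρ := ρ) (F := fun j => {w : ℕ → ℝ | w 0 ∈ F y j})
        (f := fun j w => if j = l then w else if b j then subHead y w else Φ y w)
        (c := fun j => ρ (F y j)) (fun j => ?_)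
        (fun j T hT => ?_) hSw
      · simp only [c, Set.indicator_of_mem hyC]
        rw [← this]
        congr 1
        ext W
        simp only [Set.mem_ofPred_eq, Function.update_self, rowCons_zero, hyC, true_and]
        refine and_congr ⟨fun h j => ?_, fun h j hj hb => ?_⟩ (Eq.to_iff (congrArg (· ∈ S) ?_))
        · by_cases hj : j ≠ l ∧ b j
          · have := h j hj.1 hj.2
            simp only [F, if_pos hj]
            rw [Function.update_of_ne hj.1] at this
            simp only [Function.update_self, rowCons_zero] at this
            rcases lt_or_gt_of_ne hj.1 with h' | h'
            · rw [if_pos h']; exact this.1 h'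
            · rw [if_neg h'.not_gt]; exact this.2 h'
          · simp only [F, if_neg hj, Set.mem_univ]
        · have := h j
          simp only [F, if_pos (And.intro hj hb)] at this
          rw [Function.update_of_ne hj]
          simp only [Function.update_self, rowCons_zero]
          refine ⟨fun h' => ?_, fun h' => ?_⟩
          · rw [if_pos h'] at this; exact this
          · rw [if_neg h'.not_gt] at this; exact this
        · funext j
          by_cases hj : j = l
          · subst hj; simp [afterRenewal]
          · simp [afterRenewal, elapse, hj]
      · by_cases hj : j = l
        · simp only [hj, if_true]
          exact measurable_id
        · by_cases hb : b j
          · simp only [hj, hb, if_true, if_false]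
            exact measurable_subHead.comp measurable_prodMk_left
          · simpa [hj, hb] using (hΦ y hy.le).measurable
      · by_cases hj : j = l
        · simp [F, hj]
        · by_cases hb : b j
          · have hmap : (ρ.restrict (F y j)).map (fun z => z - y) = ρ (F y j) • ρ := by
              simp only [F, if_pos (And.intro hj hb)]
              split_ifs
              · exact hρ.map_sub y hy.le
              · exact hρ.map_sub_Ici hy.le
            simp only [hj, if_false, hb, if_true]
            exact rowLaw_subHead (hFm y j) hmap hT
          · simpa [F, hj, hb] using (hΦ y hy.le).measure_preimage hT.nullMeasurableSet
    · simp [c, hyC]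
  have h1 := key Set.univ .univ
  simp only [Set.mem_univ, and_true, measure_univ, mul_one] at h1
  rw [key S hS, h1, lintegral_mul_const']
  finiteness

end

/-! ### Measurability of the observable states -/

section

variable {m : ℕ}

/-- Countability makes products of these discrete spaces discrete as well, so every function of a
status and a placement is measurable, whatever choices its definition contains. -/
instance : Countable (Status m) := by
  refine Function.Injective.countable (f := fun c : Status m =>
    (c.arrived, c.delivered, c.serving, c.queue, c.incoming, c.started)) ?_
  rintro ⟨⟩ ⟨⟩ h
  simpa using h

instance : Countable (Placement m) := by
  refine Function.Injective.countable (f := fun d : Placement m => (d.serving, d.queue)) ?_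
  rintro ⟨⟩ ⟨⟩ h
  simpa using h

instance : DiscreteMeasurableSpace (Status m) := ⟨fun _ => trivial⟩

instance : DiscreteMeasurableSpace (Placement m) := ⟨fun _ => trivial⟩

theorem Config.measurable_iff {α : Type*} [MeasurableSpace α] {f : α → Config m} :
    Measurable f ↔ Measurable (fun a => (f a).toStatus) ∧ Measurable (fun a => (f a).time) ∧
      Measurable fun a => (f a).start := by
  rw [measurable_comap_iff]
  refine ⟨fun h => ⟨measurable_fst.comp h, (measurable_fst.comp measurable_snd).comp h,
    (measurable_snd.comp measurable_snd).comp h⟩, fun h => h.1.prodMk (h.2.1.prodMk h.2.2)⟩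

theorem Config.measurable_toStatus : Measurable (Config.toStatus : Config m → Status m) :=
  (Config.measurable_iff.1 measurable_id).1

theorem Config.measurable_time : Measurable (Config.time : Config m → ℝ) :=
  (Config.measurable_iff.1 measurable_id).2.1

theorem Config.measurable_start : Measurable (Config.start : Config m → Fin m → ℝ) :=
  (Config.measurable_iff.1 measurable_id).2.2

theorem Decision.measurable_iff {α : Type*} [MeasurableSpace α] {f : α → Decision m} :
    Measurable f ↔ Measurable (fun a => (f a).toPlacement) ∧ Measurable fun a => (f a).delay := by
  rw [measurable_comap_iff]
  exact ⟨fun h => ⟨measurable_fst.comp h, measurable_snd.comp h⟩, fun h => h.1.prodMk h.2⟩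

theorem measurableSet_status (p : Status m → Prop) :
    MeasurableSet {c : Config m | p c.toStatus} :=
  Config.measurable_toStatus (MeasurableSet.of_discrete (s := {c | p c}))

/-- Serves for functions defined by case distinctions; the pieces may overlap. -/
theorem measurable_of_cover {α β ι : Type*} [MeasurableSpace α] [MeasurableSpace β] [Countable ι]
    {f : α → β} (A : ι → Set α) (g : ι → α → β) (hA : ∀ i, MeasurableSet (A i))
    (hg : ∀ i, Measurable (g i)) (hcov : ∀ a, ∃ i, a ∈ A i)
    (hfg : ∀ i, ∀ a ∈ A i, f a = g i a) : Measurable f := by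
  intro S hS
  have : f ⁻¹' S = ⋃ i, A i ∩ g i ⁻¹' S := by
    ext a
    simp only [Set.mem_preimage, Set.mem_iUnion, Set.mem_inter_iff]
    constructor
    · intro h
      obtain ⟨i, hi⟩ := hcov a
      exact ⟨i, hi, hfg i a hi ▸ h⟩
    · rintro ⟨i, hi, h⟩
      rw [hfg i a hi]; exact h
  rw [this]
  exact .iUnion fun i => (hA i).inter (hg i hS)

theorem measurable_place :
    Measurable fun p : Config m × Placement m => p.1.place p.2 := by
  classical
  have hst : Measurable fun p : Config m × Placement m => (p.1.toStatus, p.2) :=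
    (Config.measurable_toStatus.comp measurable_fst).prodMk measurable_snd
  have ht : Measurable fun p : Config m × Placement m => p.1.time :=
    Config.measurable_time.comp measurable_fst
  refine Config.measurable_iff.2 ⟨?_, ht, measurable_pi_lambda _ fun j => ?_⟩
  · let F : Status m × Placement m → Status m := fun q =>
      { arrived := q.1.arrived
        delivered := q.1.delivered
        serving := q.2.serving
        queue := q.2.queue
        incoming := none
        started := fun j => if q.2.serving j ≠ none ∧ q.2.serving j ≠ q.1.serving j
          then q.1.started j + 1 else q.1.started j }
    exact (Measurable.of_discrete (f := F)).comp hst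
  · refine Measurable.ite (hst (MeasurableSet.of_discrete (s := {q : Status m × Placement m |
      q.2.serving j ≠ none ∧ q.2.serving j ≠ q.1.serving j}))) ?_ ?_
    · exact Config.measurable_time.comp measurable_fst
    · exact (measurable_pi_apply j).comp (Config.measurable_start.comp measurable_fst)

theorem measurable_deliver (l : Fin m) :
    Measurable fun p : Config m × ℝ => p.1.deliver p.2 l := by
  have hs : Measurable fun p : Config m × ℝ => p.1.start :=
    Config.measurable_start.comp measurable_fst
  refine Config.measurable_iff.2 ⟨?_, measurable_snd, hs⟩
  exact (Measurable.of_discrete (f := fun c : Status m => { c with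
    delivered := c.delivered ∪ (c.serving l).toFinset
    serving := Function.update c.serving l none })).comp
      (Config.measurable_toStatus.comp measurable_fst)

theorem measurable_arrive (i : ℕ) :
    Measurable fun p : Config m × ℝ => p.1.arrive p.2 i := by
  have hs : Measurable fun p : Config m × ℝ => p.1.start :=
    Config.measurable_start.comp measurable_fst
  refine Config.measurable_iff.2 ⟨?_, measurable_snd, hs⟩
  exact (Measurable.of_discrete (f := fun c : Status m => { c with
    arrived := insert i c.arrived
    incoming := some i })).comp (Config.measurable_toStatus.comp measurable_fst)

theorem measurable_nextArrival (I : Input) :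
    Measurable fun c : Config m => c.nextArrival I :=
  (Measurable.of_discrete (f := fun c : Status m => (match I.next c.arrived with
    | some i => (I.a i : EReal)
    | none => ⊤ : EReal))).comp Config.measurable_toStatus

end

/-! ### The next arrival -/

theorem Input.next_spec {I : Input} {A : Finset ℕ} {i : ℕ} (h : I.next A = some i) :
    I.IsNext A i := by
  classical
  unfold Input.next at h
  split_ifs at h with h'
  obtain rfl := Option.some_injective _ h
  exact h'.choose_spec

/-- If `i` had not arrived, only finitely many packets would compete with it, and the lexicographic
minimum of (arrival time, index) among them would be next. -/
theorem Input.next_eq_none {I : Input} {A : Finset ℕ} (h : I.next A = none) {i : ℕ}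
    (hi : (i : ℕ∞) < I.n) : i ∈ A := by
  classical
  unfold Input.next at h
  split_ifs at h with h'
  by_contra hiA
  have hfin : {j : ℕ | ((j : ℕ∞) < I.n ∧ I.a j ≤ I.a i) ∧ j ∉ A}.Finite :=
    (I.finite_arrivals (I.a i)).subset fun j hj => hj.1
  obtain ⟨j, hj, hmin⟩ := hfin.toFinset.exists_min_image (fun j => toLex (I.a j, j))
    ⟨i, by simpa using ⟨hi, hiA⟩⟩
  simp only [Set.Finite.mem_toFinset, Set.mem_ofPred_eq, Prod.Lex.le_iff, ofLex_toLex] at hj hmin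
  refine h' ⟨j, hj.1.1, hj.2, fun k hk hkA => ?_⟩
  by_cases hki : I.a k ≤ I.a i
  · exact hmin k ⟨⟨hk, hki⟩, hkA⟩
  · exact Or.inl (hj.1.2.trans_lt (not_le.1 hki))

theorem Input.a_nonneg (I : Input) {i : ℕ} (hi : (i : ℕ∞) < I.n) : 0 ≤ I.a i :=
  (I.s_nonneg i hi).trans (I.s_le_a i hi)

section

variable {m : ℕ} {I : Input} {c : Config m}

theorem Config.nextArrival_eq_some {i : ℕ} (h : I.next c.arrived = some i) :
    c.nextArrival I = (I.a i : EReal) := by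
  simp only [Config.nextArrival, h]

theorem Config.nextArrival_eq_top (h : I.next c.arrived = none) : c.nextArrival I = ⊤ := by
  simp only [Config.nextArrival, h]

theorem Config.nextArrival_le {i : ℕ} (hi : (i : ℕ∞) < I.n) (hiA : i ∉ c.arrived) :
    c.nextArrival I ≤ (I.a i : EReal) := by
  cases h : I.next c.arrived with
  | none => exact absurd (Input.next_eq_none h hi) hiA
  | some j =>
    rw [Config.nextArrival_eq_some h]
    rcases (Input.next_spec h).2.2 i hi hiA with hlt | heq
    · exact_mod_cast hlt.le
    · exact_mod_cast heq.1.le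

/-! ### One step of the dynamics in terms of the residual service times -/

/-- The time of the next epoch unless a packet is delivered before. -/
def Config.deadline (I : Input) (c : Config m) (delay : ℝ≥0∞) : EReal :=
  min (c.nextArrival I) ((c.time : EReal) + (delay : EReal))

open Classical in
/-- The state at the next epoch if no packet is delivered before. -/
def Config.timeout (I : Input) (c : Config m) (delay : ℝ≥0∞) : Config m :=
  if c.deadline I delay = ⊤ then c
  else if c.nextArrival I = c.deadline I delay then
    match I.next c.arrived with
    | some i => c.arrive (c.deadline I delay).toReal i
    | none => c
  else { c with time := (c.deadline I delay).toReal }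

/-- Server `j` is busy. -/
def Config.Busy (c : Config m) (j : Fin m) : Prop := c.serving j ≠ none

/-- The state at the next epoch when `W j 0` is the residual service time at server `j`. -/
def Config.advanceBy (I : Input) (c : Config m) (delay : ℝ≥0∞) (W : Fin m → ℕ → ℝ) : Config m :=
  -- These service times make a busy server `j` complete at `c.time + W j 0`, whatever `c.start j`
  -- is.
  c.advance I (fun j _ => c.time + W j 0 - c.start j) delay

variable {delay : ℝ≥0∞} {W : Fin m → ℕ → ℝ}

theorem Config.completion_of_busy {x : Fin m → ℕ → ℝ} {j : Fin m} (h : c.Busy j) :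
    c.completion x j = ((c.start j + x j (c.started j) : ℝ) : EReal) := by
  unfold Config.completion
  cases h' : c.serving j with
  | none => exact absurd h' h
  | some _ => rfl

theorem Config.completion_of_idle {x : Fin m → ℕ → ℝ} {j : Fin m} (h : ¬c.Busy j) :
    c.completion x j = ⊤ := by
  unfold Config.completion
  rw [not_not.1 h]

theorem Config.advance_congr {x x' : Fin m → ℕ → ℝ}
    (h : ∀ j, c.Busy j → x j (c.started j) = x' j (c.started j)) :
    c.advance I x delay = c.advance I x' delay := by
  have hc : c.completion x = c.completion x' := by
    funext j
    by_cases hb : c.Busy j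
    · rw [Config.completion_of_busy hb, Config.completion_of_busy hb, h j hb]
    · rw [Config.completion_of_idle hb, Config.completion_of_idle hb]
  unfold Config.advance Config.nextTime
  rw [hc]

theorem Config.advance_eq_advanceBy {x : Fin m → ℕ → ℝ}
    (h : ∀ j, c.Busy j → W j 0 = c.start j + x j (c.started j) - c.time) :
    c.advance I x delay = c.advanceBy I delay W := by
  refine Config.advance_congr fun j hj => ?_
  rw [h j hj]; ring

/-- Deliveries precede a coinciding arrival or timer, hence `≤` in the deadline condition; `IsFirst`
breaks ties as `advance` does, which pins down the server chosen there. -/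
theorem Config.advanceBy_of_isFirst {l : Fin m} (hl : c.Busy l)
    (hd : ((c.time + W l 0 : ℝ) : EReal) ≤ c.deadline I delay) (hf : IsFirst c.Busy l W) :
    c.advanceBy I delay W = c.deliver (c.time + W l 0) l := by
  classical
  set x : Fin m → ℕ → ℝ := fun j _ => c.time + W j 0 - c.start j
  have hcomp : ∀ j, c.Busy j → c.completion x j = ((c.time + W j 0 : ℝ) : EReal) := by
    intro j hj
    rw [Config.completion_of_busy hj]
    simp [x]
  have hmin : ∀ j, ((c.time + W l 0 : ℝ) : EReal) ≤ c.completion x j := by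
    intro j
    by_cases hj : c.Busy j
    · rw [hcomp j hj, EReal.coe_le_coe_iff]
      rcases lt_trichotomy j l with h | h | h
      · linarith [(hf j h.ne hj).1 h]
      · rw [h]
      · linarith [(hf j h.ne' hj).2 h]
    · rw [Config.completion_of_idle hj]; exact le_top
  have hT : c.nextTime I x delay = ((c.time + W l 0 : ℝ) : EReal) := by
    unfold Config.nextTime
    refine le_antisymm ((min_le_left _ _).trans ((iInf_le _ l).trans (hcomp l hl).le))
      (le_min (le_iInf hmin) hd)
  have hex : ∃ j, c.completion x j = c.nextTime I x delay ∧
      ∀ i < j, c.completion x i ≠ c.nextTime I x delay := by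
    refine ⟨l, by rw [hT, hcomp l hl], fun i hi => ?_⟩
    rw [hT]
    by_cases hb : c.Busy i
    · rw [hcomp i hb]
      have := (hf i hi.ne hb).1 hi
      exact_mod_cast (by linarith : c.time + W l 0 < c.time + W i 0).ne'
    · rw [Config.completion_of_idle hb]; exact (EReal.coe_ne_top _).symm
  have hch : hex.choose = l := by
    rcases lt_trichotomy hex.choose l with h | h | h
    · have h1 := hex.choose_spec.1
      have hb : c.Busy hex.choose := by
        by_contra hb
        rw [Config.completion_of_idle hb, hT] at h1
        exact EReal.coe_ne_top _ h1.symm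
      rw [hcomp _ hb] at h1
      have h2 := EReal.coe_eq_coe_iff.1 (h1.trans hT)
      linarith [(hf _ h.ne hb).1 h]
    · exact h
    · exact absurd (by rw [hT, hcomp l hl]) (hex.choose_spec.2 l h)
  unfold Config.advanceBy Config.advance
  simp only
  rw [if_neg (by rw [hT]; exact EReal.coe_ne_top _), dif_pos hex, hch, hT, EReal.toReal_coe]

theorem Config.advanceBy_of_deadline_lt
    (h : ∀ j, c.Busy j → c.deadline I delay < ((c.time + W j 0 : ℝ) : EReal)) :
    c.advanceBy I delay W = c.timeout I delay := by
  classical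
  set x : Fin m → ℕ → ℝ := fun j _ => c.time + W j 0 - c.start j
  have hcomp : ∀ j, c.Busy j → c.completion x j = ((c.time + W j 0 : ℝ) : EReal) := by
    intro j hj
    rw [Config.completion_of_busy hj]
    simp [x]
  have hT : c.nextTime I x delay = c.deadline I delay := by
    refine min_eq_right (le_iInf fun j => ?_)
    by_cases hj : c.Busy j
    · rw [hcomp j hj]; exact (h j hj).le
    · rw [Config.completion_of_idle hj]; exact le_top
  unfold Config.advanceBy Config.advance Config.timeout
  simp only
  rw [hT]
  by_cases htop : c.deadline I delay = ⊤
  · rw [if_pos htop, if_pos htop]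
  have hnex : ¬∃ j, c.completion x j = c.deadline I delay ∧
      ∀ i < j, c.completion x i ≠ c.deadline I delay := by
    rintro ⟨j, hj, -⟩
    by_cases hb : c.Busy j
    · rw [hcomp j hb] at hj
      exact (h j hb).ne' hj
    · rw [Config.completion_of_idle hb] at hj
      exact htop hj.symm
  rw [if_neg htop, if_neg htop]
  exact dif_neg hnex

attribute [irreducible] Config.advanceBy

/-- The first busy server minimises (`W j 0`, `j`) lexicographically. With the two preceding lemmas
this resolves a step into finitely many cases. -/
theorem Config.exists_isFirst_or (c : Config m) (I : Input) (delay : ℝ≥0∞)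
    (W : Fin m → ℕ → ℝ) :
    (∃ l, c.Busy l ∧ ((c.time + W l 0 : ℝ) : EReal) ≤ c.deadline I delay ∧
      IsFirst c.Busy l W) ∨
    ∀ j, c.Busy j → c.deadline I delay < ((c.time + W j 0 : ℝ) : EReal) := by
  classical
  by_cases h : ∀ j, c.Busy j → c.deadline I delay < ((c.time + W j 0 : ℝ) : EReal)
  · exact Or.inr h
  · left
    push Not at h
    obtain ⟨j, hj, hjd⟩ := h
    obtain ⟨l, hl, hmin⟩ := (Finset.univ.filter c.Busy).exists_min_image
      (fun j => toLex (W j 0, j)) ⟨j, by simpa using hj⟩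
    simp only [Finset.mem_filter, Finset.mem_univ, true_and, Prod.Lex.le_iff, ofLex_toLex]
      at hl hmin
    refine ⟨l, hl, ?_, fun i hi hb => ⟨fun hil => ?_, fun hil => ?_⟩⟩
    · refine le_trans ?_ hjd
      rw [EReal.coe_le_coe_iff]
      rcases hmin j hj with h | h <;> linarith
    · rcases hmin i hb with h | h
      · exact h
      · exact absurd h.2 (not_le.2 hil)
    · rcases hmin i hb with h | h
      · exact h.le
      · exact h.1.le

theorem IsFirst.unique {b : Fin m → Prop} {l l' : Fin m} (hl : b l) (hl' : b l')
    (h : IsFirst b l W) (h' : IsFirst b l' W) : l = l' := by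
  by_contra hne
  rcases lt_or_gt_of_ne hne with hlt | hlt
  · exact absurd ((h l' (Ne.symm hne) hl').2 hlt) (not_le.2 ((h' l hne hl).1 hlt))
  · exact absurd ((h' l hne hl).2 hlt) (not_le.2 ((h l' (Ne.symm hne) hl').1 hlt))

theorem Config.timeout_serving : (c.timeout I delay).serving = c.serving := by
  unfold Config.timeout
  split_ifs
  · rfl
  · split <;> rfl
  · rfl

theorem Config.deadline_ne_bot : c.deadline I delay ≠ ⊥ := by
  unfold Config.deadline
  rw [ne_eq, min_eq_bot, not_or]
  constructor
  · unfold Config.nextArrival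
    cases I.next c.arrived <;> simp
  · rw [EReal.add_eq_bot_iff]
    simp

theorem Config.le_deadline (hc : (c.time : EReal) ≤ c.nextArrival I) :
    (c.time : EReal) ≤ c.deadline I delay := by
  refine le_min hc ?_
  nth_rewrite 1 [← add_zero (c.time : EReal)]
  gcongr
  exact EReal.coe_ennreal_nonneg _

theorem Config.timeout_time (h : c.deadline I delay ≠ ⊤) :
    (((c.timeout I delay).time : ℝ) : EReal) = c.deadline I delay := by
  unfold Config.timeout
  rw [if_neg h]
  split_ifs with h'
  · cases hn : I.next c.arrived with
    | none => rw [Config.nextArrival_eq_top hn] at h'; exact absurd h'.symm h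
    | some i => exact EReal.coe_toReal h Config.deadline_ne_bot
  · exact EReal.coe_toReal h Config.deadline_ne_bot

theorem Config.le_timeout_time (hc : (c.time : EReal) ≤ c.nextArrival I) :
    c.time ≤ (c.timeout I delay).time := by
  by_cases h : c.deadline I delay = ⊤
  · rw [Config.timeout, if_pos h]
  · rw [← EReal.coe_le_coe_iff, Config.timeout_time h]
    exact Config.le_deadline hc

/-- The residual gaps at the next epoch `c'`, from the residual gaps `W` at the state `c`. The rows
of the idle servers are subject to `Φ`. -/
def gapsAfter (Φ : ℝ → (ℕ → ℝ) → ℕ → ℝ) (c c' : Config m) (W : Fin m → ℕ → ℝ) :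
    Fin m → ℕ → ℝ :=
  -- A step never preempts, so a server busy before it and idle after it has just delivered and has
  -- used up its first gap.
  fun j => match c.serving j, c'.serving j with
    | none, _ => Φ (c'.time - c.time) (W j)
    | some _, none => rowTail (W j)
    | some _, some _ => subHead (c'.time - c.time) (W j)

variable {Φ : ℝ → (ℕ → ℝ) → ℕ → ℝ}

theorem gapsAfter_deliver {l : Fin m} (hl : c.Busy l) :
    gapsAfter Φ c (c.deliver (c.time + W l 0) l) W = afterRenewal c.Busy Φ l W := by
  funext j
  have ht : (c.deliver (c.time + W l 0) l).time - c.time = W l 0 := by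
    simp [Config.deliver]
  unfold gapsAfter afterRenewal
  rw [ht]
  by_cases hj : j = l
  · subst hj
    rw [Function.update_self]
    have : (c.deliver (c.time + W j 0) j).serving j = none := by simp [Config.deliver]
    rw [this]
    cases h : c.serving j with
    | none => exact absurd h hl
    | some _ => rfl
  · have : (c.deliver (c.time + W l 0) l).serving j = c.serving j := by
      simp [Config.deliver, hj]
    rw [this, Function.update_of_ne hj, elapse]
    cases h : c.serving j with
    | none => simp [Config.Busy, h]
    | some _ => simp [Config.Busy, h]

theorem gapsAfter_timeout :
    gapsAfter Φ c (c.timeout I delay) W =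
      elapse c.Busy Φ ((c.timeout I delay).time - c.time) W := by
  funext j
  unfold gapsAfter elapse
  rw [Config.timeout_serving]
  cases h : c.serving j with
  | none => simp [Config.Busy, h]
  | some _ => simp [Config.Busy, h]

variable (I) in
theorem measurable_deadline :
    Measurable fun p : Config m × ℝ≥0∞ => p.1.deadline I p.2 := by
  refine ((measurable_nextArrival I).comp measurable_fst).min ?_
  exact (measurable_coe_real_ereal.comp (Config.measurable_time.comp measurable_fst)).add
    (measurable_coe_ennreal_ereal.comp measurable_snd)

variable (I) in
theorem measurable_timeout :
    Measurable fun p : Config m × ℝ≥0∞ => p.1.timeout I p.2 := by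
  classical
  have hd := measurable_deadline (m := m) I
  have hn : Measurable fun p : Config m × ℝ≥0∞ => p.1.nextArrival I :=
    (measurable_nextArrival I).comp measurable_fst
  have hr : Measurable fun p : Config m × ℝ≥0∞ => (p.1.deadline I p.2).toReal :=
    measurable_ereal_toReal.comp hd
  refine Measurable.ite (measurableSet_eq_fun hd measurable_const) measurable_fst
    (Measurable.ite (measurableSet_eq_fun hn hd) ?_ ?_)
  · refine measurable_of_cover (ι := Option ℕ) (fun o => {p | I.next p.1.arrived = o})
      (fun o p => match o with
        | some i => p.1.arrive (p.1.deadline I p.2).toReal i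
        | none => p.1) (fun o => ?_) (fun o => ?_) (fun p => ⟨_, rfl⟩) ?_
    · exact measurable_fst (measurableSet_status fun c => I.next c.arrived = o)
    · cases o with
      | none => exact measurable_fst
      | some i => exact (measurable_arrive i).comp (measurable_fst.prodMk hr)
    · intro o p hp
      obtain rfl := Set.mem_ofPred_eq.mp hp
      rfl
  · have hst : Measurable fun p : Config m × ℝ≥0∞ => p.1.toStatus :=
      Config.measurable_toStatus.comp measurable_fst
    have hs : Measurable fun p : Config m × ℝ≥0∞ => p.1.start :=
      Config.measurable_start.comp measurable_fst
    exact Config.measurable_iff.2 ⟨hst, hr, hs⟩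

variable (I) in
theorem measurable_advanceBy : Measurable fun p : (Config m × ℝ≥0∞) × (Fin m → ℕ → ℝ) =>
    p.1.1.advanceBy I p.1.2 p.2 := by
  have hW : ∀ j, Measurable fun p : (Config m × ℝ≥0∞) × (Fin m → ℕ → ℝ) => p.2 j 0 := fun j =>
    (measurable_pi_apply 0).comp ((measurable_pi_apply j).comp measurable_snd)
  have hc : Measurable fun p : (Config m × ℝ≥0∞) × (Fin m → ℕ → ℝ) => p.1.1 :=
    measurable_fst.comp measurable_fst
  have ht : ∀ j, Measurable fun p : (Config m × ℝ≥0∞) × (Fin m → ℕ → ℝ) =>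
      p.1.1.time + p.2 j 0 := fun j => (Config.measurable_time.comp hc).add (hW j)
  have hd : Measurable fun p : (Config m × ℝ≥0∞) × (Fin m → ℕ → ℝ) =>
      p.1.1.deadline I p.1.2 := (measurable_deadline I).comp measurable_fst
  have hb : ∀ j, MeasurableSet {p : (Config m × ℝ≥0∞) × (Fin m → ℕ → ℝ) | p.1.1.Busy j} :=
    fun j => hc (measurableSet_status fun c => c.serving j ≠ none)
  have himp : ∀ (p : Prop) (f : (Config m × ℝ≥0∞) × (Fin m → ℕ → ℝ) → Prop),
      MeasurableSet {a | f a} → MeasurableSet {a | p → f a} := by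
    intro p f hf
    by_cases hp : p <;> simp [hp, hf]
  have himp' : ∀ f g : (Config m × ℝ≥0∞) × (Fin m → ℕ → ℝ) → Prop,
      MeasurableSet {a | f a} → MeasurableSet {a | g a} → MeasurableSet {a | f a → g a} := by
    intro f g hf hg
    simp only [imp_iff_not_or]
    exact hf.compl.union hg
  have hfirst : ∀ l, MeasurableSet {p : (Config m × ℝ≥0∞) × (Fin m → ℕ → ℝ) |
      IsFirst p.1.1.Busy l p.2} := by
    intro l
    unfold IsFirst
    rw [Set.ofPred_forall]
    refine .iInter fun j => himp _ _ (himp' _ _ (hb j) ?_)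
    exact (himp _ _ (measurableSet_lt (hW l) (hW j))).inter
      (himp _ _ (measurableSet_le (hW l) (hW j)))
  refine measurable_of_cover (ι := Option (Fin m)) (fun o => match o with
      | some l => {p | p.1.1.Busy l ∧ ((p.1.1.time + p.2 l 0 : ℝ) : EReal) ≤
          p.1.1.deadline I p.1.2 ∧ IsFirst p.1.1.Busy l p.2}
      | none => {p | ∀ j, p.1.1.Busy j →
          p.1.1.deadline I p.1.2 < ((p.1.1.time + p.2 j 0 : ℝ) : EReal)})
    (fun o p => match o with
      | some l => p.1.1.deliver (p.1.1.time + p.2 l 0) l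
      | none => p.1.1.timeout I p.1.2) (fun o => ?_) (fun o => ?_) (fun p => ?_) ?_
  · cases o with
    | none =>
      simp only [Set.ofPred_forall]
      refine .iInter fun j => ?_
      have := himp' _ _ (hb j) (measurableSet_lt hd (measurable_coe_real_ereal.comp (ht j)))
      simpa only [Set.ofPred_forall, Function.comp] using this
    | some l => exact (hb l).inter ((measurableSet_le (measurable_coe_real_ereal.comp (ht l))
        hd).inter (hfirst l))
  · cases o with
    | none => exact (measurable_timeout I).comp measurable_fst
    | some l => exact (measurable_deliver l).comp (hc.prodMk (ht l))
  · rcases p.1.1.exists_isFirst_or I p.1.2 p.2 with ⟨l, hl⟩ | h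
    · exact ⟨some l, hl⟩
    · exact ⟨none, h⟩
  · intro o p hp
    cases o with
    | none => exact Config.advanceBy_of_deadline_lt hp
    | some l => exact Config.advanceBy_of_isFirst hp.1 hp.2.1 hp.2.2

theorem measurable_gapsAfter (hΦm : Measurable fun p : ℝ × (ℕ → ℝ) => Φ p.1 p.2) :
    Measurable fun p : (Config m × Config m) × (Fin m → ℕ → ℝ) =>
      gapsAfter Φ p.1.1 p.1.2 p.2 := by
  refine measurable_pi_lambda _ fun j => ?_
  have hs : ∀ o o' : Option ℕ, MeasurableSet {p : (Config m × Config m) × (Fin m → ℕ → ℝ) |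
      p.1.1.serving j = o ∧ p.1.2.serving j = o'} := fun o o' =>
    ((measurable_fst.comp measurable_fst) (measurableSet_status fun c => c.serving j = o)).inter
      ((measurable_snd.comp measurable_fst) (measurableSet_status fun c => c.serving j = o'))
  have hw : Measurable fun p : (Config m × Config m) × (Fin m → ℕ → ℝ) => p.2 j :=
    (measurable_pi_apply j).comp measurable_snd
  have ht : Measurable fun p : (Config m × Config m) × (Fin m → ℕ → ℝ) =>
      (p.1.2.time - p.1.1.time, p.2 j) :=
    ((Config.measurable_time.comp (measurable_snd.comp measurable_fst)).sub
      (Config.measurable_time.comp (measurable_fst.comp measurable_fst))).prodMk hw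
  refine measurable_of_cover (ι := Option ℕ × Option ℕ)
    (fun o => {p | p.1.1.serving j = o.1 ∧ p.1.2.serving j = o.2})
    (fun o p => match o with
      | (none, _) => Φ (p.1.2.time - p.1.1.time) (p.2 j)
      | (some _, none) => rowTail (p.2 j)
      | (some _, some _) => subHead (p.1.2.time - p.1.1.time) (p.2 j))
    (fun o => hs o.1 o.2) (fun o => ?_) (fun p => ⟨(_, _), rfl, rfl⟩) ?_
  · rcases o with ⟨_ | _, _ | _⟩
    · exact hΦm.comp ht
    · exact hΦm.comp ht
    · exact measurable_rowTail.comp hw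
    · exact measurable_subHead.comp ht
  · rintro ⟨o, o'⟩ p ⟨h, h'⟩
    unfold gapsAfter
    rw [h, h']
    cases o <;> cases o' <;> rfl

/-! ### The residual gaps at the next epoch are fresh -/

variable {ρ : Measure ℝ} [IsProbabilityMeasure ρ]

/-- If the residual gaps are independent with a memoryless law, then the residual gaps at the next
epoch have the same law and are independent of the state there. -/
theorem map_advanceBy_gapsAfter (hρ : IsMemoryless ρ)
    (hΦm : Measurable fun p : ℝ × (ℕ → ℝ) => Φ p.1 p.2)
    (hΦ : ∀ τ, 0 ≤ τ → MeasurePreserving (Φ τ) (rowLaw ρ) (rowLaw ρ))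
    (hc : (c.time : EReal) ≤ c.nextArrival I) :
    (arrLaw m ρ).map (fun W => (c.advanceBy I delay W, gapsAfter Φ c (c.advanceBy I delay W) W)) =
      ((arrLaw m ρ).map fun W => c.advanceBy I delay W).prod (arrLaw m ρ) := by
  classical
  have hcW : Measurable fun W : Fin m → ℕ → ℝ => ((c, delay), W) := measurable_prodMk_left
  have hadv : Measurable fun W => c.advanceBy I delay W := (measurable_advanceBy I).comp hcW
  have hpair : Measurable fun W => ((c, c.advanceBy I delay W), W) :=
    (measurable_const.prodMk hadv).prodMk measurable_id
  have hgap : Measurable fun W => gapsAfter Φ c (c.advanceBy I delay W) W :=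
    (measurable_gapsAfter hΦm).comp hpair
  have hprob := Measure.isProbabilityMeasure_map (μ := arrLaw m ρ) hadv.aemeasurable
  refine (Measure.prod_eq fun Q S hQ hS => ?_).symm
  rw [Measure.map_apply (hadv.prodMk hgap) (hQ.prod hS), Measure.map_apply hadv hQ]
  -- The arrays are partitioned by what ends the step: a ring of server `l`, or the deadline.
  -- Independence is proved on each piece and summed.
  let A : Option (Fin m) → Set (Fin m → ℕ → ℝ) := fun o => match o with
    | some l => {W | c.Busy l ∧ ((c.time + W l 0 : ℝ) : EReal) ≤ c.deadline I delay ∧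
        IsFirst c.Busy l W}
    | none => {W | ∀ j, c.Busy j → c.deadline I delay < ((c.time + W j 0 : ℝ) : EReal)}
  have hW : ∀ j, Measurable fun W : Fin m → ℕ → ℝ => ((c.time + W j 0 : ℝ) : EReal) := fun j =>
    measurable_coe_real_ereal.comp (measurable_const.add
      ((measurable_pi_apply 0).comp (measurable_pi_apply j)))
  have hA : ∀ o, MeasurableSet (A o) := by
    rintro (_ | l)
    · simp only [A, Set.ofPred_forall]
      exact .iInter fun j => .iInter fun _ => measurableSet_lt measurable_const (hW j)
    · by_cases hl : c.Busy l
      · simp only [A, hl, true_and]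
        exact (measurableSet_le (hW l) measurable_const).inter (measurableSet_isFirst _ l)
      · simp [A, hl]
  have hcov : ∀ W, ∃ o, W ∈ A o := by
    intro W
    rcases c.exists_isFirst_or I delay W with ⟨l, hl⟩ | h
    · exact ⟨some l, hl⟩
    · exact ⟨none, h⟩
  have hdisj : Pairwise (Function.onFun Disjoint A) := by
    intro o o' hne
    refine Set.disjoint_left.2 fun W hW hW' => hne ?_
    rcases o with _ | l <;> rcases o' with _ | l'
    · rfl
    · exact absurd (hW l' hW'.1) (not_lt.2 hW'.2.1)
    · exact absurd (hW' l hW.1) (not_lt.2 hW.2.1)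
    · rw [IsFirst.unique hW.1 hW'.1 hW.2.2 hW'.2.2]
  have hsplit : ∀ B : Set (Fin m → ℕ → ℝ), MeasurableSet B →
      arrLaw m ρ B = ∑ o, arrLaw m ρ (A o ∩ B) := by
    intro B hB
    rw [← tsum_fintype (L := SummationFilter.unconditional _),
      ← measure_iUnion (fun o o' h => (hdisj h).mono Set.inter_subset_left
        Set.inter_subset_left) (fun o => (hA o).inter hB), ← Set.iUnion_inter]
    congr 1
    ext W
    simpa using fun _ => hcov W
  have hpiece : ∀ o, arrLaw m ρ (A o ∩ (fun W => (c.advanceBy I delay W,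
      gapsAfter Φ c (c.advanceBy I delay W) W)) ⁻¹' Q ×ˢ S) =
      arrLaw m ρ (A o ∩ (fun W => c.advanceBy I delay W) ⁻¹' Q) * arrLaw m ρ S := by
    rintro (_ | l)
    · set τ := (c.timeout I delay).time - c.time with hτ
      have hτ0 : 0 ≤ τ := sub_nonneg.2 (Config.le_timeout_time hc)
      -- With an infinite deadline this piece is empty if some server is busy; if all are idle, the
      -- condition on the rings is vacuous.
      have hAeq : A none = {W | ∀ j, c.Busy j → τ < W j 0} ∨ A none = ∅ := by
        by_cases htop : c.deadline I delay = ⊤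
        · by_cases hb : ∃ j, c.Busy j
          · right
            obtain ⟨j, hj⟩ := hb
            refine Set.eq_empty_of_forall_notMem fun W hW => ?_
            have := hW j hj
            rw [htop] at this
            exact not_top_lt this
          · left
            push Not at hb
            ext W
            exact ⟨fun _ j hj => absurd hj (hb j), fun _ j hj => absurd hj (hb j)⟩
        · left
          ext W
          refine forall₂_congr fun j _ => ?_
          rw [← Config.timeout_time htop, EReal.coe_lt_coe_iff, hτ, sub_lt_iff_lt_add']
      rcases hAeq with hAeq | hAeq
      -- The state reached at the deadline is deterministic, so it lies in `Q` or not, and what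
      -- remains is freshness after a fixed time.
      · by_cases hQ' : c.timeout I delay ∈ Q
        · have e1 : A none ∩ (fun W => (c.advanceBy I delay W,
              gapsAfter Φ c (c.advanceBy I delay W) W)) ⁻¹' Q ×ˢ S =
              {W | (∀ j, c.Busy j → τ < W j 0) ∧ elapse c.Busy Φ τ W ∈ S} := by
            ext W
            rw [Set.mem_inter_iff, hAeq]
            refine and_congr_right fun hW => ?_
            have hW' : W ∈ A none := by rw [hAeq]; exact hW
            simp only [Set.mem_preimage, Set.mem_prod, Config.advanceBy_of_deadline_lt hW',
              gapsAfter_timeout, hQ', true_and]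
            rfl
          have e2 : A none ∩ (fun W => c.advanceBy I delay W) ⁻¹' Q =
              {W | ∀ j, c.Busy j → τ < W j 0} := by
            rw [← hAeq]
            refine Set.inter_eq_left.2 fun W hW => ?_
            rw [Set.mem_preimage, Config.advanceBy_of_deadline_lt hW]
            exact hQ'
          rw [e1, e2]
          exact arrLaw_elapse hρ hτ0 (hΦ τ hτ0) hS
        · have e1 : A none ∩ (fun W => c.advanceBy I delay W) ⁻¹' Q = ∅ := by
            refine Set.eq_empty_of_forall_notMem fun W hW => hQ' ?_
            have := hW.2
            rwa [Set.mem_preimage, Config.advanceBy_of_deadline_lt hW.1] at this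
          rw [e1, measure_empty, zero_mul]
          refine measure_mono_null (fun W hW => ?_) (measure_empty (μ := arrLaw m ρ))
          rw [← e1]
          exact ⟨hW.1, hW.2.1⟩
      · simp [hAeq]
    · by_cases hl : c.Busy l
      -- The state after a ring of `l` depends on the array through `W l 0` only, so the event `Q`
      -- becomes a set of ring times.
      · let C : Set ℝ := {y | ((c.time + y : ℝ) : EReal) ≤ c.deadline I delay ∧
          c.deliver (c.time + y) l ∈ Q}
        have hC : MeasurableSet C := by
          refine (measurableSet_le (measurable_coe_real_ereal.comp (by fun_prop))
            measurable_const).inter ?_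
          have : Measurable fun y : ℝ => c.deliver (c.time + y) l :=
            (measurable_deliver l).comp (measurable_const.prodMk (by fun_prop))
          exact this hQ
        have e1 : A (some l) ∩ (fun W => (c.advanceBy I delay W,
            gapsAfter Φ c (c.advanceBy I delay W) W)) ⁻¹' Q ×ˢ S =
            {W | (W l 0 ∈ C ∧ IsFirst c.Busy l W) ∧ afterRenewal c.Busy Φ l W ∈ S} := by
          ext W
          constructor
          · rintro ⟨hW, hW1, hW2⟩
            simp only [Config.advanceBy_of_isFirst hW.1 hW.2.1 hW.2.2] at hW1 hW2
            rw [gapsAfter_deliver hl] at hW2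
            exact ⟨⟨⟨hW.2.1, hW1⟩, hW.2.2⟩, hW2⟩
          · rintro ⟨⟨⟨hd, hW1⟩, hf⟩, hW2⟩
            refine ⟨⟨hl, hd, hf⟩, ?_⟩
            rw [Set.mem_preimage, Config.advanceBy_of_isFirst hl hd hf, gapsAfter_deliver hl]
            exact ⟨hW1, hW2⟩
        have e2 : A (some l) ∩ (fun W => c.advanceBy I delay W) ⁻¹' Q =
            {W | W l 0 ∈ C ∧ IsFirst c.Busy l W} := by
          ext W
          constructor
          · rintro ⟨hW, hW1⟩
            rw [Set.mem_preimage, Config.advanceBy_of_isFirst hW.1 hW.2.1 hW.2.2] at hW1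
            exact ⟨⟨hW.2.1, hW1⟩, hW.2.2⟩
          · rintro ⟨⟨hd, hW1⟩, hf⟩
            refine ⟨⟨hl, hd, hf⟩, ?_⟩
            rw [Set.mem_preimage, Config.advanceBy_of_isFirst hl hd hf]
            exact hW1
        rw [e1, e2]
        exact arrLaw_afterRenewal hρ hΦm hΦ l hC hS
      · have : A (some l) = ∅ := Set.eq_empty_of_forall_notMem fun W hW => hl hW.1
        simp [this]
  rw [hsplit _ ((hadv.prodMk hgap) (hQ.prod hS)), hsplit _ (hadv hQ), Finset.sum_mul]
  exact Finset.sum_congr rfl fun o _ => hpiece o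

end

/-! ### Chains driven by residual gaps -/

section

variable {m : ℕ} {E : Type*}

/-- The observed history after one more epoch, when the servers have the residual gaps `W`. -/
def nextHistory (I : Input) (π : Policy m E) (k : ℕ) (q : E × (Fin (k + 1) → Config m))
    (W : Fin m → ℕ → ℝ) : E × (Fin (k + 1 + 1) → Config m) :=
  (q.1, Fin.snoc (α := fun _ => Config m) q.2
    (((q.2 (Fin.last k)).place (π q.1 k q.2).toPlacement).advanceBy I (π q.1 k q.2).delay W))

/-- One step of a chain that consists of the seed, the observed history and an array of residual
gaps. The array is rearranged by `pre` before the step and by `post` after it. -/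
def chainStep (I : Input) (π : Policy m E) (Φ : ℝ → (ℕ → ℝ) → ℕ → ℝ)
    (pre post : Status m → Placement m → (Fin m → ℕ → ℝ) → Fin m → ℕ → ℝ) (k : ℕ)
    (p : (E × (Fin (k + 1) → Config m)) × (Fin m → ℕ → ℝ)) :
    (E × (Fin (k + 1 + 1) → Config m)) × (Fin m → ℕ → ℝ) :=
  let c := p.1.2 (Fin.last k)
  let d := π p.1.1 k p.1.2
  let W := pre c.toStatus d.toPlacement p.2
  (nextHistory I π k p.1 W, post c.toStatus d.toPlacement
    (gapsAfter Φ (c.place d.toPlacement) ((c.place d.toPlacement).advanceBy I d.delay W) W))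

variable [MeasurableSpace E] {I : Input} {π : Policy m E} {Φ : ℝ → (ℕ → ℝ) → ℕ → ℝ}
  {pre post : Status m → Placement m → (Fin m → ℕ → ℝ) → Fin m → ℕ → ℝ}

theorem measurable_snoc (k : ℕ) : Measurable fun p : (Fin (k + 1) → Config m) × Config m =>
    (Fin.snoc (α := fun _ => Config m) p.1 p.2 : Fin (k + 1 + 1) → Config m) := by
  refine measurable_pi_lambda _ fun i => ?_
  refine Fin.lastCases ?_ (fun i => ?_) i
  · simpa using measurable_snd
  · simp only [Fin.snoc_castSucc]
    exact (measurable_pi_apply i).comp measurable_fst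

theorem measurable_decision (hπ : ∀ k, Measurable fun q : E × (Fin (k + 1) → Config m) =>
    π q.1 k q.2) (k : ℕ) : Measurable fun q : E × (Fin (k + 1) → Config m) =>
      ((q.2 (Fin.last k)).place (π q.1 k q.2).toPlacement, (π q.1 k q.2).delay) := by
  have h := Decision.measurable_iff.1 (hπ k)
  have hl : Measurable fun q : E × (Fin (k + 1) → Config m) =>
      (q.2 (Fin.last k), (π q.1 k q.2).toPlacement) :=
    ((measurable_pi_apply _).comp measurable_snd).prodMk h.1
  exact (measurable_place.comp hl).prodMk h.2

theorem measurable_nextHistory (hπ : ∀ k, Measurable fun q : E × (Fin (k + 1) → Config m) =>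
    π q.1 k q.2) (k : ℕ) :
    Measurable fun p : (E × (Fin (k + 1) → Config m)) × (Fin m → ℕ → ℝ) =>
      nextHistory I π k p.1 p.2 := by
  have h1 : Measurable fun p : (E × (Fin (k + 1) → Config m)) × (Fin m → ℕ → ℝ) =>
      (((p.1.2 (Fin.last k)).place (π p.1.1 k p.1.2).toPlacement, (π p.1.1 k p.1.2).delay),
        p.2) := ((measurable_decision hπ k).comp measurable_fst).prodMk measurable_snd
  have h2 := (measurable_snd.comp measurable_fst).prodMk ((measurable_advanceBy I).comp h1)
  exact (measurable_fst.comp measurable_fst).prodMk ((measurable_snoc k).comp h2)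

theorem measurable_rearrange {f : Status m → Placement m → (Fin m → ℕ → ℝ) → Fin m → ℕ → ℝ}
    (hf : ∀ c d, Measurable (f c d)) :
    Measurable fun p : (Status m × Placement m) × (Fin m → ℕ → ℝ) => f p.1.1 p.1.2 p.2 :=
  measurable_from_prod_countable_right fun q => hf q.1 q.2

theorem measurable_chainStep (hπ : ∀ k, Measurable fun q : E × (Fin (k + 1) → Config m) =>
    π q.1 k q.2) (hΦm : Measurable fun p : ℝ × (ℕ → ℝ) => Φ p.1 p.2)
    (hpre : ∀ c d, Measurable (pre c d)) (hpost : ∀ c d, Measurable (post c d)) (k : ℕ) :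
    Measurable (chainStep I π Φ pre post k) := by
  have hst : Measurable fun p : (E × (Fin (k + 1) → Config m)) × (Fin m → ℕ → ℝ) =>
      ((p.1.2 (Fin.last k)).toStatus, (π p.1.1 k p.1.2).toPlacement) :=
    (Config.measurable_toStatus.comp ((measurable_pi_apply (Fin.last k)).comp
      (measurable_snd.comp measurable_fst))).prodMk
        ((Decision.measurable_iff.1 (hπ k)).1.comp measurable_fst)
  have hW : Measurable fun p : (E × (Fin (k + 1) → Config m)) × (Fin m → ℕ → ℝ) =>
      pre (p.1.2 (Fin.last k)).toStatus (π p.1.1 k p.1.2).toPlacement p.2 :=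
    (measurable_rearrange hpre).comp (hst.prodMk measurable_snd)
  have hcd : Measurable fun p : (E × (Fin (k + 1) → Config m)) × (Fin m → ℕ → ℝ) =>
      ((p.1.2 (Fin.last k)).place (π p.1.1 k p.1.2).toPlacement, (π p.1.1 k p.1.2).delay) :=
    (measurable_decision hπ k).comp measurable_fst
  have hadv := (measurable_advanceBy I).comp (hcd.prodMk hW)
  have hgap := (measurable_gapsAfter hΦm).comp (((measurable_fst.comp hcd).prodMk hadv).prodMk hW)
  exact ((measurable_nextHistory hπ k).comp (measurable_fst.prodMk hW)).prodMk
    ((measurable_rearrange hpost).comp (hst.prodMk hgap))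

/-- Integrates the fibrewise identity over `ν`. A second map `f'` is allowed so that the law of the
history can be written without the rearrangements inside `f`. -/
theorem map_prod_eq_of_fiber {α β γ : Type*} [MeasurableSpace α] [MeasurableSpace β]
    [MeasurableSpace γ] {ν : Measure α} [IsProbabilityMeasure ν] {M : Measure β}
    [IsProbabilityMeasure M] {f f' : α × β → γ} {g : α × β → β} (hf : Measurable f)
    (hf' : Measurable f') (hg : Measurable g)
    (h : ∀ᵐ a ∂ν, M.map (fun b => (f (a, b), g (a, b))) = (M.map fun b => f' (a, b)).prod M) :
    (ν.prod M).map (fun p => (f p, g p)) = ((ν.prod M).map f').prod M := by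
  have hprob := Measure.isProbabilityMeasure_map (μ := ν.prod M) hf'.aemeasurable
  refine (Measure.prod_eq fun Q S hQ hS => ?_).symm
  have hfQ := hf' hQ
  rw [Measure.map_apply (hf.prodMk hg) (hQ.prod hS), Measure.map_apply hf' hQ,
    Measure.prod_apply ((hf.prodMk hg) (hQ.prod hS)), Measure.prod_apply hfQ,
    ← lintegral_mul_const _ (measurable_measure_prodMk_left hfQ)]
  refine lintegral_congr_ae ?_
  filter_upwards [h] with a ha
  have := congrArg (fun N : Measure (γ × β) => N (Q ×ˢ S)) ha
  simp only [Measure.prod_prod] at this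
  have hfg : Measurable fun b => (f (a, b), g (a, b)) :=
    (hf.prodMk hg).comp measurable_prodMk_left
  have hf'' : Measurable fun b => f' (a, b) := hf'.comp measurable_prodMk_left
  rw [Measure.map_apply hfg (hQ.prod hS), Measure.map_apply hf'' hQ] at this
  exact this

variable {ρ : Measure ℝ} [IsProbabilityMeasure ρ]

/-- If the array of residual gaps is fresh, then it is fresh again after a step of the chain, and
the law of the history does not depend on the rearrangements and on `Φ`. -/
theorem map_chainStep (hρ : IsMemoryless ρ)
    (hπ : ∀ k, Measurable fun q : E × (Fin (k + 1) → Config m) => π q.1 k q.2)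
    (hΦm : Measurable fun p : ℝ × (ℕ → ℝ) => Φ p.1 p.2)
    (hΦ : ∀ τ, 0 ≤ τ → MeasurePreserving (Φ τ) (rowLaw ρ) (rowLaw ρ))
    (hpre : ∀ c d, MeasurePreserving (pre c d) (arrLaw m ρ) (arrLaw m ρ))
    (hpost : ∀ c d, MeasurePreserving (post c d) (arrLaw m ρ) (arrLaw m ρ)) {k : ℕ}
    {ν : Measure (E × (Fin (k + 1) → Config m))} [IsProbabilityMeasure ν]
    (hν : ∀ᵐ q ∂ν, ((q.2 (Fin.last k)).time : EReal) ≤ (q.2 (Fin.last k)).nextArrival I) :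
    (ν.prod (arrLaw m ρ)).map (chainStep I π Φ pre post k) =
      ((ν.prod (arrLaw m ρ)).map fun p => nextHistory I π k p.1 p.2).prod (arrLaw m ρ) := by
  have hstep := measurable_chainStep (I := I) hπ hΦm (fun c d => (hpre c d).measurable)
    (fun c d => (hpost c d).measurable) k
  refine map_prod_eq_of_fiber (measurable_fst.comp hstep) (measurable_nextHistory hπ k)
    (measurable_snd.comp hstep) ?_
  filter_upwards [hν] with q hq
  set c := q.2 (Fin.last k)
  set d := π q.1 k q.2
  set c₁ := c.place d.toPlacement
  have hc₁ : (c₁.time : EReal) ≤ c₁.nextArrival I := hq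
  have hlaw := map_advanceBy_gapsAfter (c := c₁) (delay := d.delay) hρ hΦm hΦ hc₁
  have hcW : Measurable fun W : Fin m → ℕ → ℝ => ((c₁, d.delay), W) := measurable_prodMk_left
  have hadv : Measurable fun W => c₁.advanceBy I d.delay W := (measurable_advanceBy I).comp hcW
  have hpair : Measurable fun W => ((c₁, c₁.advanceBy I d.delay W), W) :=
    (measurable_const.prodMk hadv).prodMk measurable_id
  have hgap : Measurable fun W => gapsAfter Φ c₁ (c₁.advanceBy I d.delay W) W :=
    (measurable_gapsAfter hΦm).comp hpair
  let F : Config m → E × (Fin (k + 1 + 1) → Config m) := fun c' =>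
    (q.1, Fin.snoc (α := fun _ => Config m) q.2 c')
  have hF : Measurable F :=
    measurable_const.prodMk ((measurable_snoc k).comp measurable_prodMk_left)
  -- A step is `pre`, then the joint map of `map_advanceBy_gapsAfter`, then `post` on the gaps.
  -- Given the history, `pre` and `post` are fixed measure preserving maps and disappear from the
  -- law.
  have e1 : (fun W => ((chainStep I π Φ pre post k (q, W)).1,
      (chainStep I π Φ pre post k (q, W)).2)) =
      (Prod.map F (post c.toStatus d.toPlacement)) ∘ (fun W => (c₁.advanceBy I d.delay W,
        gapsAfter Φ c₁ (c₁.advanceBy I d.delay W) W)) ∘ pre c.toStatus d.toPlacement := rfl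
  have e2 : (fun W => nextHistory I π k q W) = F ∘ fun W => c₁.advanceBy I d.delay W := rfl
  change (arrLaw m ρ).map (fun W => ((chainStep I π Φ pre post k (q, W)).1,
      (chainStep I π Φ pre post k (q, W)).2)) =
    ((arrLaw m ρ).map fun W => nextHistory I π k q W).prod (arrLaw m ρ)
  have hprob := Measure.isProbabilityMeasure_map (μ := arrLaw m ρ) hadv.aemeasurable
  rw [e1, e2, ← Measure.map_map (hF.prodMap (hpost _ _).measurable)
    ((hadv.prodMk hgap).comp (hpre _ _).measurable),
    ← Measure.map_map (hadv.prodMk hgap) (hpre _ _).measurable, (hpre _ _).map_eq, hlaw,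
    ← Measure.map_prod_map _ _ hF (hpost _ _).measurable, (hpost _ _).map_eq,
    Measure.map_map hF hadv]

end

/-! ### The next arrival is never in the past -/

section

variable {m : ℕ} {I : Input} {c : Config m} {delay : ℝ≥0∞} {W : Fin m → ℕ → ℝ}

/-- The possible outcomes of a step. -/
theorem Config.advanceBy_cases (c : Config m) (I : Input) (delay : ℝ≥0∞) (W : Fin m → ℕ → ℝ)
    {p : Config m → Prop}
    (hdel : ∀ l, c.Busy l → ((c.time + W l 0 : ℝ) : EReal) ≤ c.deadline I delay →
      IsFirst c.Busy l W → p (c.deliver (c.time + W l 0) l))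
    (harr : ∀ i, I.next c.arrived = some i → (I.a i : EReal) = c.deadline I delay →
      (∀ j, c.Busy j → I.a i < c.time + W j 0) → p (c.arrive (I.a i) i))
    (htime : ∀ t : ℝ, (t : EReal) = c.deadline I delay → c.nextArrival I ≠ c.deadline I delay →
      (∀ j, c.Busy j → t < c.time + W j 0) → p { c with time := t })
    (hend : c.deadline I delay = ⊤ → (∀ j, ¬c.Busy j) → p c) : p (c.advanceBy I delay W) := by
  rcases c.exists_isFirst_or I delay W with ⟨l, hl, hd, hf⟩ | h
  · rw [Config.advanceBy_of_isFirst hl hd hf]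
    exact hdel l hl hd hf
  · rw [Config.advanceBy_of_deadline_lt h]
    unfold Config.timeout
    split_ifs with h1 h2
    · refine hend h1 fun j hj => ?_
      have := h j hj
      rw [h1] at this
      exact not_top_lt this
    · split
      · rename_i i hi
        rw [Config.nextArrival_eq_some hi] at h2
        rw [← h2, EReal.toReal_coe]
        refine harr i hi h2 fun j hj => ?_
        have := h j hj
        rw [← h2] at this
        exact_mod_cast this
      · rename_i hi
        rw [Config.nextArrival_eq_top hi] at h2
        exact absurd h2.symm h1
    · have ht := EReal.coe_toReal h1 (Config.deadline_ne_bot (c := c))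
      refine htime _ ht h2 fun j hj => ?_
      have := h j hj
      rw [← ht] at this
      exact_mod_cast this

theorem Config.deadline_le_nextArrival : c.deadline I delay ≤ c.nextArrival I := min_le_left _ _

/-- Arrivals are handed over in order, so no packet still to come is overdue. This keeps elapsed
times nonnegative, as memorylessness requires. -/
theorem Config.time_le_nextArrival_advanceBy (h : (c.time : EReal) ≤ c.nextArrival I) :
    ((c.advanceBy I delay W).time : EReal) ≤ (c.advanceBy I delay W).nextArrival I := by
  refine c.advanceBy_cases I delay W (p := fun c' => (c'.time : EReal) ≤ c'.nextArrival I)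
    (fun l _ hd _ => hd.trans Config.deadline_le_nextArrival) (fun i hi _ _ => ?_)
    (fun t ht _ _ => ht.le.trans Config.deadline_le_nextArrival) (fun _ _ => h)
  cases hn : I.next (insert i c.arrived) with
  | none =>
    have : (c.arrive (I.a i) i).nextArrival I = ⊤ := Config.nextArrival_eq_top hn
    rw [this]; exact le_top
  | some i' =>
    have : (c.arrive (I.a i) i).nextArrival I = (I.a i' : EReal) := Config.nextArrival_eq_some hn
    rw [this]
    change ((I.a i : ℝ) : EReal) ≤ _
    have hi' := Input.next_spec hn
    have hmem : i' ∉ c.arrived := fun h => hi'.2.1 (Finset.mem_insert_of_mem h)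
    rcases (Input.next_spec hi).2.2 i' hi'.1 hmem with h' | h'
    · exact_mod_cast h'.le
    · exact_mod_cast h'.1.le

theorem Config.time_le_nextArrival_initial :
    ((Config.initial m).time : EReal) ≤ (Config.initial m).nextArrival I := by
  cases hn : I.next (Config.initial m).arrived with
  | none => rw [Config.nextArrival_eq_top hn]; exact le_top
  | some i =>
    rw [Config.nextArrival_eq_some hn]
    exact_mod_cast I.a_nonneg (Input.next_spec hn).1

theorem measurableSet_time_le_nextArrival (I : Input) :
    MeasurableSet {c : Config m | (c.time : EReal) ≤ c.nextArrival I} :=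
  measurableSet_le (measurable_coe_real_ereal.comp Config.measurable_time)
    (measurable_nextArrival I)

end

/-! ### The original dynamics as a chain -/

section

variable {m : ℕ} {E : Type*}

/-- The residual gaps at the servers: the remaining time of the service in progress, followed by
the service times that have not been used yet. -/
def serverGaps (c : Config m) (x : Fin m → ℕ → ℝ) : Fin m → ℕ → ℝ := fun j =>
  match c.serving j with
  | none => fun i => x j (c.started j + 1 + i)
  | some _ => rowCons (c.start j + x j (c.started j) - c.time) fun i => x j (c.started j + 1 + i)

open Classical in
/-- The residual gaps after a placement: a busy server that abandons its packet uses a new service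
time. -/
def refresh (c : Status m) (d : Placement m) (W : Fin m → ℕ → ℝ) : Fin m → ℕ → ℝ := fun j =>
  if c.serving j ≠ none ∧ d.serving j ≠ c.serving j then rowTail (W j) else W j

theorem serverGaps_of_none {c : Config m} {j : Fin m} (x : Fin m → ℕ → ℝ)
    (h : c.serving j = none) : serverGaps c x j = fun i => x j (c.started j + 1 + i) := by
  unfold serverGaps
  rw [h]

theorem serverGaps_of_some {c : Config m} {j : Fin m} {p : ℕ} (x : Fin m → ℕ → ℝ)
    (h : c.serving j = some p) : serverGaps c x j =
      rowCons (c.start j + x j (c.started j) - c.time) fun i => x j (c.started j + 1 + i) := by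
  unfold serverGaps
  rw [h]

/-- A new service starts now and takes the next unused entry, so the row is then just the row of
unused service times. Only a busy server that gives up its packet loses something: the rest of its
current entry. -/
theorem serverGaps_place (c : Config m) (d : Placement m) (x : Fin m → ℕ → ℝ) :
    serverGaps (c.place d) x = refresh c.toStatus d (serverGaps c x) := by
  classical
  funext j
  unfold refresh
  cases hd : d.serving j with
  | none =>
    have hst : (c.place d).started j = c.started j := by simp [Config.place, hd]
    rw [serverGaps_of_none (c := c.place d) x hd, hst]
    cases hc : c.serving j with
    | none => rw [if_neg (by simp), serverGaps_of_none x hc]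
    | some p => rw [if_pos (by simp), serverGaps_of_some x hc, rowTail_rowCons]
  | some q =>
    rw [serverGaps_of_some (c := c.place d) x hd]
    have ht : (c.place d).time = c.time := rfl
    by_cases hqc : c.serving j = some q
    · have hst : (c.place d).started j = c.started j := by simp [Config.place, hd, hqc]
      have hs : (c.place d).start j = c.start j := by simp [Config.place, hd, hqc]
      rw [if_neg (by simp [hqc]), serverGaps_of_some x hqc, hst, hs, ht]
    · have hst : (c.place d).started j = c.started j + 1 := by
        simp [Config.place, hd, Ne.symm hqc]
      have hs : (c.place d).start j = c.time := by simp [Config.place, hd, Ne.symm hqc]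
      have hrow : rowCons ((c.place d).start j + x j ((c.place d).started j) - (c.place d).time)
          (fun i => x j ((c.place d).started j + 1 + i)) = fun i => x j (c.started j + 1 + i) := by
        rw [hst, hs, ht]
        funext i
        cases i with
        | zero => simp
        | succ i => simp only [rowCons_succ]; congr 1; omega
      rw [hrow]
      cases hc : c.serving j with
      | none => rw [if_neg (by simp), serverGaps_of_none x hc]
      | some p =>
        rw [if_pos ⟨by simp, by rw [← hc]; exact Ne.symm hqc⟩, serverGaps_of_some x hc,
          rowTail_rowCons]

/-- Here `Φ` is the identity: an idle server consumes no service time. -/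
theorem serverGaps_eq_gapsAfter {c c' : Config m} (x : Fin m → ℕ → ℝ)
    (hstarted : c'.started = c.started) (hstart : c'.start = c.start)
    (hserving : ∀ j, c'.serving j = c.serving j ∨ c'.serving j = none) :
    serverGaps c' x = gapsAfter (fun _ w => w) c c' (serverGaps c x) := by
  funext j
  unfold gapsAfter
  cases hc : c.serving j with
  | none =>
    have : c'.serving j = none := by rcases hserving j with h | h <;> simp [h, hc]
    rw [serverGaps_of_none x this, hstarted, serverGaps_of_none x hc]
  | some p =>
    rcases hserving j with h | h
    · rw [hc] at h
      rw [serverGaps_of_some x h, hstarted, hstart, h]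
      simp only [serverGaps_of_some x hc, subHead_rowCons]
      congr 1
      ring
    · rw [serverGaps_of_none x h, hstarted, h]
      simp only [serverGaps_of_some x hc, rowTail_rowCons]

theorem Config.serving_advanceBy (c : Config m) (I : Input) (delay : ℝ≥0∞)
    (W : Fin m → ℕ → ℝ) : (c.advanceBy I delay W).started = c.started ∧
      (c.advanceBy I delay W).start = c.start ∧
      ∀ j, (c.advanceBy I delay W).serving j = c.serving j ∨
        (c.advanceBy I delay W).serving j = none := by
  refine c.advanceBy_cases I delay W (p := fun c' => c'.started = c.started ∧
    c'.start = c.start ∧ ∀ j, c'.serving j = c.serving j ∨ c'.serving j = none)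
    (fun l _ _ _ => ⟨rfl, rfl, fun j => ?_⟩) (fun i _ _ _ => ⟨rfl, rfl, fun j => Or.inl rfl⟩)
    (fun t _ _ _ => ⟨rfl, rfl, fun j => Or.inl rfl⟩) (fun _ _ => ⟨rfl, rfl, fun j => Or.inl rfl⟩)
  by_cases hj : j = l
  · right; subst hj; simp [Config.deliver]
  · left; simp [Config.deliver, hj]

theorem advance_eq_advanceBy_serverGaps (c : Config m) (I : Input) (delay : ℝ≥0∞)
    (x : Fin m → ℕ → ℝ) : c.advance I x delay = c.advanceBy I delay (serverGaps c x) := by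
  refine Config.advance_eq_advanceBy fun j hj => ?_
  unfold serverGaps
  cases hc : c.serving j with
  | none => exact absurd hc hj
  | some _ => simp

variable {I : Input} {π : Policy m E}

theorem run_succ_last (e : E) (x : Fin m → ℕ → ℝ) (k : ℕ) :
    run I π e x (k + 1) (Fin.last (k + 1)) =
      (((run I π e x k (Fin.last k)).place (π e k (run I π e x k)).toPlacement).advance I x
        (π e k (run I π e x k)).delay) := by
  simp [run]

/-- The original system is the chain with `pre = refresh` and no rearrangement afterwards, which
brings it under `map_chainStep`. -/
theorem chainStep_run (e : E) (x : Fin m → ℕ → ℝ) (k : ℕ) :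
    chainStep I π (fun _ w => w) refresh (fun _ _ W => W) k
        ((e, run I π e x k), serverGaps (run I π e x k (Fin.last k)) x) =
      ((e, run I π e x (k + 1)), serverGaps (run I π e x (k + 1) (Fin.last (k + 1))) x) := by
  have h1 := run_succ_last (I := I) (π := π) e x k
  set c := run I π e x k (Fin.last k)
  set d := π e k (run I π e x k)
  rw [advance_eq_advanceBy_serverGaps, serverGaps_place] at h1
  have h2 := (c.place d.toPlacement).serving_advanceBy I d.delay
    (refresh c.toStatus d.toPlacement (serverGaps c x))
  unfold chainStep
  refine Prod.ext (Prod.ext rfl ?_) ?_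
  · change Fin.snoc (α := fun _ => Config m) _ _ = _
    rw [run]
    congr 1
    rw [advance_eq_advanceBy_serverGaps, serverGaps_place]
  · simp only
    rw [h1, serverGaps_eq_gapsAfter x h2.1 h2.2.1 h2.2.2, serverGaps_place]

theorem measurePreserving_refresh {ρ : Measure ℝ} [IsProbabilityMeasure ρ] (c : Status m)
    (d : Placement m) : MeasurePreserving (refresh c d) (arrLaw m ρ) (arrLaw m ρ) := by
  classical
  refine measurePreserving_rowwise
    (f := fun j w => if c.serving j ≠ none ∧ d.serving j ≠ c.serving j then rowTail w else w)
    fun j => ?_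
  by_cases h : c.serving j ≠ none ∧ d.serving j ≠ c.serving j
  · simp only [if_pos h]; exact measurePreserving_rowTail ρ
  · simp only [if_neg h]; exact MeasurePreserving.id _

theorem time_le_nextArrival_run (e : E) (x : Fin m → ℕ → ℝ) (k : ℕ) :
    ((run I π e x k (Fin.last k)).time : EReal) ≤ (run I π e x k (Fin.last k)).nextArrival I := by
  induction k with
  | zero => exact Config.time_le_nextArrival_initial
  | succ k ih =>
    rw [run_succ_last, advance_eq_advanceBy_serverGaps]
    exact Config.time_le_nextArrival_advanceBy ih

/-! ### The dynamics driven by ranked clocks -/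

/-- The generation time of the packet at each server (`⊥` if the server is idle). -/
def servedAt (I : Input) (d : Placement m) (j : Fin m) : WithBot ℝ :=
  match d.serving j with
  | some p => (I.s p : WithBot ℝ)
  | none => ⊥

/-- The rank of the servers by decreasing generation times of their packets. -/
def rank (I : Input) (d : Placement m) : Equiv.Perm (Fin m) :=
  (Tuple.sort fun j => OrderDual.toDual (servedAt I d j)).symm

/-- The history and the residual gaps of the clocks when clock `l` drives the server of rank `l`,
and the clocks of idle servers keep running. -/
def clockChain (I : Input) (π : Policy m E) (e : E) (z : Fin m → ℕ → ℝ) :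
    (k : ℕ) → (E × (Fin (k + 1) → Config m)) × (Fin m → ℕ → ℝ)
  | 0 => ((e, fun _ => Config.initial m), z)
  | k + 1 => chainStep I π residual (fun _ d W => W ∘ rank I d) (fun _ d W => W ∘ (rank I d).symm)
      k (clockChain I π e z k)

variable [MeasurableSpace E]

theorem measurable_clockChain
    (hπ : ∀ k, Measurable fun q : E × (Fin (k + 1) → Config m) => π q.1 k q.2) (k : ℕ) :
    Measurable fun p : E × (Fin m → ℕ → ℝ) => clockChain I π p.1 p.2 k := by
  have hperm : ∀ σ : Equiv.Perm (Fin m), Measurable fun W : Fin m → ℕ → ℝ => W ∘ σ := fun σ =>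
    measurable_pi_lambda _ fun i => measurable_pi_apply (σ i)
  induction k with
  | zero => exact (measurable_fst.prodMk measurable_const).prodMk measurable_snd
  | succ k ih =>
    exact (measurable_chainStep hπ measurable_residual (fun _ d => hperm _)
      (fun _ d => hperm _) k).comp ih

variable {Ω : Type*} [MeasurableSpace Ω] {P : Measure Ω} [IsProbabilityMeasure P]
  {ρ : Measure ℝ} [IsProbabilityMeasure ρ] {X : Fin m → ℕ → Ω → ℝ} {ξ : Ω → E}

/-- Seed and gaps are independent, and the gaps are independent with law `ρ`. -/
theorem map_seed_gaps (hX_meas : ∀ j k, Measurable (X j k))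
    (hX_law : ∀ j k, P.map (X j k) = ρ)
    (hX_indep : iIndepFun (fun q : Fin m × ℕ => X q.1 q.2) P)
    (hξ_meas : Measurable ξ) (hξ_indep : IndepFun ξ (fun ω (q : Fin m × ℕ) => X q.1 q.2 ω) P) :
    P.map (fun ω => (ξ ω, fun j i => X j (1 + i) ω)) = (P.map ξ).prod (arrLaw m ρ) := by
  -- Services are numbered from `1`, so entry `0` of each row is discarded.
  let r : (Fin m × ℕ → ℝ) → Fin m → ℕ → ℝ := fun y j i => y (j, 1 + i)
  have hr : Measurable r := measurable_pi_lambda _ fun j => measurable_pi_lambda _ fun i =>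
    measurable_pi_apply _
  have hi : IndepFun ξ (fun ω j i => X j (1 + i) ω) P := hξ_indep.comp measurable_id hr
  have hm : Measurable fun ω j i => X j (1 + i) ω :=
    measurable_pi_lambda _ fun j => measurable_pi_lambda _ fun i => hX_meas _ _
  rw [(indepFun_iff_map_prod_eq_prod_map_map hξ_meas.aemeasurable hm.aemeasurable).1 hi]
  congr 1
  have hinj : Function.Injective fun q : Fin m × ℕ => (q.1, 1 + q.2) := by
    rintro ⟨a, b⟩ ⟨a', b'⟩ h
    simp only [Prod.mk.injEq, add_right_inj] at h
    exact Prod.ext h.1 h.2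
  have h1 := (hX_indep.precomp hinj).map_fun_eq_infinitePi_map (fun q => hX_meas _ _)
  simp only [hX_law] at h1
  have h2 := Measure.infinitePi_map_curry (fun (_ : Fin m) (_ : ℕ) => ρ)
  rw [← h1, Measure.map_map (MeasurableEquiv.measurable _)
    (measurable_pi_lambda _ fun q => hX_meas _ _), Measure.infinitePi_eq_pi] at h2
  exact h2

/-- Induction on the epoch. In both dynamics the residual gaps are fresh given seed and history, so
the law of the next history arises from the present one in the same way, by `nextHistory` with fresh
gaps, although the two dynamics use their gaps differently. -/
theorem map_run_serverGaps (hρ : IsMemoryless ρ)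
    (hπ : ∀ k, Measurable fun q : E × (Fin (k + 1) → Config m) => π q.1 k q.2)
    (hX_meas : ∀ j k, Measurable (X j k)) (hξ_meas : Measurable ξ)
    (hlaw : P.map (fun ω => (ξ ω, fun j i => X j (1 + i) ω)) = (P.map ξ).prod (arrLaw m ρ))
    (k : ℕ) :
    (Measurable fun ω => ((ξ ω, run I π (ξ ω) (fun j i => X j i ω) k),
      serverGaps (run I π (ξ ω) (fun j i => X j i ω) k (Fin.last k)) fun j i => X j i ω)) ∧
    P.map (fun ω => ((ξ ω, run I π (ξ ω) (fun j i => X j i ω) k),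
      serverGaps (run I π (ξ ω) (fun j i => X j i ω) k (Fin.last k)) fun j i => X j i ω)) =
        (P.map fun ω => (ξ ω, run I π (ξ ω) (fun j i => X j i ω) k)).prod (arrLaw m ρ) ∧
    ((P.map ξ).prod (arrLaw m ρ)).map (fun p => clockChain I π p.1 p.2 k) =
      (P.map fun ω => (ξ ω, run I π (ξ ω) (fun j i => X j i ω) k)).prod (arrLaw m ρ) := by
  have hprobξ := Measure.isProbabilityMeasure_map (μ := P) hξ_meas.aemeasurable
  have hXm : Measurable fun ω j i => X j (1 + i) ω :=
    measurable_pi_lambda _ fun j => measurable_pi_lambda _ fun i => hX_meas _ _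
  induction k with
  | zero =>
    let F : E → E × (Fin (0 + 1) → Config m) := fun e => (e, fun _ => Config.initial m)
    have hF : Measurable F := measurable_id.prodMk measurable_const
    have e0 : (fun ω => ((ξ ω, run I π (ξ ω) (fun j i => X j i ω) 0),
        serverGaps (run I π (ξ ω) (fun j i => X j i ω) 0 (Fin.last 0)) fun j i => X j i ω)) =
        Prod.map F id ∘ fun ω => (ξ ω, fun j i => X j (1 + i) ω) := by
      funext ω
      refine Prod.ext rfl ?_
      funext j i
      simp [run, serverGaps, Config.initial]
    have e1 : (fun ω => (ξ ω, run I π (ξ ω) (fun j i => X j i ω) 0)) = F ∘ ξ := rfl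
    have hmap : ((P.map ξ).prod (arrLaw m ρ)).map (Prod.map F id) =
        ((P.map ξ).map F).prod (arrLaw m ρ) := by
      rw [← Measure.map_prod_map _ _ hF measurable_id, Measure.map_id]
    refine ⟨?_, ?_, ?_⟩
    · rw [e0]
      exact (hF.prodMap measurable_id).comp (hξ_meas.prodMk hXm)
    · rw [e0, e1, ← Measure.map_map (hF.prodMap measurable_id) (hξ_meas.prodMk hXm), hlaw, hmap,
        Measure.map_map hF hξ_meas]
    · rw [e1, ← Measure.map_map hF hξ_meas, ← hmap]
      rfl
  | succ k ih =>
    obtain ⟨ih0, ih1, ih2⟩ := ih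
    have hfst : Measurable fun ω => (ξ ω, run I π (ξ ω) (fun j i => X j i ω) k) :=
      measurable_fst.comp ih0
    set ν := P.map fun ω => (ξ ω, run I π (ξ ω) (fun j i => X j i ω) k) with hν
    have hprobν : IsProbabilityMeasure ν := Measure.isProbabilityMeasure_map hfst.aemeasurable
    have hνae : ∀ᵐ q ∂ν, ((q.2 (Fin.last k)).time : EReal) ≤
        (q.2 (Fin.last k)).nextArrival I := by
      rw [hν, ae_map_iff hfst.aemeasurable]
      · exact ae_of_all _ fun ω => time_le_nextArrival_run _ _ k
      · have hlast : Measurable fun q : E × (Fin (k + 1) → Config m) => q.2 (Fin.last k) :=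
          (measurable_pi_apply (Fin.last k)).comp measurable_snd
        exact hlast (measurableSet_time_le_nextArrival I)
    have hidm : Measurable fun p : ℝ × (ℕ → ℝ) => p.2 := measurable_snd
    have stepX := map_chainStep (I := I) (π := π) (pre := refresh) (post := fun _ _ W => W)
      (Φ := fun _ w => w) hρ hπ hidm (fun τ _ => MeasurePreserving.id _)
      measurePreserving_refresh (fun _ _ => MeasurePreserving.id _) hνae
    -- Idle clocks are fresh by `measurePreserving_residual`, and reindexing by rank is harmless
    -- because the rows are independent with a common law.
    have stepZ := map_chainStep (I := I) (π := π) (pre := fun _ d W => W ∘ rank I d)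
      (post := fun _ d W => W ∘ (rank I d).symm) hρ hπ measurable_residual
      (fun τ hτ => measurePreserving_residual hρ hτ) (fun _ d => measurePreserving_comp_perm _)
      (fun _ d => measurePreserving_comp_perm _) hνae
    have hmX := measurable_chainStep (I := I) (π := π) (Φ := fun _ w => w) (pre := refresh)
      (post := fun _ _ W => W) hπ hidm
      (fun c d => (measurePreserving_refresh (ρ := ρ) c d).measurable)
      (fun _ _ => measurable_id) k
    have hmZ := measurable_chainStep (I := I) (π := π) (pre := fun _ d W => W ∘ rank I d)
      (post := fun _ d W => W ∘ (rank I d).symm) hπ measurable_residual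
      (fun _ d => (measurePreserving_comp_perm (ρ := ρ) _).measurable)
      (fun _ d => (measurePreserving_comp_perm (ρ := ρ) _).measurable) k
    have e0 : (fun ω => ((ξ ω, run I π (ξ ω) (fun j i => X j i ω) (k + 1)),
        serverGaps (run I π (ξ ω) (fun j i => X j i ω) (k + 1) (Fin.last (k + 1)))
          fun j i => X j i ω)) =
        chainStep I π (fun _ w => w) refresh (fun _ _ W => W) k ∘
        fun ω => ((ξ ω, run I π (ξ ω) (fun j i => X j i ω) k),
          serverGaps (run I π (ξ ω) (fun j i => X j i ω) k (Fin.last k)) fun j i => X j i ω) := by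
      funext ω
      exact (chainStep_run (ξ ω) (fun j i => X j i ω) k).symm
    have hm1 : Measurable fun ω => ((ξ ω, run I π (ξ ω) (fun j i => X j i ω) (k + 1)),
        serverGaps (run I π (ξ ω) (fun j i => X j i ω) (k + 1) (Fin.last (k + 1)))
          fun j i => X j i ω) := by
      rw [e0]; exact hmX.comp ih0
    have hlawX : P.map (fun ω => ((ξ ω, run I π (ξ ω) (fun j i => X j i ω) (k + 1)),
        serverGaps (run I π (ξ ω) (fun j i => X j i ω) (k + 1) (Fin.last (k + 1)))
          fun j i => X j i ω)) =
        ((ν.prod (arrLaw m ρ)).map fun p => nextHistory I π k p.1 p.2).prod (arrLaw m ρ) := by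
      rw [e0, ← Measure.map_map hmX ih0, ih1, stepX]
    have hprobN := Measure.isProbabilityMeasure_map (μ := ν.prod (arrLaw m ρ))
      (measurable_nextHistory (I := I) hπ k).aemeasurable
    have hnext : (P.map fun ω => (ξ ω, run I π (ξ ω) (fun j i => X j i ω) (k + 1))) =
        (ν.prod (arrLaw m ρ)).map fun p => nextHistory I π k p.1 p.2 := by
      have := congrArg Measure.fst hlawX
      rw [Measure.fst_prod, Measure.fst, Measure.map_map measurable_fst hm1] at this
      exact this
    refine ⟨hm1, by rw [hnext, hlawX], ?_⟩
    rw [hnext, ← stepZ, ← ih2, Measure.map_map hmZ (measurable_clockChain hπ k)]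
    rfl

end

/-! ### Invariants of the states under feasible decisions -/

section

variable {m : ℕ}

/-- The invariants of the observable states. -/
structure Config.Regular (I : Input) (c : Config m) : Prop where
  arrived_spec : ∀ i ∈ c.arrived, (i : ℕ∞) < I.n ∧ I.a i ≤ c.time
  delivered_subset : c.delivered ⊆ c.arrived
  inSystem_spec : ∀ p, c.InSystem p → p ∈ c.arrived ∧ p ∉ c.delivered
  serving_inj : ∀ j j' p, c.serving j = some p → c.serving j' = some p → j = j'
  serving_queue : ∀ j p, c.serving j = some p → p ∉ c.queue
  queue_card : (c.queue.card : ℕ∞) ≤ I.B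
  incoming_spec : ∀ p, c.incoming = some p → (∀ j, c.serving j ≠ some p) ∧ p ∉ c.queue
  time_le : (c.time : EReal) ≤ c.nextArrival I

theorem Config.regular_initial (I : Input) : (Config.initial m).Regular I where
  arrived_spec := by simp [Config.initial]
  delivered_subset := by simp [Config.initial]
  inSystem_spec := by simp [Config.initial, Status.InSystem]
  serving_inj := by simp [Config.initial]
  serving_queue := by simp [Config.initial]
  queue_card := by simp [Config.initial]
  incoming_spec := by simp [Config.initial]
  time_le := Config.time_le_nextArrival_initial

variable {I : Input} {c : Config m} {d : Placement m} {delay : ℝ≥0∞} {W : Fin m → ℕ → ℝ}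

theorem Config.Regular.place (hc : c.Regular I) (hd : Feasible I.B c.toStatus d) :
    (c.place d).Regular I where
  arrived_spec := hc.arrived_spec
  delivered_subset := hc.delivered_subset
  inSystem_spec := by
    rintro p (⟨j, hj⟩ | hp | hp)
    · exact hc.inSystem_spec p (hd.serving_mem j p hj)
    · exact hc.inSystem_spec p (hd.queue_mem p hp)
    · exact absurd hp (by simp [Config.place])
  serving_inj := hd.serving_inj
  serving_queue := hd.serving_queue
  queue_card := hd.queue_card
  incoming_spec := by simp [Config.place]
  time_le := hc.time_le

/-- The state at the next epoch: the invariants, and the monotonicity of time and deliveries. -/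
theorem Config.Regular.advanceBy (hc : c.Regular I) (hin : c.incoming = none)
    (hW : ∀ j, 0 ≤ W j 0) :
    (c.advanceBy I delay W).Regular I ∧ c.time ≤ (c.advanceBy I delay W).time ∧
      c.delivered ⊆ (c.advanceBy I delay W).delivered := by
  have htime := Config.time_le_nextArrival_advanceBy (delay := delay) (W := W) hc.time_le
  revert htime
  refine c.advanceBy_cases I delay W (p := fun c' => (c'.time : EReal) ≤ c'.nextArrival I →
    c'.Regular I ∧ c.time ≤ c'.time ∧ c.delivered ⊆ c'.delivered) ?_ ?_ ?_ ?_
  · intro l hl hd hf htime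
    obtain ⟨p, hp⟩ := Option.ne_none_iff_exists'.1 hl
    have hserv : ∀ j q, (c.deliver (c.time + W l 0) l).serving j = some q →
        j ≠ l ∧ c.serving j = some q := by
      intro j q hq
      by_cases hj : j = l
      · subst hj; simp [Config.deliver] at hq
      · exact ⟨hj, by simpa [Config.deliver, hj] using hq⟩
    have hdel : (c.deliver (c.time + W l 0) l).delivered = c.delivered ∪ {p} := by
      simp [Config.deliver, hp]
    have hle : c.time ≤ c.time + W l 0 := by linarith [hW l]
    have hp' := hc.inSystem_spec p (Or.inl ⟨l, hp⟩)
    refine ⟨⟨fun i hi => ⟨(hc.arrived_spec i hi).1, (hc.arrived_spec i hi).2.trans hle⟩, ?_, ?_,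
      ?_, ?_, hc.queue_card, ?_, htime⟩, hle, ?_⟩
    · rw [hdel]
      exact Finset.union_subset hc.delivered_subset (Finset.singleton_subset_iff.2 hp'.1)
    · intro q hq
      rw [hdel]
      have hqp : c.InSystem q ∧ q ≠ p := by
        rcases hq with ⟨j, hj⟩ | hq | hq
        · obtain ⟨hjl, hj⟩ := hserv j q hj
          refine ⟨Or.inl ⟨j, hj⟩, ?_⟩
          rintro rfl
          exact hjl (hc.serving_inj j l q hj hp)
        · refine ⟨Or.inr (Or.inl hq), ?_⟩
          rintro rfl
          exact hc.serving_queue l q hp hq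
        · exact absurd (show c.incoming = some q from hq) (by simp [hin])
      have := hc.inSystem_spec q hqp.1
      exact ⟨this.1, by simp [this.2, hqp.2]⟩
    · intro j j' q hj hj'
      exact hc.serving_inj j j' q (hserv j q hj).2 (hserv j' q hj').2
    · intro j q hj
      exact hc.serving_queue j q (hserv j q hj).2
    · intro q hq
      exact absurd (show c.incoming = some q from hq) (by simp [hin])
    · rw [hdel]; exact Finset.subset_union_left
  · intro i hi hd _ htime
    have hspec := Input.next_spec hi
    have hle : c.time ≤ I.a i := by
      rw [← EReal.coe_le_coe_iff, hd]
      exact Config.le_deadline hc.time_le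
    have hnew : ∀ q, c.InSystem q → q ≠ i := by
      rintro q hq rfl
      exact hspec.2.1 (hc.inSystem_spec q hq).1
    refine ⟨⟨?_, ?_, ?_, hc.serving_inj, hc.serving_queue, hc.queue_card, ?_, htime⟩, hle,
      Finset.Subset.refl _⟩
    · intro q hq
      rcases Finset.mem_insert.1 (show q ∈ insert i c.arrived from hq) with rfl | hq
      · exact ⟨hspec.1, le_rfl⟩
      · exact ⟨(hc.arrived_spec q hq).1, (hc.arrived_spec q hq).2.trans hle⟩
    · exact hc.delivered_subset.trans (Finset.subset_insert _ _)
    · rintro q (hq | hq | hq)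
      · have := hc.inSystem_spec q (Or.inl hq)
        exact ⟨Finset.mem_insert_of_mem this.1, this.2⟩
      · have := hc.inSystem_spec q (Or.inr (Or.inl hq))
        exact ⟨Finset.mem_insert_of_mem this.1, this.2⟩
      · obtain rfl : i = q := Option.some_injective _ hq
        exact ⟨Finset.mem_insert_self _ _, fun h => hspec.2.1 (hc.delivered_subset h)⟩
    · intro q hq
      obtain rfl : i = q := Option.some_injective _ hq
      exact ⟨fun j hj => hnew i (Or.inl ⟨j, hj⟩) rfl,
        fun h => hnew i (Or.inr (Or.inl h)) rfl⟩
  · intro t ht _ _ htime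
    have hle : c.time ≤ t := by
      rw [← EReal.coe_le_coe_iff, ht]
      exact Config.le_deadline hc.time_le
    exact ⟨⟨fun i hi => ⟨(hc.arrived_spec i hi).1, (hc.arrived_spec i hi).2.trans hle⟩,
      hc.delivered_subset, hc.inSystem_spec, hc.serving_inj, hc.serving_queue, hc.queue_card,
      hc.incoming_spec, htime⟩, hle, Finset.Subset.refl _⟩
  · exact fun _ _ _ => ⟨hc, le_rfl, Finset.Subset.refl _⟩

theorem Config.advanceBy_time_le {j : Fin m} (hj : c.Busy j) :
    (c.advanceBy I delay W).time ≤ c.time + W j 0 := by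
  refine c.advanceBy_cases I delay W (p := fun c' => c'.time ≤ c.time + W j 0)
    (fun l _ _ hf => ?_) (fun i _ _ h => (h j hj).le) (fun t _ _ h => (h j hj).le)
    (fun _ h => absurd hj (h j))
  change c.time + W l 0 ≤ c.time + W j 0
  rcases lt_trichotomy j l with h | h | h
  · linarith [(hf j h.ne hj).1 h]
  · rw [h]
  · linarith [(hf j h.ne' hj).2 h]

theorem Config.advanceBy_time_of_completed {j : Fin m} (hj : c.Busy j)
    (hj' : ¬(c.advanceBy I delay W).Busy j) :
    (c.advanceBy I delay W).time = c.time + W j 0 := by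
  revert hj'
  refine c.advanceBy_cases I delay W (p := fun c' => ¬c'.Busy j → c'.time = c.time + W j 0)
    (fun l _ _ _ h => ?_) (fun i _ _ _ h => absurd hj h) (fun t _ _ _ h => absurd hj h)
    (fun _ _ h => absurd hj h)
  by_cases hjl : j = l
  · rw [hjl]; rfl
  · refine absurd hj fun h' => h ?_
    simpa [Config.Busy, Config.deliver, hjl] using h'

theorem Config.exists_of_mem_delivered_advanceBy {i : ℕ}
    (hi : i ∈ (c.advanceBy I delay W).delivered) :
    i ∈ c.delivered ∨ ∃ j, c.serving j = some i ∧
      (c.advanceBy I delay W).time = c.time + W j 0 := by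
  revert hi
  refine c.advanceBy_cases I delay W (p := fun c' => i ∈ c'.delivered → i ∈ c.delivered ∨
    ∃ j, c.serving j = some i ∧ c'.time = c.time + W j 0)
    (fun l _ _ _ h => ?_) (fun _ _ _ _ h => Or.inl h) (fun _ _ _ _ h => Or.inl h)
    (fun _ _ h => Or.inl h)
  rcases Finset.mem_union.1 (show i ∈ c.delivered ∪ (c.serving l).toFinset from h) with h | h
  · exact Or.inl h
  · exact Or.inr ⟨l, by simpa using h, rfl⟩

theorem gapsAfter_nonneg {Φ : ℝ → (ℕ → ℝ) → ℕ → ℝ} (hW : ∀ j i, 0 ≤ W j i)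
    (hΦ : ∀ τ w, 0 ≤ τ → (∀ i, 0 ≤ w i) → ∀ i, 0 ≤ Φ τ w i)
    (ht : c.time ≤ (c.advanceBy I delay W).time) (j : Fin m) (i : ℕ) :
    0 ≤ gapsAfter Φ c (c.advanceBy I delay W) W j i := by
  unfold gapsAfter
  cases hc : c.serving j with
  | none => exact hΦ _ _ (sub_nonneg.2 ht) (hW j) i
  | some p =>
    cases hc' : (c.advanceBy I delay W).serving j with
    | none => exact hW j (i + 1)
    | some q =>
      cases i with
      | zero =>
        have := Config.advanceBy_time_le (c := c) (I := I) (delay := delay) (W := W) (j := j)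
          (by simp [Config.Busy, hc])
        simp only [subHead_zero_apply]
        linarith
      | succ i => exact hW j (i + 1)

theorem residual_nonneg {τ : ℝ} {w : ℕ → ℝ} (hw : ∀ i, 0 ≤ w i) (i : ℕ) :
    0 ≤ residual τ w i := by
  by_cases h : ∃ n, PassAt τ w n
  · obtain ⟨n, hn⟩ := h
    rw [hn.residual_eq]
    cases i with
    | zero => simpa [residualAt] using hn.1.le
    | succ i => exact hw _
  · rw [residual, dif_neg h]; exact hw i

end

/-! ### The original dynamics -/

section

variable {m : ℕ} {E : Type*} {I : Input} {π : Policy m E} {e : E} {x : Fin m → ℕ → ℝ}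

theorem stateAt_succ (k : ℕ) : stateAt I π e x (k + 1) =
    ((stateAt I π e x k).place (π e k (run I π e x k)).toPlacement).advanceBy I
      (π e k (run I π e x k)).delay (refresh (stateAt I π e x k).toStatus
        (π e k (run I π e x k)).toPlacement (serverGaps (stateAt I π e x k) x)) := by
  unfold stateAt
  rw [run_succ_last, advance_eq_advanceBy_serverGaps, serverGaps_place]

theorem refresh_nonneg {c : Status m} {d : Placement m} {W : Fin m → ℕ → ℝ}
    (hW : ∀ j i, 0 ≤ W j i) (j : Fin m) (i : ℕ) : 0 ≤ refresh c d W j i := by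
  unfold refresh
  split_ifs
  · exact hW j (i + 1)
  · exact hW j i

/-- Regularity and nonnegative gaps are propagated together: nonnegative gaps keep time from running
backwards, on which regularity rests. -/
theorem stateAt_step (hfeas : Feasible I.B (stateAt I π e x k).toStatus
      (π e k (run I π e x k)).toPlacement)
    (hreg : (stateAt I π e x k).Regular I)
    (hgaps : ∀ j i, 0 ≤ serverGaps (stateAt I π e x k) x j i) :
    ((stateAt I π e x (k + 1)).Regular I ∧
      ∀ j i, 0 ≤ serverGaps (stateAt I π e x (k + 1)) x j i) ∧
    (stateAt I π e x k).time ≤ (stateAt I π e x (k + 1)).time ∧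
    (stateAt I π e x k).delivered ⊆ (stateAt I π e x (k + 1)).delivered := by
  have hst := stateAt_succ (I := I) (π := π) (e := e) (x := x) k
  set c := stateAt I π e x k
  set d := π e k (run I π e x k)
  have hW := refresh_nonneg (c := c.toStatus) (d := d.toPlacement) hgaps
  have h := (hreg.place hfeas).advanceBy (delay := d.delay) rfl fun j => hW j 0
  have h2 := (c.place d.toPlacement).serving_advanceBy I d.delay
    (refresh c.toStatus d.toPlacement (serverGaps c x))
  have h3 : ∀ j i, 0 ≤ serverGaps ((c.place d.toPlacement).advanceBy I d.delay
      (refresh c.toStatus d.toPlacement (serverGaps c x))) x j i := by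
    rw [serverGaps_eq_gapsAfter x h2.1 h2.2.1 h2.2.2, serverGaps_place]
    exact gapsAfter_nonneg hW (fun _ _ _ h => h) h.2.1
  rw [hst]
  exact ⟨⟨h.1, h3⟩, h.2⟩

theorem stateAt_zero_spec (hx : ∀ j k, 0 < x j k) : (stateAt I π e x 0).Regular I ∧
    ∀ j i, 0 ≤ serverGaps (stateAt I π e x 0) x j i := by
  refine ⟨Config.regular_initial I, fun j i => ?_⟩
  rw [serverGaps_of_none x (rfl : (stateAt I π e x 0).serving j = none)]
  exact (hx _ _).le

end

/-! ### The preemptive Last-Generated-First-Served policy is causal -/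

section

variable {m : ℕ} {I : Input}

theorem mem_store {B : ℕ∞} {q : Finset ℕ} {p r : ℕ} (h : r ∈ store B q p) : r = p ∨ r ∈ q := by
  unfold store at h
  split_ifs at h
  · exact Finset.mem_insert.1 h
  · exact Or.inr h

theorem store_card {B : ℕ∞} {q : Finset ℕ} {p : ℕ} (h : (q.card : ℕ∞) ≤ B) :
    ((store B q p).card : ℕ∞) ≤ B := by
  unfold store
  split_ifs with h'
  · refine le_trans ?_ (Order.add_one_le_of_lt h')
    exact_mod_cast Finset.card_insert_le p q
  · exact h

theorem update_eq_some {f : Fin m → Option ℕ} {j₀ j : Fin m} {p q : ℕ}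
    (h : Function.update f j₀ (some p) j = some q) :
    (j = j₀ ∧ p = q) ∨ (j ≠ j₀ ∧ f j = some q) := by
  by_cases hj : j = j₀
  · subst hj
    exact Or.inl ⟨rfl, by simpa using h⟩
  · exact Or.inr ⟨hj, by simpa [hj] using h⟩

/-- Covers every case in which one server receives a packet: an idle server, a preemption, a refill
from the queue. -/
theorem Feasible.update {B : ℕ∞} {c : Status m} {j₀ : Fin m} {p : ℕ} {q : Finset ℕ}
    (hp : c.InSystem p) (hpj : ∀ j, j ≠ j₀ → c.serving j ≠ some p) (hpq : p ∉ q)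
    (hinj : ∀ j j' p, c.serving j = some p → c.serving j' = some p → j = j')
    (hq : ∀ r ∈ q, c.InSystem r) (hsq : ∀ j r, j ≠ j₀ → c.serving j = some r → r ∉ q)
    (hcard : (q.card : ℕ∞) ≤ B) :
    Feasible B c ⟨Function.update c.serving j₀ (some p), q⟩ where
  serving_mem j r h := by
    rcases update_eq_some h with ⟨-, rfl⟩ | ⟨-, h⟩
    · exact hp
    · exact Or.inl ⟨j, h⟩
  queue_mem := hq
  serving_inj j j' r h h' := by
    rcases update_eq_some h with ⟨hj, rfl⟩ | ⟨hj, h⟩ <;>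
      rcases update_eq_some h' with ⟨hj', h'⟩ | ⟨hj', h'⟩
    · rw [hj, hj']
    · exact absurd h' (hpj j' hj')
    · exact absurd (h' ▸ h) (hpj j hj)
    · exact hinj j j' r h h'
  serving_queue j r h := by
    rcases update_eq_some h with ⟨-, rfl⟩ | ⟨hj, h⟩
    · exact hpq
    · exact hsq j r hj h
  queue_card := hcard

theorem feasible_lgfsPlacement {c : Config m} (hc : c.Regular I) :
    Feasible I.B c.toStatus (lgfsPlacement I c.toStatus) := by
  unfold lgfsPlacement
  split
  · rename_i p hp
    have hin := hc.incoming_spec p hp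
    split_ifs with h1 h2
    · exact Feasible.update (Or.inr (Or.inr hp)) (fun j _ => hin.1 j) hin.2 hc.serving_inj
        (fun r hr => Or.inr (Or.inl hr)) (fun j r _ h => hc.serving_queue j r h) hc.queue_card
    · obtain ⟨hr, -, -⟩ := h2.choose_spec
      refine Feasible.update (Or.inr (Or.inr hp)) (fun j _ => hin.1 j) (fun h => ?_)
        hc.serving_inj (fun r h => ?_) (fun j r hj h h' => ?_) (store_card hc.queue_card)
      · rcases mem_store h with h | h
        · exact hin.1 _ (hr.trans (congrArg some h.symm))
        · exact hin.2 h
      · rcases mem_store h with h | h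
        · exact Or.inl ⟨_, hr.trans (congrArg some h.symm)⟩
        · exact Or.inr (Or.inl h)
      · rcases mem_store h' with h' | h'
        · exact hj (hc.serving_inj _ _ r h (hr.trans (congrArg some h'.symm)))
        · exact hc.serving_queue j r h h'
    · refine ⟨fun j r h => Or.inl ⟨j, h⟩, fun r h => ?_, hc.serving_inj, fun j r h h' => ?_,
        store_card hc.queue_card⟩
      · rcases mem_store h with h | h
        · exact Or.inr (Or.inr (hp.trans (congrArg some h.symm)))
        · exact Or.inr (Or.inl h)
      · rcases mem_store h' with h' | h'
        · exact hin.1 j (h.trans (congrArg some h'))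
        · exact hc.serving_queue j r h h'
  · split_ifs with h1
    · obtain ⟨hr, hq, -⟩ := h1.choose_spec
      refine Feasible.update (Or.inr (Or.inl hq)) (fun j _ h => hc.serving_queue j _ h hq)
        (Finset.notMem_erase _ _) hc.serving_inj
        (fun r h => Or.inr (Or.inl (Finset.mem_of_mem_erase h)))
        (fun j r _ h h' => hc.serving_queue j r h (Finset.mem_of_mem_erase h')) ?_
      refine le_trans ?_ hc.queue_card
      exact_mod_cast Finset.card_erase_le
    · exact ⟨fun j r h => Or.inl ⟨j, h⟩, fun r h => Or.inr (Or.inl h), hc.serving_inj,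
        hc.serving_queue, hc.queue_card⟩

theorem prmpLGFS_mem_causalPolicies (m : ℕ) (E : Type*) [MeasurableSpace E] (I : Input) :
    prmpLGFS m E I ∈ causalPolicies m E I := by
  refine ⟨fun k => ?_, fun e x hx k => ?_⟩
  · have hl : Measurable fun q : E × (Fin (k + 1) → Config m) => (q.2 (Fin.last k)).toStatus :=
      Config.measurable_toStatus.comp ((measurable_pi_apply _).comp measurable_snd)
    exact Decision.measurable_iff.2
      ⟨(Measurable.of_discrete (f := fun c : Status m => lgfsPlacement I c)).comp hl,
        measurable_const⟩
  -- Feasibility at epoch `k` needs regularity there, which needs feasibility earlier; the induction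
  -- is therefore on regularity.
  · suffices h : (stateAt I (prmpLGFS m E I) e x k).Regular I ∧
        ∀ j i, 0 ≤ serverGaps (stateAt I (prmpLGFS m E I) e x k) x j i from
      feasible_lgfsPlacement h.1
    induction k with
    | zero => exact stateAt_zero_spec hx
    | succ k ih => exact (stateAt_step (feasible_lgfsPlacement ih.1) ih.1 ih.2).1

end

/-! ### The ranking of the servers -/

section

variable {m : ℕ} {I : Input} {d : Placement m}

theorem antitone_servedAt_rank (I : Input) (d : Placement m) :
    Antitone fun l => servedAt I d ((rank I d).symm l) := by
  intro l l' h
  exact Tuple.monotone_sort (fun j => OrderDual.toDual (servedAt I d j)) h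

theorem le_servedAt_iff {v : ℝ} {j : Fin m} :
    (v : WithBot ℝ) ≤ servedAt I d j ↔ ∃ q, d.serving j = some q ∧ v ≤ I.s q := by
  unfold servedAt
  cases d.serving j with
  | none => simp
  | some q => simp

/-- At least `rank + 1` packets under service are as fresh as the one of a given rank. -/
theorem exists_finset_of_serving
    (hinj : ∀ j j' p, d.serving j = some p → d.serving j' = some p → j = j') {j : Fin m} {i : ℕ}
    (hi : d.serving j = some i) :
    ∃ A : Finset ℕ, (∀ p ∈ A, (∃ j', d.serving j' = some p) ∧ I.s i ≤ I.s p) ∧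
      (rank I d j : ℕ) + 1 ≤ A.card := by
  classical
  -- All ranks up to that of `j` are busy with packets at least as fresh, since idle servers have
  -- the value `⊥` and come last.
  have hkey : ∀ r ∈ Finset.Iic (rank I d j), ∃ q, d.serving ((rank I d).symm r) = some q ∧
      I.s i ≤ I.s q := by
    intro r hr
    rw [← le_servedAt_iff]
    refine le_trans ?_ (antitone_servedAt_rank I d (Finset.mem_Iic.1 hr))
    simp only [Equiv.symm_apply_apply]
    exact le_servedAt_iff.2 ⟨i, hi, le_rfl⟩
  choose! f hf using hkey
  refine ⟨(Finset.Iic (rank I d j)).image f, ?_, ?_⟩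
  · intro p hp
    obtain ⟨r, hr, rfl⟩ := Finset.mem_image.1 hp
    exact ⟨⟨_, (hf r hr).1⟩, (hf r hr).2⟩
  · rw [Finset.card_image_of_injOn, Fin.card_Iic]
    intro r hr r' hr' h
    have h1 := (hf r hr).1
    have h2 := (hf r' hr').1
    rw [h] at h1
    exact (rank I d).symm.injective (hinj _ _ _ h1 h2)

open Classical in
/-- The server of rank `l` has a packet at least as fresh as `v` if `l + 1` servers have one. -/
theorem serving_of_rank {v : ℝ} {l : Fin m}
    (h : (l : ℕ) + 1 ≤ (Finset.univ.filter fun j => ∃ q, d.serving j = some q ∧ v ≤ I.s q).card) :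
    ∃ q, d.serving ((rank I d).symm l) = some q ∧ v ≤ I.s q := by
  by_contra hl
  rw [← le_servedAt_iff, not_le] at hl
  -- If the server of rank `l` were idle or staler than `v`, all counted servers would have ranks
  -- below `l`, and there are only `l` of these.
  have hsub : (Finset.univ.filter fun j => ∃ q, d.serving j = some q ∧ v ≤ I.s q) ⊆
      (Finset.Iio l).image (rank I d).symm := by
    intro j hj
    have hj' := (Finset.mem_filter.1 hj).2
    rw [← le_servedAt_iff] at hj'
    refine Finset.mem_image.2 ⟨rank I d j, Finset.mem_Iio.2 ?_, by simp⟩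
    by_contra hlj
    have := antitone_servedAt_rank I d (not_lt.1 hlj)
    simp only [Equiv.symm_apply_apply] at this
    exact absurd (hj'.trans this) (not_le.2 hl)
  have := (Finset.card_le_card hsub).trans Finset.card_image_le
  rw [Fin.card_Iio] at this
  omega

end

/-! ### Renewal times along the dynamics -/

section

variable {m : ℕ} {E : Type*}

theorem psum_residualAt (τ : ℝ) (w : ℕ → ℝ) (n k : ℕ) :
    psum (residualAt τ w n) (k + 1) = psum w (n + k + 1) - τ := by
  induction k with
  | zero => simp [psum_succ', residualAt]
  | succ k ih =>
    rw [psum_succ, ih]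
    have : residualAt τ w n (k + 1) = w (n + k + 1) := by
      simp only [residualAt, rowCons_succ]; congr 1; omega
    rw [this, show n + (k + 1) + 1 = (n + k + 1) + 1 by omega, psum_succ w (n + k + 1)]
    ring

/-- The gaps `w` at time `t` are those of the renewal process with gaps `z`. -/
def Synced (t : ℝ) (w z : ℕ → ℝ) : Prop :=
  ∃ N, (∀ n, t + psum w (n + 1) = psum z (N + n + 1)) ∧ ∀ n < N, psum z (n + 1) ≤ t

theorem Synced.subHead {t τ : ℝ} {w z : ℕ → ℝ} (h : Synced t w z) (hτ : 0 ≤ τ) :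
    Synced (t + τ) (subHead τ w) z := by
  obtain ⟨N, h1, h2⟩ := h
  refine ⟨N, fun n => ?_, fun n hn => by linarith [h2 n hn]⟩
  rw [psum_subHead, ← h1]; ring

theorem Synced.rowTail {t : ℝ} {w z : ℕ → ℝ} (h : Synced t w z) (hw : 0 ≤ w 0) :
    Synced (t + w 0) (rowTail w) z := by
  obtain ⟨N, h1, h2⟩ := h
  refine ⟨N + 1, fun n => ?_, fun n hn => ?_⟩
  · have := h1 (n + 1)
    rw [psum_succ'] at this
    rw [add_assoc, this]
    congr 1; omega
  · rcases Nat.lt_succ_iff_lt_or_eq.1 hn with hn | rfl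
    · linarith [h2 n hn]
    · have := h1 0
      simp only [psum_succ, psum_zero, add_zero, zero_add] at this
      rw [psum_succ, this]

/-- Unbounded renewal times exclude the default value of `residual`; the index `N + n₀` adds the
`n₀` rings that went by unused. -/
theorem Synced.residual {t τ : ℝ} {w z : ℕ → ℝ} (h : Synced t w z) (hτ : 0 ≤ τ)
    (hz : ∃ n, t + τ < psum z (n + 1)) : Synced (t + τ) (residual τ w) z := by
  obtain ⟨N, h1, h2⟩ := h
  obtain ⟨n', hn'⟩ := hz
  have hex : ∃ n, τ < psum w (n + 1) := by
    rcases lt_or_ge n' N with hN | hN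
    · linarith [h2 n' hN]
    · refine ⟨n' - N, ?_⟩
      have := h1 (n' - N)
      rw [Nat.add_sub_cancel' hN] at this
      linarith
  obtain ⟨n₀, hn₀⟩ := exists_passAt hex
  rw [hn₀.residual_eq]
  refine ⟨N + n₀, fun n => ?_, fun n hn => ?_⟩
  · rw [psum_residualAt]
    have := h1 (n₀ + n)
    rw [← add_assoc] at this
    rw [← this]; ring
  · rcases lt_or_ge n N with hN | hN
    · linarith [h2 n hN]
    · have := h1 (n - N)
      rw [Nat.add_sub_cancel' hN] at this
      linarith [hn₀.2 (n - N) (by omega)]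

/-- The observable state at epoch `k` of the dynamics driven by ranked clocks. -/
def clockState (I : Input) (π : Policy m E) (e : E) (z : Fin m → ℕ → ℝ) (k : ℕ) : Config m :=
  (clockChain I π e z k).1.2 (Fin.last k)

/-- The decision at epoch `k` of the dynamics driven by ranked clocks. -/
def clockDecision (I : Input) (π : Policy m E) (e : E) (z : Fin m → ℕ → ℝ) (k : ℕ) :
    Decision m :=
  π (clockChain I π e z k).1.1 k (clockChain I π e z k).1.2

/-- The residual gaps at the servers right after the decision at epoch `k`. -/
def clockGaps (I : Input) (π : Policy m E) (e : E) (z : Fin m → ℕ → ℝ) (k : ℕ) :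
    Fin m → ℕ → ℝ :=
  (clockChain I π e z k).2 ∘ rank I (clockDecision I π e z k).toPlacement

variable {I : Input} {π : Policy m E} {e : E} {z : Fin m → ℕ → ℝ} {k : ℕ}

theorem clockState_succ : clockState I π e z (k + 1) =
    ((clockState I π e z k).place (clockDecision I π e z k).toPlacement).advanceBy I
      (clockDecision I π e z k).delay (clockGaps I π e z k) := by
  unfold clockState
  simp only [clockChain, chainStep, nextHistory, Fin.snoc_last]
  rfl

theorem clockChain_succ_snd : (clockChain I π e z (k + 1)).2 =
    gapsAfter residual ((clockState I π e z k).place (clockDecision I π e z k).toPlacement)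
      (clockState I π e z (k + 1)) (clockGaps I π e z k) ∘
        (rank I (clockDecision I π e z k).toPlacement).symm := by
  rw [clockState_succ]
  rfl

/-- All decisions up to epoch `k` are feasible. -/
def ClockFeasible (I : Input) (π : Policy m E) (e : E) (z : Fin m → ℕ → ℝ) : Prop :=
  ∀ k, Feasible I.B (clockState I π e z k).toStatus (clockDecision I π e z k).toPlacement

/-- The invariants of the dynamics driven by ranked clocks. -/
structure ClockInv (I : Input) (π : Policy m E) (e : E) (z : Fin m → ℕ → ℝ) (k : ℕ) : Prop where
  regular : (clockState I π e z k).Regular I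
  nonneg : ∀ l i, 0 ≤ (clockChain I π e z k).2 l i
  synced : ∀ l, Synced (clockState I π e z k).time ((clockChain I π e z k).2 l) (z l)

/-- The core of the coupling. A row is aged by `residual`, `rowTail` or `subHead` according as its
server is idle, delivers or goes on, and each operation keeps it in step with the same renewal
process `z l`; a change of the server driven by the clock is a mere reindexing. So the ring times do
not depend on the policy. -/
theorem ClockInv.step (h : ClockInv I π e z k)
    (hf : Feasible I.B (clockState I π e z k).toStatus (clockDecision I π e z k).toPlacement)
    (hz : ∀ l t, ∃ n, t < psum (z l) (n + 1)) :
    ClockInv I π e z (k + 1) ∧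
      (clockState I π e z k).time ≤ (clockState I π e z (k + 1)).time ∧
      (clockState I π e z k).delivered ⊆ (clockState I π e z (k + 1)).delivered := by
  set c := clockState I π e z k
  set d := clockDecision I π e z k
  set V := clockGaps I π e z k
  have hV : ∀ j i, 0 ≤ V j i := fun j i => h.nonneg _ i
  have hc' : clockState I π e z (k + 1) = (c.place d.toPlacement).advanceBy I d.delay V :=
    clockState_succ
  have hadv := (h.regular.place hf).advanceBy (delay := d.delay) rfl fun j => hV j 0
  rw [← hc'] at hadv
  have ht : c.time ≤ (clockState I π e z (k + 1)).time := hadv.2.1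
  refine ⟨⟨hadv.1, fun l i => ?_, fun l => ?_⟩, hadv.2⟩
  · rw [clockChain_succ_snd, hc']
    refine gapsAfter_nonneg hV (fun _ _ _ hw => residual_nonneg hw) ?_ _ i
    rw [← hc']; exact ht
  · rw [clockChain_succ_snd]
    set j := (rank I d.toPlacement).symm l with hj
    have hs : Synced c.time (V j) (z l) := by
      have : V j = (clockChain I π e z k).2 l := by
        simp only [V, clockGaps, Function.comp, hj]
        rw [Equiv.apply_symm_apply]
      rw [this]; exact h.synced l
    change Synced _ (gapsAfter residual (c.place d.toPlacement) (clockState I π e z (k + 1)) V j) _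
    set t' := (clockState I π e z (k + 1)).time with ht'
    have htt : c.time + (t' - c.time) = t' := by ring
    have hτ : 0 ≤ t' - c.time := sub_nonneg.2 ht
    unfold gapsAfter
    cases hcj : (c.place d.toPlacement).serving j with
    | none =>
      have := hs.residual hτ (hz l _)
      rw [htt] at this
      exact this
    | some p =>
      have hbusy : (c.place d.toPlacement).Busy j := by simp [Config.Busy, hcj]
      cases hcj' : (clockState I π e z (k + 1)).serving j with
      | none =>
        have htj : t' = c.time + V j 0 := by
          rw [ht', hc']
          refine Config.advanceBy_time_of_completed hbusy ?_
          rw [← hc']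
          simp [Config.Busy, hcj']
        rw [htj]
        exact hs.rowTail (hV j 0)
      | some q =>
        have := hs.subHead hτ
        rw [htt] at this
        exact this

theorem clockInv_of_feasible (hf : ClockFeasible I π e z) (hz0 : ∀ l i, 0 ≤ z l i)
    (hz : ∀ l t, ∃ n, t < psum (z l) (n + 1)) (k : ℕ) : ClockInv I π e z k := by
  induction k with
  | zero =>
    exact ⟨Config.regular_initial I, hz0, fun l => ⟨0, fun n => by
      simp [clockState, clockChain, Config.initial], by simp⟩⟩
  | succ k ih => exact (ih.step (hf k) hz).1

/-! ### The deliveries of an arbitrary policy -/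

/-- At time `T` one of the clocks rings, and a packet generated at time `v` has a chance to be
delivered at that moment. -/
def Offered (I : Input) (z : Fin m → ℕ → ℝ) (v T : ℝ) : Prop :=
  ∃ (l : Fin m) (n : ℕ) (A : Finset ℕ), T = psum (z l) (n + 1) ∧
    (∀ i ∈ A, (i : ℕ∞) < I.n ∧ I.a i < T ∧ v ≤ I.s i) ∧ (l : ℕ) + 1 ≤ A.card

/-- Clocks that do not ring at the same time, nor at an arrival. -/
structure Generic (I : Input) (z : Fin m → ℕ → ℝ) : Prop where
  pos : ∀ l i, 0 < z l i
  unbounded : ∀ l t, ∃ n, t < psum (z l) (n + 1)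
  ne_arrival : ∀ l n i, psum (z l) (n + 1) ≠ I.a i
  ne_ring : ∀ l l', l ≠ l' → ∀ n n', psum (z l) (n + 1) ≠ psum (z l') (n' + 1)

/-- A new delivery occurs at a server of some rank `l`, at a ring of clock `l`, and ranks `0, …, l`
then hold `l + 1` distinct packets at least as fresh. -/
theorem exists_offered_of_mem_delivered (hz : Generic I z) (hf : ClockFeasible I π e z) (k : ℕ)
    {i : ℕ} (hi : i ∈ (clockState I π e z k).delivered) :
    ∃ T ≤ (clockState I π e z k).time, Offered I z (I.s i) T := by
  have hinv := clockInv_of_feasible hf (fun l i => (hz.pos l i).le) hz.unbounded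
  induction k with
  | zero => simp [clockState, clockChain, Config.initial] at hi
  | succ k ih =>
    have hstep := (hinv k).step (hf k) hz.unbounded
    rw [clockState_succ] at hi
    rcases Config.exists_of_mem_delivered_advanceBy hi with hi | ⟨j, hj, ht⟩
    · obtain ⟨T, hT, hoff⟩ := ih hi
      exact ⟨T, hT.trans hstep.2.1, hoff⟩
    · rw [← clockState_succ] at ht
      refine ⟨_, le_rfl, rank I (clockDecision I π e z k).toPlacement j, ?_⟩
      obtain ⟨N, hN, -⟩ := (hinv k).synced (rank I (clockDecision I π e z k).toPlacement j)
      obtain ⟨A, hA, hcard⟩ := exists_finset_of_serving (I := I) (hf k).serving_inj hj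
      have hT : (clockState I π e z (k + 1)).time =
          psum (z (rank I (clockDecision I π e z k).toPlacement j)) (N + 1) := by
        rw [ht]
        have := hN 0
        simp only [psum_succ, psum_zero, add_zero, zero_add] at this
        rw [psum_succ, ← this]
        rfl
      refine ⟨N, A, hT, fun p hp => ?_, hcard⟩
      obtain ⟨⟨j', hj'⟩, hs⟩ := hA p hp
      have hreg := (hinv k).regular
      have harr := hreg.arrived_spec p (hreg.inSystem_spec p ((hf k).serving_mem j' p hj')).1
      -- Strictness holds because no clock rings at an arrival time; it ensures that prmp-LGFS has
      -- placed the packet before the ring.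
      refine ⟨harr.1, lt_of_le_of_ne (harr.2.trans hstep.2.1) ?_, hs⟩
      rw [hT]
      exact (hz.ne_arrival _ _ _).symm

end

/-! ### The deliveries of the preemptive Last-Generated-First-Served policy -/

section

variable {m : ℕ} {I : Input}

open Classical in
/-- The number of servers with a packet generated at time `v` or later. -/
def servedCount (I : Input) (f : Fin m → Option ℕ) (v : ℝ) : ℕ :=
  (Finset.univ.filter fun j => ∃ q, f j = some q ∧ v ≤ I.s q).card

open Classical in
/-- The number of arrived and placed packets generated at time `v` or later. -/
def placedCount (I : Input) (c : Config m) (v : ℝ) : ℕ :=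
  -- Dropped packets are counted as well, which makes the invariant below insensitive to the buffer
  -- size.
  (c.arrived.filter fun i => c.incoming ≠ some i ∧ v ≤ I.s i).card

/-- The freshest packets among those fresher than the delivered ones are under service. -/
def Config.TopServed (I : Input) (c : Config m) : Prop :=
  ∀ v : ℝ, (∀ i ∈ c.delivered, I.s i < v) → min m (placedCount I c v) ≤ servedCount I c.serving v

theorem servedCount_eq_of_forall {f : Fin m → Option ℕ} {v : ℝ}
    (h : ∀ j, ∃ q, f j = some q ∧ v ≤ I.s q) : servedCount I f v = m := by
  classical
  unfold servedCount
  rw [Finset.filter_true_of_mem fun j _ => h j]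
  simp

theorem servedCount_mono {f g : Fin m → Option ℕ} {v : ℝ}
    (h : ∀ j q, f j = some q → v ≤ I.s q → g j = some q) :
    servedCount I f v ≤ servedCount I g v := by
  classical
  refine Finset.card_le_card fun j hj => ?_
  simp only [Finset.mem_filter, Finset.mem_univ, true_and] at hj ⊢
  obtain ⟨q, hq, hv⟩ := hj
  exact ⟨q, h j q hq hv, hv⟩

theorem servedCount_update {f : Fin m → Option ℕ} {j₀ : Fin m} {p : ℕ} {v : ℝ}
    (hf : ∀ q, f j₀ = some q → I.s q < v) (hp : v ≤ I.s p) :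
    servedCount I f v + 1 ≤ servedCount I (Function.update f j₀ (some p)) v := by
  classical
  unfold servedCount
  have hj₀ : j₀ ∉ Finset.univ.filter fun j => ∃ q, f j = some q ∧ v ≤ I.s q := by
    simp only [Finset.mem_filter, Finset.mem_univ, true_and, not_exists, not_and, not_le]
    exact hf
  rw [← Finset.card_insert_of_notMem hj₀]
  refine Finset.card_le_card fun j hj => ?_
  simp only [Finset.mem_filter, Finset.mem_univ, true_and]
  rcases Finset.mem_insert.1 hj with rfl | hj'
  · exact ⟨p, by simp, hp⟩
  · obtain ⟨q, hq, hv⟩ := (Finset.mem_filter.1 hj').2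
    have : j ≠ j₀ := by rintro rfl; exact hj₀ hj'
    exact ⟨q, by simpa [this] using hq, hv⟩

theorem placedCount_place_le (c : Config m) (d : Placement m) (v : ℝ) :
    placedCount I (c.place d) v ≤ placedCount I c v + 1 := by
  classical
  unfold placedCount
  cases hp : c.incoming with
  | none =>
    refine (Finset.card_le_card fun i hi => ?_).trans (Nat.le_succ _)
    have := Finset.mem_filter.1 hi
    exact Finset.mem_filter.2 ⟨this.1, by simp, this.2.2⟩
  | some p =>
    refine (Finset.card_le_card (t := insert p _) fun i hi => ?_).trans (Finset.card_insert_le p _)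
    have := Finset.mem_filter.1 hi
    by_cases hip : i = p
    · exact Finset.mem_insert.2 (Or.inl hip)
    · exact Finset.mem_insert_of_mem (Finset.mem_filter.2
        ⟨this.1, fun h => hip (Option.some_injective _ h).symm, this.2.2⟩)

theorem placedCount_place_le_self {c : Config m} {d : Placement m} {v : ℝ}
    (h : ∀ p, c.incoming = some p → I.s p < v) :
    placedCount I (c.place d) v ≤ placedCount I c v := by
  classical
  refine Finset.card_le_card fun i hi => ?_
  have := Finset.mem_filter.1 hi
  exact Finset.mem_filter.2 ⟨this.1, fun h' => absurd (h i h') (not_lt.2 this.2.2), this.2.2⟩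

/-- A placement raises the count by at most one, and only for `v` up to the generation time of the
incoming packet. If that packet goes to an idle server or replaces one staler than `v`, the servers
gain one too; otherwise all servers hold packets generated at `v` or later and the minimum `m` is
attained. The queue is irrelevant. -/
theorem Config.TopServed.place {c : Config m} (h : c.TopServed I) :
    (c.place (lgfsPlacement I c.toStatus)).TopServed I := by
  classical
  intro v hv
  have hcv := h v hv
  have hle := placedCount_place_le (I := I) c (lgfsPlacement I c.toStatus) v
  have hself := placedCount_place_le_self (I := I) (c := c) (d := lgfsPlacement I c.toStatus)
    (v := v)
  change min m (placedCount I (c.place (lgfsPlacement I c.toStatus)) v) ≤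
    servedCount I (lgfsPlacement I c.toStatus).serving v
  generalize placedCount I (c.place (lgfsPlacement I c.toStatus)) v = A at hle hself ⊢
  unfold lgfsPlacement
  cases hin : c.incoming with
  | none =>
    replace hself := hself fun p hp => by simp [hin] at hp
    simp only
    have hmono : servedCount I c.serving v ≤
        servedCount I (lgfsPlacement I c.toStatus).serving v := by
      refine servedCount_mono fun j q hj _ => ?_
      unfold lgfsPlacement
      simp only [hin]
      split_ifs with h1
      · have : j ≠ h1.choose.1 := by
          rintro rfl
          rw [h1.choose_spec.1] at hj
          simp at hj
        simpa [this] using hj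
      · exact hj
    unfold lgfsPlacement at hmono
    simp only [hin] at hmono
    omega
  | some p =>
    simp only
    split_ifs with h1 h2
    · rcases le_or_gt v (I.s p) with hp | hp
      · have := servedCount_update (I := I) (f := c.serving) (j₀ := h1.choose) (p := p) (v := v)
          (fun q hq => by rw [h1.choose_spec] at hq; simp at hq) hp
        simp only
        omega
      · replace hself := hself fun q hq => by
          rw [hin] at hq; rwa [← Option.some_injective _ hq]
        have := servedCount_mono (I := I) (f := c.serving) (v := v)
          (g := Function.update c.serving h1.choose (some p)) (fun j q hj _ => by
            have : j ≠ h1.choose := by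
              rintro rfl
              rw [h1.choose_spec] at hj
              simp at hj
            simpa [this] using hj)
        simp only
        omega
    · obtain ⟨hr, hmin, hlt⟩ := h2.choose_spec
      have hall : ∀ j, ∃ q, c.serving j = some q ∧ I.s h2.choose.2 ≤ I.s q := by
        intro j
        obtain ⟨q, hq⟩ := Option.ne_none_iff_exists'.1 (fun h => h1 ⟨j, h⟩)
        exact ⟨q, hq, hmin j q hq⟩
      simp only
      rcases le_or_gt v (I.s h2.choose.2) with hv1 | hv1
      · rw [servedCount_eq_of_forall]
        · exact min_le_left _ _
        · intro j
          by_cases hj : j = h2.choose.1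
          · exact ⟨p, by simp [hj], hv1.trans hlt.le⟩
          · obtain ⟨q, hq, hs⟩ := hall j
            exact ⟨q, by simpa [hj] using hq, hv1.trans hs⟩
      · have hold : ∀ q, c.serving h2.choose.1 = some q → I.s q < v := by
          intro q hq
          rw [hr] at hq
          rwa [← Option.some_injective _ hq]
        rcases le_or_gt v (I.s p) with hp | hp
        · have := servedCount_update (I := I) (f := c.serving) (p := p) hold hp
          omega
        · replace hself := hself fun q hq => by
            rw [hin] at hq; rwa [← Option.some_injective _ hq]
          have := servedCount_mono (I := I) (f := c.serving) (v := v)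
            (g := Function.update c.serving h2.choose.1 (some p)) (fun j q hj hq => by
              have : j ≠ h2.choose.1 := by
                rintro rfl
                exact absurd (hold q hj) (not_lt.2 hq)
              simpa [this] using hj)
          omega
    · simp only
      rcases le_or_gt v (I.s p) with hp | hp
      · rw [servedCount_eq_of_forall]
        · exact min_le_left _ _
        · intro j
          obtain ⟨j₀, -, hj₀⟩ := (Finset.univ : Finset (Fin m)).exists_min_image
            (fun j => (c.serving j).elim 0 I.s) ⟨j, Finset.mem_univ j⟩
          have hbusy : ∀ j, ∃ q, c.serving j = some q := fun j =>
            Option.ne_none_iff_exists'.1 (fun h => h1 ⟨j, h⟩)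
          obtain ⟨q₀, hq₀⟩ := hbusy j₀
          obtain ⟨q, hq⟩ := hbusy j
          have hmin : ∀ j q, c.serving j = some q → I.s q₀ ≤ I.s q := by
            intro j q hq
            have := hj₀ j (Finset.mem_univ j)
            simpa [hq₀, hq] using this
          have : I.s p ≤ I.s q₀ := by
            by_contra hlt
            exact h2 ⟨(j₀, q₀), hq₀, hmin, not_le.1 hlt⟩
          exact ⟨q, hq, hp.trans (this.trans (hmin j q hq))⟩
      · replace hself := hself fun q hq => by
          rw [hin] at hq; rwa [← Option.some_injective _ hq]
        omega

/-- A delivery of `p` restricts the claim to `v` above the generation time of `p`, and for these the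
server that becomes idle was not counted. A packet that has just arrived is still incoming, hence
not counted. -/
theorem Config.TopServed.advanceBy {c : Config m} (h : c.TopServed I) (hin : c.incoming = none)
    {delay : ℝ≥0∞} {W : Fin m → ℕ → ℝ} : (c.advanceBy I delay W).TopServed I := by
  classical
  refine c.advanceBy_cases I delay W (p := fun c' => c'.TopServed I)
    (fun l hl _ _ v hv => ?_) (fun i hi _ _ v hv => ?_) (fun _ _ _ _ => h) (fun _ _ => h)
  · obtain ⟨p, hp⟩ := Option.ne_none_iff_exists'.1 hl
    have hdel : (c.deliver (c.time + W l 0) l).delivered = c.delivered ∪ {p} := by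
      simp [Config.deliver, hp]
    rw [hdel] at hv
    refine (h v fun i hi => hv i (Finset.mem_union_left _ hi)).trans
      (servedCount_mono fun j q hj hq => ?_)
    have hjl : j ≠ l := by
      rintro rfl
      rw [hp] at hj
      obtain rfl := Option.some_injective _ hj
      exact absurd (hv p (by simp)) (not_lt.2 hq)
    simpa [Config.deliver, hjl] using hj
  · refine le_trans ?_ (h v hv)
    refine min_le_min_left m (Finset.card_le_card fun q hq => ?_)
    obtain ⟨h1, h2, h3⟩ := Finset.mem_filter.1 hq
    rcases Finset.mem_insert.1 (show q ∈ insert i c.arrived from h1) with rfl | h1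
    · exact absurd rfl h2
    · exact Finset.mem_filter.2 ⟨h1, by simp [hin], h3⟩

/-- With an infinite delay, each epoch before time `T` brings an arrival or a delivery. -/
theorem Config.advanceBy_progress {c : Config m} (hc : c.Regular I) {W : Fin m → ℕ → ℝ} {T : ℝ}
    (h : ¬((∀ j, c.Busy j → T ≤ c.time + W j 0) ∧ (T : EReal) ≤ c.nextArrival I)) :
    (c.advanceBy I ⊤ W).time < T ∧ c.arrived.card + c.delivered.card <
      (c.advanceBy I ⊤ W).arrived.card + (c.advanceBy I ⊤ W).delivered.card := by
  have hdl : c.deadline I ⊤ = c.nextArrival I := by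
    unfold Config.deadline
    rw [EReal.coe_ennreal_top, EReal.coe_add_top]
    exact min_eq_left le_top
  refine c.advanceBy_cases I ⊤ W (p := fun c' => c'.time < T ∧
    c.arrived.card + c.delivered.card < c'.arrived.card + c'.delivered.card) ?_ ?_ ?_ ?_
  · intro l hl hd hf
    obtain ⟨p, hp⟩ := Option.ne_none_iff_exists'.1 hl
    have hdel : (c.deliver (c.time + W l 0) l).delivered = c.delivered ∪ {p} := by
      simp [Config.deliver, hp]
    constructor
    · by_contra hT
      replace hT : T ≤ c.time + W l 0 := not_lt.1 hT
      refine h ⟨fun j hj => ?_, ?_⟩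
      · rcases lt_trichotomy j l with hjl | hjl | hjl
        · linarith [(hf j hjl.ne hj).1 hjl]
        · rw [hjl]; exact hT
        · linarith [(hf j hjl.ne' hj).2 hjl]
      · rw [← hdl]
        exact le_trans (EReal.coe_le_coe_iff.2 hT) hd
    · have hp' := (hc.inSystem_spec p (Or.inl ⟨l, hp⟩)).2
      rw [hdel, Finset.union_comm, ← Finset.insert_eq, Finset.card_insert_of_notMem hp']
      change _ < c.arrived.card + _
      omega
  · intro i hi hd hlt
    constructor
    · by_contra hT
      replace hT : T ≤ I.a i := not_lt.1 hT
      refine h ⟨fun j hj => hT.trans (hlt j hj).le, ?_⟩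
      rw [← hdl, ← hd]
      exact EReal.coe_le_coe_iff.2 hT
    · change _ < (insert i c.arrived).card + c.delivered.card
      rw [Finset.card_insert_of_notMem (Input.next_spec hi).2.1]
      omega
  · intro t _ hne _
    exact absurd hdl.symm hne
  · intro htop hidle
    refine absurd ⟨fun j hj => absurd hj (hidle j), ?_⟩ h
    rw [← hdl, htop]
    exact le_top

variable {E : Type*} {e : E} {z : Fin m → ℕ → ℝ}

theorem topServed_clockState (k : ℕ) : (clockState I (prmpLGFS m E I) e z k).TopServed I := by
  induction k with
  | zero => intro v _; simp [placedCount, clockState, clockChain, Config.initial]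
  | succ k ih =>
    rw [clockState_succ]
    exact ih.place.advanceBy rfl

/-- The last epoch before a time `T`. -/
theorem exists_epoch_before (hinv : ∀ k, ClockInv I (prmpLGFS m E I) e z k) {T : ℝ}
    (hT : 0 < T) :
    ∃ k, (clockState I (prmpLGFS m E I) e z k).time < T ∧
      (∀ j, ((clockState I (prmpLGFS m E I) e z k).place
          (clockDecision I (prmpLGFS m E I) e z k).toPlacement).Busy j →
        T ≤ (clockState I (prmpLGFS m E I) e z k).time +
          clockGaps I (prmpLGFS m E I) e z k j 0) ∧
      (T : EReal) ≤ (clockState I (prmpLGFS m E I) e z k).nextArrival I := by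
  by_contra hcon
  push Not at hcon
  -- Without a last epoch before `T`, all epochs precede `T` and each one increases the number of
  -- arrivals plus deliveries. If `K` packets arrive by `T`, this number is at most `2 * K`, a
  -- contradiction at epoch `2 * K + 1`.
  have key : ∀ k, (clockState I (prmpLGFS m E I) e z k).time < T ∧
      k ≤ (clockState I (prmpLGFS m E I) e z k).arrived.card +
        (clockState I (prmpLGFS m E I) e z k).delivered.card := by
    intro k
    induction k with
    | zero => exact ⟨hT, Nat.zero_le _⟩
    | succ k ih =>
      have hreg := (hinv k).regular
      have hstep := Config.advanceBy_progress (hreg.place (feasible_lgfsPlacement hreg)) (T := T)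
        (W := clockGaps I (prmpLGFS m E I) e z k)
        fun h => absurd h.2 (not_le.2 (hcon k ih.1 h.1))
      rw [clockState_succ]
      refine ⟨hstep.1, ?_⟩
      have := hstep.2
      change (clockState I (prmpLGFS m E I) e z k).arrived.card +
        (clockState I (prmpLGFS m E I) e z k).delivered.card < _ at this
      change _ ≤ (Config.advanceBy I _ ⊤ _).arrived.card +
        (Config.advanceBy I _ ⊤ _).delivered.card
      exact Nat.succ_le_of_lt (ih.2.trans_lt this)
  set K := (I.finite_arrivals T).toFinset.card
  obtain ⟨h1, h2⟩ := key (2 * K + 1)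
  have hreg := (hinv (2 * K + 1)).regular
  have ha : (clockState I (prmpLGFS m E I) e z (2 * K + 1)).arrived.card ≤ K := by
    refine Finset.card_le_card fun i hi => ?_
    have := hreg.arrived_spec i hi
    simpa using ⟨this.1, this.2.trans h1.le⟩
  have hd := Finset.card_le_card hreg.delivered_subset
  omega

theorem clockFeasible_prmpLGFS (hz : Generic I z) : ClockFeasible I (prmpLGFS m E I) e z := by
  have h : ∀ k, ClockInv I (prmpLGFS m E I) e z k := by
    intro k
    induction k with
    | zero =>
      exact ⟨Config.regular_initial I, fun l i => (hz.pos l i).le, fun l => ⟨0, fun n => by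
        simp [clockState, clockChain, Config.initial], by simp⟩⟩
    | succ k ih => exact (ih.step (feasible_lgfsPlacement ih.regular) hz.unbounded).1
  exact fun k => feasible_lgfsPlacement (h k).regular

/-- Whatever can be delivered at the ring of a clock is matched by the policy. -/
theorem exists_delivered_of_offered (hz : Generic I z) {v T : ℝ} (h : Offered I z v T) :
    ∃ k, (clockState I (prmpLGFS m E I) e z k).time ≤ T ∧
      ∃ i ∈ (clockState I (prmpLGFS m E I) e z k).delivered, v ≤ I.s i := by
  classical
  obtain ⟨l, n, A, hT, hA, hcard⟩ := h
  have hf := clockFeasible_prmpLGFS (E := E) (e := e) hz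
  have hinv := clockInv_of_feasible hf (fun l i => (hz.pos l i).le) hz.unbounded
  have hmono : StrictMono (psum (z l)) :=
    strictMono_nat_of_lt_succ fun n => by rw [psum_succ]; linarith [hz.pos l n]
  have hTpos : 0 < T := by
    rw [hT, ← psum_zero (z l)]
    exact hmono (Nat.succ_pos n)
  -- The last epoch before the ring: after it, nothing arrives and no busy server rings before `T`.
  obtain ⟨k, hk, hbusy, harr⟩ := exists_epoch_before hinv hTpos
  have hfk := hf k
  have hreg := (hinv k).regular
  set c := clockState I (prmpLGFS m E I) e z k with hc
  set d := clockDecision I (prmpLGFS m E I) e z k with hd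
  by_cases hdel : ∃ i ∈ c.delivered, v ≤ I.s i
  · exact ⟨k, hk.le, hdel⟩
  push Not at hdel
  have htop : (c.place d.toPlacement).TopServed I := (topServed_clockState k).place
  -- The packets of `A` arrived before `T`, hence by epoch `k`, and have been placed, possibly by
  -- being dropped.
  have hAc : A.card ≤ placedCount I (c.place d.toPlacement) v := by
    refine Finset.card_le_card fun i hi => Finset.mem_filter.2 ⟨?_, by simp [Config.place], ?_⟩
    · obtain ⟨h1, h2, -⟩ := hA i hi
      by_contra hiA
      have := harr.trans (Config.nextArrival_le h1 hiA)
      exact absurd (EReal.coe_le_coe_iff.1 this) (not_le.2 h2)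
    · exact (hA i hi).2.2
  have hserved : (l : ℕ) + 1 ≤ servedCount I d.serving v := by
    refine le_trans (le_min ?_ (hcard.trans hAc)) (htop v hdel)
    exact l.2
  obtain ⟨q, hq, hvq⟩ := serving_of_rank (d := d.toPlacement) hserved
  set j := (rank I d.toPlacement).symm l with hj
  have hring : ∀ j, ∃ N, c.time + clockGaps I (prmpLGFS m E I) e z k j 0 =
      psum (z (rank I d.toPlacement j)) (N + 1) ∧
        ∀ n < N, psum (z (rank I d.toPlacement j)) (n + 1) ≤ c.time := by
    intro j
    obtain ⟨N, hN, hN'⟩ := (hinv k).synced (rank I d.toPlacement j)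
    refine ⟨N, ?_, hN'⟩
    have := hN 0
    simp only [psum_succ, psum_zero, add_zero, zero_add] at this
    rw [psum_succ, ← this]
    rfl
  have hjb : (c.place d.toPlacement).Busy j := by
    simp [Config.Busy, Config.place, hq]
  -- No busy server rings before `T`, and the clock `l` that drives `j` rings next at `T` at the
  -- latest, as its ring at `T` is still pending.
  have hTj : c.time + clockGaps I (prmpLGFS m E I) e z k j 0 = T := by
    refine le_antisymm ?_ (hbusy j hjb)
    obtain ⟨N, hN, hN'⟩ := hring j
    rw [hj, Equiv.apply_symm_apply] at hN hN'
    rw [hN, hT]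
    refine hmono.monotone (Nat.succ_le_succ ?_)
    by_contra hlt
    have := hN' n (not_le.1 hlt)
    rw [← hT] at this
    linarith
  -- Different clocks never ring together, so `j` is the only busy server that rings at `T`.
  have hfirst : IsFirst (c.place d.toPlacement).Busy j (clockGaps I (prmpLGFS m E I) e z k) := by
    intro j' hne hb
    have hle := hbusy j' hb
    have hne' : c.time + clockGaps I (prmpLGFS m E I) e z k j' 0 ≠ T := by
      obtain ⟨N, hN, -⟩ := hring j'
      rw [hN, hT]
      refine hz.ne_ring _ _ (fun h => hne ?_) _ _
      rw [hj, ← h, Equiv.symm_apply_apply]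
    have hlt := lt_of_le_of_ne hle hne'.symm
    exact ⟨fun _ => by linarith, fun _ => by linarith⟩
  have hdl : ((c.time + clockGaps I (prmpLGFS m E I) e z k j 0 : ℝ) : EReal) ≤
      (c.place d.toPlacement).deadline I ⊤ := by
    rw [hTj]
    unfold Config.deadline
    rw [EReal.coe_ennreal_top, EReal.coe_add_top]
    exact le_min harr le_top
  have hsucc := clockState_succ (I := I) (π := prmpLGFS m E I) (e := e) (z := z) (k := k)
  have hadv : clockState I (prmpLGFS m E I) e z (k + 1) = (c.place d.toPlacement).deliver
      ((c.place d.toPlacement).time + clockGaps I (prmpLGFS m E I) e z k j 0) j :=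
    hsucc.trans (Config.advanceBy_of_isFirst hjb hdl hfirst)
  refine ⟨k + 1, ?_, q, ?_, hvq⟩
  · rw [hadv]
    exact hTj.le
  · rw [hadv]
    refine Finset.mem_union_right _ ?_
    have : (c.place d.toPlacement).serving j = some q := hq
    rw [this]
    simp

end

/-! ### Age paths of sequences of states -/

section

variable {m : ℕ} {I : Input} {u₀ : ℝ} {c : ℕ → Config m}

/-- The packets delivered by time `t`. -/
def seqDelivered (c : ℕ → Config m) (t : ℝ) : Set ℕ :=
  {i | ∃ k, (c k).time ≤ t ∧ i ∈ (c k).delivered}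

/-- The age path determined by the states at the epochs. -/
def seqAge (I : Input) (u₀ : ℝ) (c : ℕ → Config m) : ℝ≥0 → ℝ :=
  fun t => (t : ℝ) - sSup (insert u₀ (I.s '' seqDelivered c t))

/-- The properties of the sequences of states that make the age path regular. -/
structure IsOrderly (I : Input) (c : ℕ → Config m) : Prop where
  time_le : ∀ k, (c k).time ≤ (c (k + 1)).time
  delivered_subset : ∀ k, (c k).delivered ⊆ (c (k + 1)).delivered
  delivered_spec : ∀ k i, i ∈ (c k).delivered → (i : ℕ∞) < I.n ∧ I.a i ≤ (c k).time

theorem measurableSet_isOrderly (I : Input) : MeasurableSet {c : ℕ → Config m | IsOrderly I c} := by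
  have ht : ∀ k, Measurable fun c : ℕ → Config m => (c k).time := fun k =>
    Config.measurable_time.comp (measurable_pi_apply k)
  have hs : ∀ (p : Status m → Prop) k, MeasurableSet {c : ℕ → Config m | p (c k).toStatus} :=
    fun p k =>
      have hk : Measurable fun c : ℕ → Config m => c k := measurable_pi_apply k
      hk (measurableSet_status p)
  have h1 : MeasurableSet {c : ℕ → Config m | ∀ k, (c k).time ≤ (c (k + 1)).time} := by
    rw [Set.ofPred_forall]
    exact .iInter fun k => measurableSet_le (ht k) (ht (k + 1))
  have h2 : MeasurableSet {c : ℕ → Config m | ∀ k i, i ∈ (c k).delivered →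
      i ∈ (c (k + 1)).delivered} := by
    simp only [Set.ofPred_forall, imp_iff_not_or]
    exact .iInter fun k => .iInter fun i =>
      (hs (fun c => i ∉ c.delivered) k).union (hs (fun c => i ∈ c.delivered) (k + 1))
  have h3 : MeasurableSet {c : ℕ → Config m | ∀ k i, i ∈ (c k).delivered →
      (i : ℕ∞) < I.n ∧ I.a i ≤ (c k).time} := by
    simp only [Set.ofPred_forall, imp_iff_not_or]
    exact .iInter fun k => .iInter fun i => (hs (fun c => i ∉ c.delivered) k).union
      ((MeasurableSet.const _).inter (measurableSet_le measurable_const (ht k)))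
  have : {c : ℕ → Config m | IsOrderly I c} = {c | ∀ k, (c k).time ≤ (c (k + 1)).time} ∩
      ({c | ∀ k i, i ∈ (c k).delivered → i ∈ (c (k + 1)).delivered} ∩
        {c | ∀ (k i : ℕ), i ∈ (c k).delivered → (i : ℕ∞) < I.n ∧ I.a i ≤ (c k).time}) := by
    ext c
    exact ⟨fun h => ⟨h.time_le, fun k i hi => h.delivered_subset k hi, h.delivered_spec⟩,
      fun h => ⟨h.1, fun k i hi => h.2.1 k i hi, h.2.2⟩⟩
  rw [this]
  exact h1.inter (h2.inter h3)

theorem IsOrderly.seqDelivered_subset (h : IsOrderly I c) (t : ℝ) :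
    seqDelivered c t ⊆ {i : ℕ | (i : ℕ∞) < I.n ∧ I.a i ≤ t} := by
  rintro i ⟨k, hk, hi⟩
  have := h.delivered_spec k i hi
  exact ⟨this.1, this.2.trans hk⟩

theorem IsOrderly.bddAbove (h : IsOrderly I c) (u₀ t : ℝ) :
    BddAbove (insert u₀ (I.s '' seqDelivered c t)) :=
  ((((I.finite_arrivals t).subset (h.seqDelivered_subset t)).image I.s).insert u₀).bddAbove

/-- Epoch times are monotone, so a packet counts as delivered from the first epoch that lists it.
The threshold itself is included, which yields right-continuity. -/
theorem IsOrderly.exists_threshold (h : IsOrderly I c) (i : ℕ) :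
    ∃ τ : EReal, ∀ t : ℝ, i ∈ seqDelivered c t ↔ τ ≤ (t : EReal) := by
  classical
  by_cases hi : ∃ k, i ∈ (c k).delivered
  · have hmono : Monotone fun k => (c k).time := monotone_nat_of_le_succ h.time_le
    refine ⟨((c (Nat.find hi)).time : EReal), fun t => ⟨?_, fun ht => ?_⟩⟩
    · rintro ⟨k, hk, hik⟩
      exact EReal.coe_le_coe_iff.2 ((hmono (Nat.find_min' hi hik)).trans hk)
    · exact ⟨_, EReal.coe_le_coe_iff.1 ht, Nat.find_spec hi⟩
  · refine ⟨⊤, fun t => ⟨?_, fun ht => ?_⟩⟩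
    · rintro ⟨k, -, hik⟩
      exact absurd ⟨k, hik⟩ hi
    · exact absurd (top_le_iff.1 ht) (EReal.coe_ne_top t)

/-- Near `t` only finitely many packets can have been delivered, each from its threshold on. So the
set of delivered packets is constant just after `t`, with its value at `t`, and constant just before
`t`, where it consists of the packets with threshold before `t`. -/
theorem IsOrderly.isCadlag_seqAge (h : IsOrderly I c) (u₀ : ℝ) : IsCadlag (seqAge I u₀ c) := by
  choose τ hτ using h.exists_threshold
  intro t
  let C := (I.finite_arrivals ((t : ℝ) + 1)).toFinset
  have hC : ∀ t' : ℝ, t' ≤ t + 1 → ∀ i, i ∈ seqDelivered c t' → i ∈ C := by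
    intro t' ht' i hi
    have := h.seqDelivered_subset t' hi
    simpa [C] using ⟨this.1, this.2.trans ht'⟩
  have hcoe : Continuous fun t' : ℝ≥0 => ((t' : ℝ) : EReal) :=
    continuous_coe_real_ereal.comp NNReal.continuous_coe
  have hlt : ∀ᶠ t' : ℝ≥0 in 𝓝 t, (t' : ℝ) ≤ t + 1 := by
    have : ∀ᶠ t' : ℝ≥0 in 𝓝 t, (t' : ℝ) < t + 1 :=
      NNReal.continuous_coe.continuousAt.eventually_lt continuousAt_const (by linarith)
    exact this.mono fun _ => le_of_lt
  constructor
  · have hev : ∀ᶠ t' : ℝ≥0 in 𝓝[≥] t, seqDelivered c t' = seqDelivered c t := by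
      have h1 : ∀ᶠ t' : ℝ≥0 in 𝓝[≥] t, ∀ i ∈ C, (i ∈ seqDelivered c t' ↔
          i ∈ seqDelivered c t) := by
        rw [Filter.eventually_all_finset]
        intro i _
        by_cases hi : τ i ≤ ((t : ℝ) : EReal)
        · filter_upwards [self_mem_nhdsWithin] with t' ht'
          rw [hτ, hτ]
          have : ((t : ℝ) : EReal) ≤ ((t' : ℝ) : EReal) := by
            exact_mod_cast (Set.mem_Ici.1 ht')
          exact iff_of_true (hi.trans this) hi
        · have : ∀ᶠ t' : ℝ≥0 in 𝓝 t, ((t' : ℝ) : EReal) < τ i :=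
            hcoe.continuousAt.eventually_lt continuousAt_const (not_le.1 hi)
          filter_upwards [nhdsWithin_le_nhds this] with t' ht'
          rw [hτ, hτ]
          exact iff_of_false (not_le.2 ht') hi
      filter_upwards [h1, nhdsWithin_le_nhds hlt] with t' h1 h2
      ext i
      by_cases hi : i ∈ C
      · exact h1 i hi
      · exact iff_of_false (fun h => hi (hC _ h2 i h)) fun h => hi (hC _ (by linarith) i h)
    refine ContinuousWithinAt.congr_of_eventuallyEq
      (f := fun t' : ℝ≥0 => (t' : ℝ) - sSup (insert u₀ (I.s '' seqDelivered c t))) ?_ ?_ rfl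
    · exact (NNReal.continuous_coe.sub continuous_const).continuousWithinAt
    · filter_upwards [hev] with t' ht'
      simp only [seqAge, ht']
  · have hev : ∀ᶠ t' : ℝ≥0 in 𝓝[<] t, seqDelivered c t' = {i | τ i < ((t : ℝ) : EReal)} := by
      have h1 : ∀ᶠ t' : ℝ≥0 in 𝓝[<] t, ∀ i ∈ C, (i ∈ seqDelivered c t' ↔
          τ i < ((t : ℝ) : EReal)) := by
        rw [Filter.eventually_all_finset]
        intro i _
        by_cases hi : τ i < ((t : ℝ) : EReal)
        · have : ∀ᶠ t' : ℝ≥0 in 𝓝 t, τ i < ((t' : ℝ) : EReal) :=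
            continuousAt_const.eventually_lt hcoe.continuousAt hi
          filter_upwards [nhdsWithin_le_nhds this] with t' ht'
          rw [hτ]
          exact iff_of_true ht'.le hi
        · filter_upwards [self_mem_nhdsWithin] with t' ht'
          rw [hτ]
          have : ((t' : ℝ) : EReal) < ((t : ℝ) : EReal) := by
            exact_mod_cast (Set.mem_Iio.1 ht')
          exact iff_of_false (not_le.2 (this.trans_le (not_lt.1 hi))) hi
      filter_upwards [h1, nhdsWithin_le_nhds hlt] with t' h1 h2
      ext i
      by_cases hi : i ∈ C
      · exact h1 i hi
      · exact iff_of_false (fun h => hi (hC _ h2 i h))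
          fun h => hi (hC t (by linarith) i ((hτ i t).2 (le_of_lt h)))
    refine ⟨(t : ℝ) - sSup (insert u₀ (I.s '' {i | τ i < ((t : ℝ) : EReal)})), ?_⟩
    refine Filter.Tendsto.congr' (f₁ := fun t' : ℝ≥0 => (t' : ℝ) -
      sSup (insert u₀ (I.s '' {i | τ i < ((t : ℝ) : EReal)}))) ?_ ?_
    · filter_upwards [hev] with t' ht'
      simp only [seqAge, ht']
    · exact ((NNReal.continuous_coe.sub continuous_const).tendsto t).mono_left nhdsWithin_le_nhds

/-- On the orderly sequences, the age at a given time is a measurable function. -/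
theorem exists_measurable_seqAge (I : Input) (u₀ : ℝ) (t : ℝ≥0) :
    ∃ f : (ℕ → Config m) → ℝ, Measurable f ∧ ∀ c, IsOrderly I c → seqAge I u₀ c t = f c := by
  -- The age at `t` is a function of finitely many events, the deliveries by `t` of the packets
  -- arriving by `t`, and any function on `C → Prop` is measurable.
  let C := (I.finite_arrivals (t : ℝ)).toFinset
  let D : (ℕ → Config m) → C → Prop := fun c i => (i : ℕ) ∈ seqDelivered c t
  have hD : Measurable D := by
    refine measurable_pi_lambda _ fun i => ?_
    have : {c : ℕ → Config m | (i : ℕ) ∈ seqDelivered c t} =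
        ⋃ k, {c : ℕ → Config m | (c k).time ≤ (t : ℝ)} ∩
          {c : ℕ → Config m | (i : ℕ) ∈ (c k).delivered} := by
      ext c; simp [seqDelivered]
    have hset : MeasurableSet {c : ℕ → Config m | (i : ℕ) ∈ seqDelivered c t} := by
      rw [this]
      refine .iUnion fun k => ?_
      have hk : Measurable fun c : ℕ → Config m => c k := measurable_pi_apply k
      exact (measurableSet_le (Config.measurable_time.comp hk) measurable_const).inter
        (hk (measurableSet_status fun c => (i : ℕ) ∈ c.delivered))
    exact measurableSet_setOfPred.1 hset
  let Ψ : (C → Prop) → ℝ := fun f =>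
    (t : ℝ) - sSup (insert u₀ (I.s '' {i | ∃ h : i ∈ C, f ⟨i, h⟩}))
  refine ⟨fun c => Ψ (D c), (Measurable.of_discrete (f := Ψ)).comp hD, fun c hc => ?_⟩
  have : seqDelivered c t = {i | ∃ h : i ∈ C, D c ⟨i, h⟩} := by
    ext i
    refine ⟨fun hi => ⟨?_, hi⟩, fun ⟨_, hi⟩ => hi⟩
    simpa [C] using hc.seqDelivered_subset t hi
  simp only [seqAge, Ψ, ← this]

open Classical in
/-- A functional of the age path as a function of the sequence of states; it is set to `0` off the
orderly sequences. -/
def seqPenalty (I : Input) (u₀ : ℝ) (g : (ℝ≥0 → ℝ) → ℝ) (c : ℕ → Config m) : ℝ :=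
  if IsOrderly I c then g (seqAge I u₀ c) else 0

/-- Measurability of `g` is only known on càdlàg paths, so the composition is formed on the
measurable set of orderly sequences. -/
theorem measurable_seqPenalty (I : Input) (u₀ : ℝ) {g : (ℝ≥0 → ℝ) → ℝ} (hg : IsAgePenalty g) :
    Measurable (seqPenalty (m := m) I u₀ g) := by
  classical
  have hs := measurableSet_isOrderly (m := m) I
  refine measurable_of_restrict_of_restrict_compl hs ?_ ?_
  · let F : {c : ℕ → Config m | IsOrderly I c} → {f : ℝ≥0 → ℝ // IsCadlag f} := fun c =>
      ⟨seqAge I u₀ c.1, IsOrderly.isCadlag_seqAge c.2 u₀⟩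
    have hF : Measurable F := by
      refine Measurable.subtype_mk (measurable_pi_lambda _ fun t => ?_)
      obtain ⟨f, hf, hfc⟩ := exists_measurable_seqAge (m := m) I u₀ t
      have : (fun c : {c : ℕ → Config m | IsOrderly I c} => seqAge I u₀ c.1 t) =
          fun c => f c.1 := funext fun c => hfc c.1 c.2
      rw [this]
      exact hf.comp measurable_subtype_coe
    have : (Set.domRestrict {c : ℕ → Config m | IsOrderly I c} (seqPenalty I u₀ g)) =
        (fun f : {f : ℝ≥0 → ℝ // IsCadlag f} => g f.1) ∘ F := by
      funext c
      simp only [Set.domRestrict_apply, seqPenalty, Function.comp, F]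
      exact if_pos c.2
    rw [this]
    exact hg.measurable.comp hF
  · have : (Set.domRestrict {c : ℕ → Config m | IsOrderly I c}ᶜ (seqPenalty I u₀ g)) =
        fun _ => 0 := by
      funext c
      simp only [Set.domRestrict_apply, seqPenalty]
      exact if_neg c.2
    rw [this]
    exact measurable_const

end

/-! ### The laws of the sequences of states -/

section

variable {m : ℕ} {E : Type*} {I : Input} {π : Policy m E}

theorem run_apply (e : E) (x : Fin m → ℕ → ℝ) (k : ℕ) (i : Fin (k + 1)) :
    run I π e x k i = stateAt I π e x i := by
  induction k with
  | zero => obtain rfl : i = Fin.last 0 := Fin.ext (by omega); rfl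
  | succ k ih =>
    refine Fin.lastCases rfl (fun i => ?_) i
    rw [run]
    simp only [Fin.snoc_castSucc]
    exact ih i

theorem clockChain_apply (e : E) (z : Fin m → ℕ → ℝ) (k : ℕ) (i : Fin (k + 1)) :
    (clockChain I π e z k).1.2 i = clockState I π e z i := by
  induction k with
  | zero => obtain rfl : i = Fin.last 0 := Fin.ext (by omega); rfl
  | succ k ih =>
    refine Fin.lastCases rfl (fun i => ?_) i
    simp only [clockChain, chainStep, nextHistory, Fin.snoc_castSucc]
    exact ih i

theorem isOrderly_stateAt {e : E} {x : Fin m → ℕ → ℝ} (hx : ∀ j k, 0 < x j k)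
    (hf : ∀ k, Feasible I.B (stateAt I π e x k).toStatus (π e k (run I π e x k)).toPlacement) :
    IsOrderly I (stateAt I π e x) := by
  have h : ∀ k, (stateAt I π e x k).Regular I ∧
      ∀ j i, 0 ≤ serverGaps (stateAt I π e x k) x j i := by
    intro k
    induction k with
    | zero => exact stateAt_zero_spec hx
    | succ k ih => exact (stateAt_step (hf k) ih.1 ih.2).1
  have hstep := fun k => (stateAt_step (hf k) (h k).1 (h k).2).2
  exact ⟨fun k => (hstep k).1, fun k => (hstep k).2, fun k i hi =>
    (h k).1.arrived_spec i ((h k).1.delivered_subset hi)⟩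

theorem isOrderly_clockState {e : E} {z : Fin m → ℕ → ℝ} (hz : Generic I z)
    (hf : ClockFeasible I π e z) : IsOrderly I (clockState I π e z) := by
  have h := clockInv_of_feasible hf (fun l i => (hz.pos l i).le) hz.unbounded
  have hstep := fun k => ((h k).step (hf k) hz.unbounded).2
  exact ⟨fun k => (hstep k).1, fun k => (hstep k).2, fun k i hi =>
    (h k).regular.arrived_spec i ((h k).regular.delivered_subset hi)⟩

/-- With the same clocks, the age is smallest under the preemptive Last-Generated-First-Served
policy. -/
theorem seqAge_prmpLGFS_le {e : E} {z : Fin m → ℕ → ℝ} (hz : Generic I z)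
    (hf : ClockFeasible I π e z) (u₀ : ℝ) (t : ℝ≥0) :
    seqAge I u₀ (clockState I (prmpLGFS m E I) e z) t ≤ seqAge I u₀ (clockState I π e z) t := by
  have hbdd := (isOrderly_clockState hz (clockFeasible_prmpLGFS (E := E) (e := e) hz)).bddAbove u₀ t
  refine sub_le_sub_left (csSup_le (Set.insert_nonempty _ _) ?_) _
  rintro v (rfl | ⟨i, ⟨k, hk, hi⟩, rfl⟩)
  · exact le_csSup hbdd (Set.mem_insert _ _)
  -- Each delivery under `π` occurs at a ring by which prmp-LGFS has delivered something at least as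
  -- fresh.
  · obtain ⟨T, hT, hoff⟩ := exists_offered_of_mem_delivered hz hf k hi
    obtain ⟨k', hk', i', hi', hle⟩ := exists_delivered_of_offered (E := E) (e := e) hz hoff
    exact le_csSup_of_le hbdd
      (Set.mem_insert_of_mem _ ⟨i', ⟨k', hk'.trans (hT.trans hk), hi'⟩, rfl⟩) hle

theorem ae_generic {ρ : Measure ℝ} [IsProbabilityMeasure ρ] (hρ : IsMemoryless ρ) (I : Input) :
    ∀ᵐ z ∂arrLaw m ρ, Generic I z := by
  have h1 := ae_arrLaw_of_ae_rowLaw (m := m) (ae_rowLaw_pos hρ)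
  have h2 := ae_arrLaw_of_ae_rowLaw (m := m) (ae_rowLaw_exists_lt_psum hρ)
  have h3 : ∀ᵐ z ∂arrLaw m ρ, ∀ l n i, psum (z l) (n + 1) ≠ I.a i := by
    simp only [ae_all_iff]
    exact fun l n i => ae_psum_ne hρ l n (q := fun _ => I.a i) measurable_const fun _ _ => rfl
  have h4 : ∀ᵐ z ∂arrLaw m ρ, ∀ l l', l ≠ l' → ∀ n n',
      psum (z l) (n + 1) ≠ psum (z l') (n' + 1) := by
    simp only [ae_all_iff]
    intro l l' hne n n'
    refine ae_psum_ne hρ l n (q := fun z => psum (z l') (n' + 1))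
      ((measurable_psum _).comp (measurable_pi_apply l')) fun W w => ?_
    simp only [Function.update_of_ne hne.symm]
  filter_upwards [h1, h2, h3, h4] with z h1 h2 h3 h4
  exact ⟨h1, h2, h3, h4⟩

theorem ae_isOrderly_stateAt [MeasurableSpace E] {Ω : Type*} [MeasurableSpace Ω] {P : Measure Ω}
    {X : Fin m → ℕ → Ω → ℝ} {ξ : Ω → E} (hπ : π ∈ causalPolicies m E I)
    (hX_pos : ∀ᵐ ω ∂P, ∀ j k, 0 < X j k ω) :
    ∀ᵐ ω ∂P, IsOrderly I (stateAt I π (ξ ω) fun j i => X j i ω) := by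
  filter_upwards [hX_pos] with ω hω
  exact isOrderly_stateAt hω (hπ.2 (ξ ω) _ hω)

variable [MeasurableSpace E] {Ω : Type*} [MeasurableSpace Ω] {P : Measure Ω}
  [IsProbabilityMeasure P] {ρ : Measure ℝ} [IsProbabilityMeasure ρ] {X : Fin m → ℕ → Ω → ℝ}
  {ξ : Ω → E}

/-- Feasibility is assumed along the original dynamics only. It is an event of the seed and the
history, whose law is the same with clocks. -/
theorem ae_clockFeasible (hρ : IsMemoryless ρ) (hπ : π ∈ causalPolicies m E I)
    (hX_meas : ∀ j k, Measurable (X j k)) (hξ_meas : Measurable ξ)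
    (hX_pos : ∀ᵐ ω ∂P, ∀ j k, 0 < X j k ω)
    (hlaw : P.map (fun ω => (ξ ω, fun j i => X j (1 + i) ω)) = (P.map ξ).prod (arrLaw m ρ)) :
    ∀ᵐ p ∂(P.map ξ).prod (arrLaw m ρ), ClockFeasible I π p.1 p.2 := by
  unfold ClockFeasible
  rw [ae_all_iff]
  intro k
  obtain ⟨h0, -, h2⟩ := map_run_serverGaps (I := I) hρ hπ.1 hX_meas hξ_meas hlaw k
  have hm1 : Measurable fun ω => (ξ ω, run I π (ξ ω) (fun j i => X j i ω) k) :=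
    measurable_fst.comp h0
  have hprob := Measure.isProbabilityMeasure_map (μ := P) hm1.aemeasurable
  have hm2 := measurable_clockChain (I := I) hπ.1 k
  have hset : MeasurableSet {q : E × (Fin (k + 1) → Config m) |
      Feasible I.B (q.2 (Fin.last k)).toStatus (π q.1 k q.2).toPlacement} := by
    have hst : Measurable fun q : E × (Fin (k + 1) → Config m) =>
        ((q.2 (Fin.last k)).toStatus, (π q.1 k q.2).toPlacement) :=
      (Config.measurable_toStatus.comp ((measurable_pi_apply (Fin.last k)).comp
        measurable_snd)).prodMk (Decision.measurable_iff.1 (hπ.1 k)).1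
    exact hst (MeasurableSet.of_discrete (s := {q : Status m × Placement m |
      Feasible I.B q.1 q.2}))
  have h3 : ((P.map ξ).prod (arrLaw m ρ)).map (fun p => (clockChain I π p.1 p.2 k).1) =
      P.map fun ω => (ξ ω, run I π (ξ ω) (fun j i => X j i ω) k) := by
    have := congrArg Measure.fst h2
    rw [Measure.fst_prod, Measure.fst, Measure.map_map measurable_fst hm2] at this
    exact this
  have h4 : ∀ᵐ q ∂P.map fun ω => (ξ ω, run I π (ξ ω) (fun j i => X j i ω) k),
      Feasible I.B (q.2 (Fin.last k)).toStatus (π q.1 k q.2).toPlacement := by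
    rw [ae_map_iff hm1.aemeasurable hset]
    filter_upwards [hX_pos] with ω hω
    exact hπ.2 (ξ ω) _ hω k
  have hm3 : Measurable fun p : E × (Fin m → ℕ → ℝ) => (clockChain I π p.1 p.2 k).1 :=
    measurable_fst.comp hm2
  rw [← h3, ae_map_iff hm3.aemeasurable hset] at h4
  exact h4

theorem measurable_clockState (hπ : ∀ k, Measurable fun q : E × (Fin (k + 1) → Config m) =>
    π q.1 k q.2) : Measurable fun (p : E × (Fin m → ℕ → ℝ)) k => clockState I π p.1 p.2 k :=
  measurable_pi_lambda _ fun k => (measurable_pi_apply (Fin.last k)).comp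
    (measurable_snd.comp (measurable_fst.comp (measurable_clockChain hπ k)))

/-- The sequence of states has the same law in the original dynamics and in the dynamics driven by
ranked clocks. -/
theorem map_stateAt_eq (hρ : IsMemoryless ρ)
    (hπ : ∀ k, Measurable fun q : E × (Fin (k + 1) → Config m) => π q.1 k q.2)
    (hX_meas : ∀ j k, Measurable (X j k)) (hξ_meas : Measurable ξ)
    (hlaw : P.map (fun ω => (ξ ω, fun j i => X j (1 + i) ω)) = (P.map ξ).prod (arrLaw m ρ)) :
    (Measurable fun ω k => stateAt I π (ξ ω) (fun j i => X j i ω) k) ∧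
    P.map (fun ω k => stateAt I π (ξ ω) (fun j i => X j i ω) k) =
      ((P.map ξ).prod (arrLaw m ρ)).map fun p k => clockState I π p.1 p.2 k := by
  have hrun := map_run_serverGaps (I := I) hρ hπ hX_meas hξ_meas hlaw
  have hm1 : ∀ k, Measurable fun ω => (ξ ω, run I π (ξ ω) (fun j i => X j i ω) k) := fun k =>
    measurable_fst.comp (hrun k).1
  have hmX : Measurable fun ω k => stateAt I π (ξ ω) (fun j i => X j i ω) k :=
    measurable_pi_lambda _ fun k => (measurable_pi_apply (Fin.last k)).comp
      (measurable_snd.comp (hm1 k))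
  have hmZ := measurable_clockState (I := I) hπ
  have hprobξ := Measure.isProbabilityMeasure_map (μ := P) hξ_meas.aemeasurable
  have hprobX := Measure.isProbabilityMeasure_map (μ := P) hmX.aemeasurable
  refine ⟨hmX, ?_⟩
  have hfin : ∀ J : Finset ℕ, IsFiniteMeasure
      ((P.map (fun ω k => stateAt I π (ξ ω) (fun j i => X j i ω) k)).map J.restrict) :=
    fun J => inferInstance
  -- Finite-dimensional marginals determine a law on sequences, and each is an image of the law of
  -- the history up to some epoch `K`.
  refine IsProjectiveLimit.unique (P := fun J : Finset ℕ =>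
    (P.map (fun ω k => stateAt I π (ξ ω) (fun j i => X j i ω) k)).map J.restrict)
    (fun J => rfl) fun J => ?_
  obtain ⟨K, hK⟩ : ∃ K, ∀ j ∈ J, j < K + 1 :=
    ⟨J.sup id, fun j hj => Nat.lt_succ_of_le (Finset.le_sup (f := id) hj)⟩
  let G : E × (Fin (K + 1) → Config m) → J → Config m := fun q j => q.2 ⟨j.1, hK j.1 j.2⟩
  have hG : Measurable G := measurable_pi_lambda _ fun j =>
    (measurable_pi_apply _).comp measurable_snd
  have e1 : J.restrict ∘ (fun ω k => stateAt I π (ξ ω) (fun j i => X j i ω) k) =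
      G ∘ fun ω => (ξ ω, run I π (ξ ω) (fun j i => X j i ω) K) := by
    funext ω j
    exact (run_apply _ _ K ⟨j.1, hK j.1 j.2⟩).symm
  have e2 : J.restrict ∘ (fun (p : E × (Fin m → ℕ → ℝ)) k => clockState I π p.1 p.2 k) =
      G ∘ Prod.fst ∘ fun p => clockChain I π p.1 p.2 K := by
    funext p j
    exact (clockChain_apply _ _ K ⟨j.1, hK j.1 j.2⟩).symm
  have hprobK := Measure.isProbabilityMeasure_map (μ := P) (hm1 K).aemeasurable
  have h3 : ((P.map ξ).prod (arrLaw m ρ)).map (Prod.fst ∘ fun p => clockChain I π p.1 p.2 K) =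
      P.map fun ω => (ξ ω, run I π (ξ ω) (fun j i => X j i ω) K) := by
    have := congrArg Measure.fst (hrun K).2.2
    rw [Measure.fst_prod, Measure.fst,
      Measure.map_map measurable_fst (measurable_clockChain hπ K)] at this
    exact this
  beta_reduce
  rw [Measure.map_map (Finset.measurable_restrict J) hmZ,
    Measure.map_map (Finset.measurable_restrict J) hmX, e1, e2, ← Measure.map_map hG (hm1 K), ← h3,
    Measure.map_map hG (measurable_fst.comp (measurable_clockChain hπ K))]

/-! ### Comparison of the policies -/

/-- Both sides integrate one function of the sequence of states, whose law is common to the two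
dynamics. In the application `φ` takes the positive or the negative part. -/
theorem lintegral_ageProcess (hρ : IsMemoryless ρ) (hπ : π ∈ causalPolicies m E I)
    (hX_meas : ∀ j k, Measurable (X j k)) (hξ_meas : Measurable ξ)
    (hX_pos : ∀ᵐ ω ∂P, ∀ j k, 0 < X j k ω)
    (hlaw : P.map (fun ω => (ξ ω, fun j i => X j (1 + i) ω)) = (P.map ξ).prod (arrLaw m ρ))
    (u₀ : ℝ) {g : (ℝ≥0 → ℝ) → ℝ} (hg : IsAgePenalty g) {φ : ℝ → ℝ≥0∞} (hφ : Measurable φ) :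
    ∫⁻ ω, φ (g (ageProcess I u₀ X ξ π ω)) ∂P =
      ∫⁻ p, φ (seqPenalty I u₀ g (clockState I π p.1 p.2)) ∂(P.map ξ).prod (arrLaw m ρ) := by
  obtain ⟨hm, heq⟩ := map_stateAt_eq (I := I) hρ hπ.1 hX_meas hξ_meas hlaw
  have hφg : Measurable fun c : ℕ → Config m => φ (seqPenalty I u₀ g c) :=
    hφ.comp (measurable_seqPenalty I u₀ hg)
  have h1 : ∫⁻ ω, φ (g (ageProcess I u₀ X ξ π ω)) ∂P =
      ∫⁻ ω, φ (seqPenalty I u₀ g (stateAt I π (ξ ω) fun j i => X j i ω)) ∂P := by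
    refine lintegral_congr_ae ?_
    filter_upwards [ae_isOrderly_stateAt (ξ := ξ) hπ hX_pos] with ω hω
    rw [seqPenalty, if_pos hω]
    rfl
  rw [h1, ← lintegral_map hφg hm, heq, lintegral_map hφg (measurable_clockState hπ.1)]

theorem ae_seqPenalty_le (hρ : IsMemoryless ρ) (hπ : π ∈ causalPolicies m E I)
    (hX_meas : ∀ j k, Measurable (X j k)) (hξ_meas : Measurable ξ)
    (hX_pos : ∀ᵐ ω ∂P, ∀ j k, 0 < X j k ω)
    (hlaw : P.map (fun ω => (ξ ω, fun j i => X j (1 + i) ω)) = (P.map ξ).prod (arrLaw m ρ))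
    (u₀ : ℝ) {g : (ℝ≥0 → ℝ) → ℝ} (hg : IsAgePenalty g) :
    ∀ᵐ p ∂(P.map ξ).prod (arrLaw m ρ),
      seqPenalty I u₀ g (clockState I (prmpLGFS m E I) p.1 p.2) ≤
        seqPenalty I u₀ g (clockState I π p.1 p.2) := by
  have hprobξ := Measure.isProbabilityMeasure_map (μ := P) hξ_meas.aemeasurable
  have hgen : ∀ᵐ p ∂(P.map ξ).prod (arrLaw m ρ), Generic I p.2 :=
    Measure.quasiMeasurePreserving_snd.ae (ae_generic hρ I)
  filter_upwards [hgen, ae_clockFeasible hρ hπ hX_meas hξ_meas hX_pos hlaw] with p hp hf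
  have h1 := isOrderly_clockState hp (clockFeasible_prmpLGFS (E := E) (e := p.1) hp)
  have h2 := isOrderly_clockState hp hf
  rw [seqPenalty, seqPenalty, if_pos h1, if_pos h2]
  exact hg.mono _ _ (h1.isCadlag_seqAge u₀) (h2.isCadlag_seqAge u₀) (seqAge_prmpLGFS_le hp hf u₀)

/-- The functionals of the age that give the probabilities of upper sets. -/
theorem isAgePenalty_indicator {n : ℕ} (t : Fin n → ℝ≥0) {S : Set (Fin n → ℝ)}
    (hS : MeasurableSet S) (hS' : IsUpperSet S) :
    IsAgePenalty fun f => S.indicator (fun _ => (1 : ℝ)) fun i => f (t i) where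
  mono f₁ f₂ _ _ h := by
    by_cases h₁ : (fun i => f₁ (t i)) ∈ S
    · have h₂ : (fun i => f₂ (t i)) ∈ S := hS' (fun i => h (t i)) h₁
      simp [h₁, h₂]
    · rw [Set.indicator_of_notMem h₁]
      exact Set.indicator_nonneg (fun _ _ => zero_le_one) _
  measurable := by
    have : Measurable fun (f : {f : ℝ≥0 → ℝ // IsCadlag f}) i => f.1 (t i) :=
      measurable_pi_lambda _ fun i => (measurable_pi_apply (t i)).comp measurable_subtype_coe
    exact (measurable_const.indicator hS).comp this

end

section

variable {m : ℕ} {E : Type*} {I : Input} {π : Policy m E} [MeasurableSpace E] {Ω : Type*}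
  [MeasurableSpace Ω] {P : Measure Ω} [IsProbabilityMeasure P] {ρ : Measure ℝ}
  [IsProbabilityMeasure ρ] {X : Fin m → ℕ → Ω → ℝ} {ξ : Ω → E}

theorem aemeasurable_ageProcess (hρ : IsMemoryless ρ) (hπ : π ∈ causalPolicies m E I)
    (hX_meas : ∀ j k, Measurable (X j k)) (hξ_meas : Measurable ξ)
    (hX_pos : ∀ᵐ ω ∂P, ∀ j k, 0 < X j k ω)
    (hlaw : P.map (fun ω => (ξ ω, fun j i => X j (1 + i) ω)) = (P.map ξ).prod (arrLaw m ρ))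
    (u₀ : ℝ) (t : ℝ≥0) : AEMeasurable (fun ω => ageProcess I u₀ X ξ π ω t) P := by
  obtain ⟨f, hf, hfc⟩ := exists_measurable_seqAge (m := m) I u₀ t
  refine ⟨_, hf.comp (map_stateAt_eq (I := I) hρ hπ.1 hX_meas hξ_meas hlaw).1, ?_⟩
  filter_upwards [ae_isOrderly_stateAt (ξ := ξ) hπ hX_pos] with ω hω
  exact hfc _ hω

theorem lintegral_ageProcess_prmpLGFS_le (hρ : IsMemoryless ρ) (hπ : π ∈ causalPolicies m E I)
    (hX_meas : ∀ j k, Measurable (X j k)) (hξ_meas : Measurable ξ)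
    (hX_pos : ∀ᵐ ω ∂P, ∀ j k, 0 < X j k ω)
    (hlaw : P.map (fun ω => (ξ ω, fun j i => X j (1 + i) ω)) = (P.map ξ).prod (arrLaw m ρ))
    (u₀ : ℝ) {g : (ℝ≥0 → ℝ) → ℝ} (hg : IsAgePenalty g) :
    ∫⁻ ω, ENNReal.ofReal (g (ageProcess I u₀ X ξ (prmpLGFS m E I) ω)) ∂P ≤
        ∫⁻ ω, ENNReal.ofReal (g (ageProcess I u₀ X ξ π ω)) ∂P ∧
      ∫⁻ ω, ENNReal.ofReal (-g (ageProcess I u₀ X ξ π ω)) ∂P ≤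
        ∫⁻ ω, ENNReal.ofReal (-g (ageProcess I u₀ X ξ (prmpLGFS m E I) ω)) ∂P := by
  have hle := ae_seqPenalty_le hρ hπ hX_meas hξ_meas hX_pos hlaw u₀ hg
  have hL := prmpLGFS_mem_causalPolicies m E I
  have h1 : Measurable fun y : ℝ => ENNReal.ofReal y := ENNReal.measurable_ofReal
  have h2 : Measurable fun y : ℝ => ENNReal.ofReal (-y) := h1.comp measurable_neg
  constructor
  · rw [lintegral_ageProcess hρ hL hX_meas hξ_meas hX_pos hlaw u₀ hg h1,
      lintegral_ageProcess hρ hπ hX_meas hξ_meas hX_pos hlaw u₀ hg h1]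
    exact lintegral_mono_ae (hle.mono fun p hp => ENNReal.ofReal_le_ofReal hp)
  · rw [lintegral_ageProcess hρ hL hX_meas hξ_meas hX_pos hlaw u₀ hg h2,
      lintegral_ageProcess hρ hπ hX_meas hξ_meas hX_pos hlaw u₀ hg h2]
    exact lintegral_mono_ae (hle.mono fun p hp => ENNReal.ofReal_le_ofReal (neg_le_neg hp))

/-- The probability of an upper set is the integral of its indicator, which is an age penalty. -/
theorem processStLE_prmpLGFS (hρ : IsMemoryless ρ) (hπ : π ∈ causalPolicies m E I)
    (hX_meas : ∀ j k, Measurable (X j k)) (hξ_meas : Measurable ξ)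
    (hX_pos : ∀ᵐ ω ∂P, ∀ j k, 0 < X j k ω)
    (hlaw : P.map (fun ω => (ξ ω, fun j i => X j (1 + i) ω)) = (P.map ξ).prod (arrLaw m ρ))
    (u₀ : ℝ) :
    ProcessStLE P (ageProcess I u₀ X ξ (prmpLGFS m E I)) (ageProcess I u₀ X ξ π) := by
  intro n t _ S hS hS'
  have key : ∀ π' ∈ causalPolicies m E I,
      ∫⁻ ω, ENNReal.ofReal (S.indicator (fun _ => (1 : ℝ))
        fun i => ageProcess I u₀ X ξ π' ω (t i)) ∂P =
        P ((fun ω i => ageProcess I u₀ X ξ π' ω (t i)) ⁻¹' S) := by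
    intro π' hπ'
    have hm : AEMeasurable (fun ω i => ageProcess I u₀ X ξ π' ω (t i)) P :=
      aemeasurable_pi_lambda _ fun i =>
        aemeasurable_ageProcess hρ hπ' hX_meas hξ_meas hX_pos hlaw u₀ (t i)
    rw [← lintegral_indicator_one₀ (hm.nullMeasurableSet_preimage hS)]
    refine lintegral_congr fun ω => ?_
    by_cases h : (fun i => ageProcess I u₀ X ξ π' ω (t i)) ∈ S
    · rw [Set.indicator_of_mem h, ENNReal.ofReal_one]
      exact (Set.indicator_of_mem (M := ℝ≥0∞)
        (s := (fun ω i => ageProcess I u₀ X ξ π' ω (t i)) ⁻¹' S) h 1).symm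
    · rw [Set.indicator_of_notMem h, ENNReal.ofReal_zero]
      exact (Set.indicator_of_notMem (M := ℝ≥0∞)
        (s := (fun ω i => ageProcess I u₀ X ξ π' ω (t i)) ⁻¹' S) h 1).symm
  rw [← key _ (prmpLGFS_mem_causalPolicies m E I), ← key π hπ]
  exact (lintegral_ageProcess_prmpLGFS_le hρ hπ hX_meas hξ_meas hX_pos hlaw u₀
    (isAgePenalty_indicator t hS hS')).1

end

end InfoUpdate

end

/-! ### Optimality of prmp-LGFS -/

open InfoUpdate MeasureTheory ProbabilityTheory in
theorem theorem1 {Ω E : Type*} [MeasurableSpace Ω] [MeasurableSpace E]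
    (P : Measure Ω) [IsProbabilityMeasure P]
    -- the number of servers, the input, and the freshest generation time before time `0`
    (m : ℕ) (I : Input) (u₀ : ℝ)
    -- service times: `X j k` is the duration of the `k`-th service at server `j`
    (μ : ℝ) (hμ : 0 < μ) (X : Fin m → ℕ → Ω → ℝ)
    (hX_meas : ∀ j k, Measurable (X j k))
    (hX_law : ∀ j k, P.map (X j k) = expMeasure μ)
    (hX_indep : iIndepFun (fun q : Fin m × ℕ => X q.1 q.2) P)
    -- the seed of randomized policies
    (ξ : Ω → E) (hξ_meas : Measurable ξ)
    (hξ_indep : IndepFun ξ (fun ω (q : Fin m × ℕ) => X q.1 q.2 ω) P) :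
    prmpLGFS m E I ∈ causalPolicies m E I ∧
    (∀ π ∈ causalPolicies m E I,
      ProcessStLE P (ageProcess I u₀ X ξ (prmpLGFS m E I)) (ageProcess I u₀ X ξ π)) ∧
    (∀ g : (NNReal → ℝ) → ℝ, IsAgePenalty g →
      HasExpectation P (fun ω => g (ageProcess I u₀ X ξ (prmpLGFS m E I) ω)) →
      IsLeast
        {v : EReal | ∃ π ∈ causalPolicies m E I,
          HasExpectation P (fun ω => g (ageProcess I u₀ X ξ π ω)) ∧
          v = expectation P (fun ω => g (ageProcess I u₀ X ξ π ω))}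
        (expectation P (fun ω => g (ageProcess I u₀ X ξ (prmpLGFS m E I) ω)))) := by
  have : IsProbabilityMeasure (expMeasure μ) := isProbabilityMeasure_expMeasure hμ
  have hρ := isMemoryless_expMeasure hμ
  have hX_pos : ∀ᵐ ω ∂P, ∀ j k, 0 < X j k ω := by
    simp only [ae_all_iff]
    intro j k
    have h := hρ.ae_pos
    rw [← hX_law j k] at h
    exact ae_of_ae_map (hX_meas j k).aemeasurable h
  have hlaw := map_seed_gaps hX_meas hX_law hX_indep hξ_meas hξ_indep
  have hL := prmpLGFS_mem_causalPolicies m E I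
  refine ⟨hL, fun π hπ => processStLE_prmpLGFS hρ hπ hX_meas hξ_meas hX_pos hlaw u₀,
    fun g hg hexp => ⟨⟨_, hL, hexp, rfl⟩, ?_⟩⟩
  rintro v ⟨π, hπ, -, rfl⟩
  obtain ⟨h1, h2⟩ := lintegral_ageProcess_prmpLGFS_le hρ hπ hX_meas hξ_meas hX_pos hlaw u₀ hg
  -- The positive part has the smaller and the negative part the larger integral under prmp-LGFS;
  -- subtraction in `EReal` respects this even at infinite values.
  exact EReal.sub_le_sub (EReal.coe_ennreal_le_coe_ennreal_iff.2 h1)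
    (EReal.coe_ennreal_le_coe_ennreal_iff.2 h2)
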